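/- **Setting.** Let $\Bbbk$ be a field. For a lattice $L$ with dual $L^*$ put $T_L=L\otimes\Bbbk^*=\operatorname{Spec}\Bbbk[L^*]$, and for $u\in L$ put $T_{L,u}=\operatorname{Spec}\Bbbk[v\in L^*\mid\langle u,v\rangle\ge 0]\supseteq T_L$. A seed $S=(N,I,E=\{e_i\}_{i\in I},F,[\cdot,\cdot])$ consists of a lattice $N$ of finite rank, a basis $E$ of a saturated sublattice $N_I\subseteq N$, a subset $F\subseteq I$ (the frozen indices; $I_{\mathrm{uf}}=I\setminus F$), and a $\mathbb Z$-valued bilinear form on $N$ with $[e_i,e_i]=0$ for $i\in I_{\mathrm{uf}}$. Let $M=N^*$, $M_I=N_I^*$ with dual basis $e_i^*$, $p_1(n)=[n,\cdot]$ and $p_2(n)=[\cdot,n]$ in $M$, $\overline p_1(n)=p_1(n)|_{N_I}\in M_I$, and $K_1=\ker p_1$. Assume that $p_2(e_i)\ne0$ for all $i\in I$, that $p_2(e_i)$ is primitive in $M$ for all $i\in F$, and that $\ker\overline p_1=K_1$ (which is automatic if $N_I=N$). *Cluster varieties.* $\mathcal X^\star$ is obtained from the torus $U_0=X_S=T_M$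 by gluing in charts $U_i=X_{S,i}$, $i\in I$. For $i\in I_{\mathrm{uf}}$, $U_i=T_M$ is glued to $U_0$ along the birational map $\mu_i\colon U_0\dashrightarrow U_i$, $\mu_i^\sharp(z^n)=z^n(1+z^{e_i})^{-[n,e_i]}$, restricted to the locus where it is biregular; for $i\in F$, $U_i=T_{M,p_2(e_i)}$ is glued along the inclusion $T_M\subset T_{M,p_2(e_i)}$; distinct $U_i,U_j$ are identified only through $U_0$. $\mathcal A^\star$ is obtained in the same way from $A_S=T_N$, with $\mu_i^\sharp(z^m)=z^m(1+z^{p_1(e_i)})^{-\langle e_i,m\rangle}$ for $i\in I_{\mathrm{uf}}$ and $T_N\subset T_{N,e_i}$ for $i\in F$. $\mathcal A^\star_{\mathrm{prin}}$ is the variety $\mathcal A^\star$ of the seed $(N_I\oplus M,I,\{(e_i,0)\},F,[\cdot,\cdot]_{\mathrm{prin}})$ with $[(n_1,m_1),(n_2,m_2)]_{\mathrm{prin}}=[n_1,n_2]+\langle n_1,m_2\rangle-\langle n_2,m_1\rangle$; its torus is $\operatorname{Spec}\Bbbk[M_I\oplus N]$. The formulas $\pi^\sharp(z^n)=z^{(0,n)}$,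 $\tilde p_2^\sharp(z^n)=z^{(\overline p_1(n),n)}$, $\lambda^\sharp(z^k)=z^k$ and $i^\sharp(z^k)=z^k$ ($n\in N$, $k\in K_1$) define morphisms $\pi\colon\mathcal A^\star_{\mathrm{prin}}\to T_M$, $\tilde p_2\colon\mathcal A^\star_{\mathrm{prin}}\to\mathcal X^\star$, $\lambda\colon\mathcal X^\star\to T_{K_1^*}$ and $i\colon T_M\to T_{K_1^*}$ with $\lambda\circ\tilde p_2=i\circ\pi$. For $\phi\in T_{K_1^*}$ and $t\in i^{-1}(\phi)\subset T_M$ ($\Bbbk$-points), let $\mathcal X^\star_\phi=\lambda^{-1}(\phi)$, $\mathcal A^\star_t=\pi^{-1}(t)$, and let $p_{2,t}\colon\mathcal A^\star_t\to\mathcal X^\star_\phi$ be the restriction of $\tilde p_2$. Assume that $z^{e_i}(\phi)\neq-1$ for every $i\in I_{\mathrm{uf}}$ with $e_i\in K_1$ (no condition if no such $e_i$ lies in $K_1$). *Universal torsor.* Write $X=\mathcal X^\star_\phi$, and $U_i$ also for $U_i\cap X$. For $m=\sum a_ie_i^*\in M_I$ let $W_\phi(m)=\sum_{i\in I_{\mathrm{uf}}}a_iE_{i,\phi}+\sum_{i\in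 F}a_iD_{i,\phi}$, where $E_{i,\phi}$ ($i\in I_{\mathrm{uf}}$) has the local equation $1+z^{e_i}$ on $U_i$ (in the coordinates of $U_i$) and $1$ on all other charts, and $D_{i,\phi}$ ($i\in F$) has the local equation $z^n$, for any $n\in N$ with $[n,e_i]=1$, on $U_i$ and $1$ on all other charts. If $X$ is integral and these are Cartier divisors, view $\mathcal O_X(m):=\mathcal O_X(W_\phi(m))$ as a subsheaf of the constant sheaf $K(X)$, and put $$\mathcal R=\bigoplus_{m\in M_I}\mathcal O_X(m)\,z^m\subset K(X)[M_I].$$ Let $\Lambda_0=\overline p_1(N)\subseteq M_I$. A homomorphism $\rho\colon\Lambda_0\to K(X)^\times$ is a *shifting family* if $\rho(m_0)\mathcal O_X(m)\subseteq\mathcal O_X(m+m_0)$ for all $m_0\in\Lambda_0$ and $m\in M_I$. Given one, let $\mathcal I_\rho(U)\subseteq\mathcal R(U)$ be the ideal generated by all $f-f\rho(m_0)z^{m_0}$ with $f\in\mathcal R(U)$ and $m_0\in\Lambda_0$, and let $\mathrm{UT}_X$ be the relative spectrum over $X$ of $\mathcal R/\mathcal I_\rho$, glued from the schemes $\operatorname{Spec}(\mathcal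 R(U)/\mathcal I_\rho(U))$ for $U\subseteq X$ affine open. **Theorem.** Under these assumptions, for every $\phi\in T_{K_1^*}$ and every $t\in i^{-1}(\phi)$: 1. $X=\mathcal X^\star_\phi$ is integral, the local equations above define Cartier divisors $W_\phi(m)$, and there is a shifting family $\rho$ with $\rho(\overline p_1(n))=z^n(t)\,z^{-n}$ for all $n\in N$. For affine open $U\subseteq X$ and $f\in\mathcal O_X(U)$, the ring $\mathcal R(D(f))/\mathcal I_\rho(D(f))$ is the localization of $\mathcal R(U)/\mathcal I_\rho(U)$ at $f$, so that $\mathrm{UT}_X$ is defined. 2. $\tilde p_2^\sharp$ induces an isomorphism $\mathcal A^\star_t\cong\mathrm{UT}_{\mathcal X^\star_\phi}$ over $\mathcal X^\star_\phi$. That is, there is a homomorphism of sheaves of $\mathcal O_X$-algebras $\theta\colon\mathcal R\to(p_{2,t})_*\mathcal O_{\mathcal A^\star_t}$ with the following properties. Whenever $U\subseteq U_0$, $s\in\mathcal O_X(U)$ and $m\in M_I$, one has $\theta(s z^m)=p_{2,t}^\sharp(s)\,z^{(m,0)}$ on the intersection of $p_{2,t}^{-1}(U)$ with the torus of $\mathcal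 A^\star_t$. The map $\theta$ kills $\mathcal I_\rho$. And there is an isomorphism $\Phi\colon\mathcal A^\star_t\to\mathrm{UT}_X$ of schemes over $X$ such that, for every affine open $U\subseteq X$, the restriction of $\Phi$ to $p_{2,t}^{-1}(U)$ is the morphism to $\operatorname{Spec}(\mathcal R(U)/\mathcal I_\rho(U))$ given by the map induced by $\theta_U$. -/

import Mathlib

universe u

open CategoryTheory CategoryTheory.Limits AlgebraicGeometry

noncomputable section

namespace Cluster

/-! ## Gluing charts to a central scheme -/

/-- A central scheme `X₀`, charts `X i`, and for each `i` an open immersion `j i` of an open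
subscheme `V i ⊆ X₀` into `X i`, along which `X i` is to be glued to `X₀`. -/
structure StarDatum (I : Type u) where
  X₀ : Scheme.{u}
  X : I → Scheme.{u}
  V : I → X₀.Opens
  j : ∀ i, (V i).toScheme ⟶ X i
  open_j : ∀ i, IsOpenImmersion (j i)

namespace StarDatum

variable {I : Type u} (D : StarDatum I)

instance (i : I) : IsOpenImmersion (D.j i) := D.open_j i

/-- The shape of the gluing diagram: the open subschemes of the centre, and the charts. -/
inductive Idx : Type u
  | op (W : D.X₀.Opens)
  | chart (i : I)

/-- `W ≤ W'` is inclusion, and `W ≤ chart i` means that `W` is contained in the gluing locus of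
the chart `i`. -/
inductive Idx.LE : D.Idx → D.Idx → Prop
  | op {W W' : D.X₀.Opens} (h : W ≤ W') : Idx.LE (.op W) (.op W')
  | toChart {W : D.X₀.Opens} {i : I} (h : W ≤ D.V i) : Idx.LE (.op W) (.chart i)
  | refl (i : I) : Idx.LE (.chart i) (.chart i)

instance : Preorder D.Idx where
  le := Idx.LE D
  le_refl a := by
    cases a
    · exact .op le_rfl
    · exact .refl _
  le_trans a b c hab hbc := by
    cases hab with
    | op h => cases hbc with
      | op h' => exact .op (h.trans h')
      | toChart h' => exact .toChart (h.trans h')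
    | toChart h => cases hbc; exact .toChart h
    | refl i => exact hbc

/-- The objects of the gluing diagram. -/
def obj : D.Idx → Scheme.{u}
  | .op W => W.toScheme
  | .chart i => D.X i

lemma op_le_op {W W' : D.X₀.Opens} (h : Idx.op W ≤ (Idx.op W' : D.Idx)) : W ≤ W' := by
  cases h; assumption

lemma op_le_chart {W : D.X₀.Opens} {i : I} (h : Idx.op W ≤ (Idx.chart i : D.Idx)) : W ≤ D.V i := by
  cases h; assumption

lemma not_chart_le_op {W : D.X₀.Opens} {i : I} (h : Idx.chart i ≤ (Idx.op W : D.Idx)) : False := by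
  cases h

lemma chart_le_chart {i i' : I} (h : Idx.chart i ≤ (Idx.chart i' : D.Idx)) : i = i' := by
  cases h; rfl

/-- The transition maps of the gluing diagram. -/
def map : ∀ {a b : D.Idx}, a ≤ b → (D.obj a ⟶ D.obj b)
  | .op _, .op _, h => D.X₀.homOfLE (D.op_le_op h)
  | .op _, .chart i, h => D.X₀.homOfLE (D.op_le_chart h) ≫ D.j i
  | .chart _, .op _, h => (D.not_chart_le_op h).elim
  | .chart _, .chart _, h => eqToHom (by rw [D.chart_le_chart h])

/-- The gluing diagram. -/
def diagram : D.Idx ⥤ Scheme.{u} where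
  obj := D.obj
  map f := D.map f.le
  map_id a := by
    cases a
    · exact Scheme.homOfLE_rfl _ _
    · rfl
  map_comp {a b c} f g := by
    obtain ⟨f⟩ := f
    obtain ⟨g⟩ := g
    obtain ⟨f⟩ := f
    obtain ⟨g⟩ := g
    cases f with
    | @op W W' h => cases g with
      | @op _ W'' h' => exact (Scheme.homOfLE_homOfLE D.X₀ h h').symm
      | @toChart _ i h' =>
        have e : D.X₀.homOfLE (h.trans h') ≫ D.j i = D.X₀.homOfLE h ≫ D.X₀.homOfLE h' ≫ D.j i := by
          rw [Scheme.homOfLE_homOfLE_assoc]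
        exact e
    | toChart h => cases g with
      | refl => exact (Category.comp_id _).symm
    | refl => cases g with
      | refl => exact (Category.comp_id _).symm

instance {a b : D.Idx} (f : a ⟶ b) : IsOpenImmersion (D.diagram.map f) := by
  obtain ⟨f⟩ := f
  obtain ⟨f⟩ := f
  cases f with
  | op h => exact inferInstanceAs (IsOpenImmersion (D.X₀.homOfLE h))
  | toChart h => exact inferInstanceAs (IsOpenImmersion (D.X₀.homOfLE h ≫ D.j _))
  | refl i => exact inferInstanceAs (IsOpenImmersion (𝟙 (D.X i)))

lemma exists_inf {W W' : D.X₀.Opens} (x : W) (y : W') (h : x.1 = y.1) :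
    ∃ z : (W ⊓ W' : D.X₀.Opens), D.X₀.homOfLE inf_le_left z = x ∧ D.X₀.homOfLE inf_le_right z = y :=
  ⟨⟨x.1, x.2, h ▸ y.2⟩, Subtype.ext (by simp), Subtype.ext (by simpa using h)⟩

lemma eq_of_homOfLE_eq {W W' W'' : D.X₀.Opens} (hW : W ≤ W'') (hW' : W' ≤ W'') (x : W) (y : W')
    (h : D.X₀.homOfLE hW x = D.X₀.homOfLE hW' y) : x.1 = y.1 := by
  simpa using congrArg Subtype.val h

lemma eq_of_comp_j_eq {W W' : D.X₀.Opens} {i : I} (hW : W ≤ D.V i) (hW' : W' ≤ D.V i) (x : W)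
    (y : W') (h : (D.X₀.homOfLE hW ≫ D.j i) x = (D.X₀.homOfLE hW' ≫ D.j i) y) : x.1 = y.1 := by
  exact D.eq_of_homOfLE_eq hW hW' x y ((D.j i).injective h)

instance : (D.diagram ⋙ Scheme.forget).IsLocallyDirected := by
  constructor
  rintro a b c ⟨⟨f⟩⟩ ⟨⟨g⟩⟩ x y h
  cases f with
  | refl => exact ⟨b, ⟨⟨g⟩⟩, 𝟙 b, y, h.symm, by simp⟩
  | @op W W'' hf =>
    cases g with
    | @op W' _ hg =>
      obtain ⟨z, hz, hz'⟩ := D.exists_inf x y (D.eq_of_homOfLE_eq hf hg x y h)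
      exact ⟨.op (W ⊓ W'), ⟨⟨.op inf_le_left⟩⟩, ⟨⟨.op inf_le_right⟩⟩, z, hz, hz'⟩
  | @toChart W i hf =>
    cases g with
    | refl => exact ⟨_, 𝟙 _, ⟨⟨.toChart hf⟩⟩, x, by simp, h⟩
    | @toChart W' _ hg =>
      obtain ⟨z, hz, hz'⟩ := D.exists_inf x y (D.eq_of_comp_j_eq hf hg x y h)
      exact ⟨.op (W ⊓ W'), ⟨⟨.op inf_le_left⟩⟩, ⟨⟨.op inf_le_right⟩⟩, z, hz, hz'⟩

/-- The scheme obtained by gluing every chart `X i` to the centre `X₀` along `V i`. -/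
def glued : Scheme.{u} := colimit D.diagram

/-- The inclusion of an open subscheme of the centre. -/
def ιOp (W : D.X₀.Opens) : W.toScheme ⟶ D.glued := colimit.ι D.diagram (.op W)

/-- The inclusion of the centre. -/
def ι₀ : D.X₀ ⟶ D.glued := D.X₀.topIso.inv ≫ D.ιOp ⊤

/-- The inclusion of a chart. -/
def ι (i : I) : D.X i ⟶ D.glued := colimit.ι D.diagram (.chart i)

instance (W : D.X₀.Opens) : IsOpenImmersion (D.ιOp W) :=
  inferInstanceAs (IsOpenImmersion (colimit.ι D.diagram (.op W)))

instance : IsOpenImmersion D.ι₀ :=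
  inferInstanceAs (IsOpenImmersion (D.X₀.topIso.inv ≫ D.ιOp ⊤))

instance (i : I) : IsOpenImmersion (D.ι i) :=
  inferInstanceAs (IsOpenImmersion (colimit.ι D.diagram (.chart i)))

section desc

variable {Y : Scheme.{u}} (f₀ : D.X₀ ⟶ Y) (f : ∀ i, D.X i ⟶ Y)

/-- The components of the cocone defined by compatible morphisms from the centre and the charts. -/
def descApp : ∀ a : D.Idx, D.obj a ⟶ Y
  | .op W => W.ι ≫ f₀
  | .chart i => f i

lemma descApp_naturality (h : ∀ i, (D.V i).ι ≫ f₀ = D.j i ≫ f i) {a b : D.Idx} (hab : a ≤ b) :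
    D.map hab ≫ D.descApp f₀ f b = D.descApp f₀ f a := by
  cases hab with
  | op hg => exact Scheme.homOfLE_ι_assoc D.X₀ hg f₀
  | @toChart W i hg =>
    have e : (D.X₀.homOfLE hg ≫ D.j i) ≫ f i = W.ι ≫ f₀ := by
      rw [Category.assoc, ← h, Scheme.homOfLE_ι_assoc]
    exact e
  | refl => exact Category.id_comp _

variable (h : ∀ i, (D.V i).ι ≫ f₀ = D.j i ≫ f i)

/-- Morphisms out of the glued scheme. -/
def desc : D.glued ⟶ Y :=
  colimit.desc D.diagram
    { pt := Y
      ι :=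
        { app := D.descApp f₀ f
          naturality := fun _ _ g ↦
            (D.descApp_naturality f₀ f h g.le).trans (Category.comp_id _).symm } }

lemma ιOp_desc (W : D.X₀.Opens) : D.ιOp W ≫ D.desc f₀ f h = W.ι ≫ f₀ :=
  colimit.ι_desc _ _

lemma ι₀_desc : D.ι₀ ≫ D.desc f₀ f h = f₀ := by
  rw [ι₀, Category.assoc, ιOp_desc]
  simp

lemma ι_desc (i : I) : D.ι i ≫ D.desc f₀ f h = f i :=
  colimit.ι_desc _ _

end desc

lemma ιOp_eq (W : D.X₀.Opens) : D.ιOp W = W.ι ≫ D.ι₀ := by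
  have h : D.X₀.homOfLE le_top ≫ D.ιOp ⊤ = D.ιOp W :=
    colimit.w D.diagram (⟨⟨Idx.LE.op le_top⟩⟩ : Idx.op W ⟶ Idx.op ⊤)
  have e : D.X₀.homOfLE le_top = W.ι ≫ D.X₀.topIso.inv := by
    rw [← cancel_mono (Scheme.Opens.ι ⊤)]
    simp
  rw [ι₀, ← h, e, Category.assoc]

/-- The gluing condition. -/
lemma ι_comp_ι₀ (i : I) : (D.V i).ι ≫ D.ι₀ = D.j i ≫ D.ι i := by
  have h : (D.X₀.homOfLE le_rfl ≫ D.j i) ≫ D.ι i = D.ιOp (D.V i) :=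
    colimit.w D.diagram (⟨⟨Idx.LE.toChart le_rfl⟩⟩ : Idx.op (D.V i) ⟶ Idx.chart i)
  rw [← ιOp_eq, ← h]
  simp

lemma hom_ext {Y : Scheme.{u}} {f g : D.glued ⟶ Y} (h₀ : D.ι₀ ≫ f = D.ι₀ ≫ g)
    (h : ∀ i, D.ι i ≫ f = D.ι i ≫ g) : f = g := by
  refine colimit.hom_ext fun a ↦ ?_
  cases a with
  | op W =>
    change D.ιOp W ≫ f = D.ιOp W ≫ g
    rw [ιOp_eq, Category.assoc, Category.assoc, h₀]
  | chart i => exact h i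

end StarDatum

/-- A star of gluings given by spans of open immersions `X₀ ← Z i → X i`. -/
def StarDatum.ofSpans {I : Type u} (X₀ : Scheme.{u}) (X Z : I → Scheme.{u})
    (a : ∀ i, Z i ⟶ X₀) (b : ∀ i, Z i ⟶ X i)
    [∀ i, IsOpenImmersion (a i)] [∀ i, IsOpenImmersion (b i)] : StarDatum I where
  X₀ := X₀
  X := X
  V i := (a i).opensRange
  j i := (a i).isoOpensRange.inv ≫ b i
  open_j _ := inferInstance

lemma StarDatum.ofSpans_glue_iff {I : Type u} {X₀ : Scheme.{u}} {X Z : I → Scheme.{u}}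
    {a : ∀ i, Z i ⟶ X₀} {b : ∀ i, Z i ⟶ X i}
    [∀ i, IsOpenImmersion (a i)] [∀ i, IsOpenImmersion (b i)] (i : I) {Y : Scheme.{u}}
    (f₀ : X₀ ⟶ Y) (f : X i ⟶ Y) :
    ((StarDatum.ofSpans X₀ X Z a b).V i).ι ≫ f₀ = (StarDatum.ofSpans X₀ X Z a b).j i ≫ f ↔
      a i ≫ f₀ = b i ≫ f := by
  change (a i).opensRange.ι ≫ f₀ = ((a i).isoOpensRange.inv ≫ b i) ≫ f ↔ _
  rw [Category.assoc, ← cancel_epi (a i).isoOpensRange.hom]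
  simp

/-! ## Gluing tori along mutations -/

/-- Combinatorial data for attaching charts to the torus `T_L = Spec 𝕜[Q]`, where `Q = L*`:
for each `i` a cocharacter `u i ∈ L`, seen as a map `Q → ℤ`, and a character `ψ i ∈ Q`, together
with the set `F` of frozen indices. -/
structure MutationDatum (Q I : Type u) [AddCommGroup Q] where
  u : I → Q →+ ℤ
  ψ : I → Q
  F : Set I
  u_ψ : ∀ i, i ∉ F → u i (ψ i) = 0

namespace MutationDatum

variable {Q Q' I : Type u} [AddCommGroup Q] [AddCommGroup Q']

/-- The exponents of the monomials that are regular on the chart of index `i`: all of `Q` if `i` is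
not frozen (the chart is then a torus), and those with `⟨u i, q⟩ ≥ 0` if `i` is frozen (the chart
is then the partial compactification `T_{L, u i}`). -/
def chartMonoid (D : MutationDatum Q I) (i : I) : AddSubmonoid Q where
  carrier := {q | i ∈ D.F → 0 ≤ D.u i q}
  zero_mem' := by simp
  add_mem' {a b} ha hb := fun hi ↦ by
    rw [map_add]
    exact add_nonneg (ha hi) (hb hi)

variable (𝕜 : Type u) [Field 𝕜] (D : MutationDatum Q I)

open Classical in
/-- The function `1 + z^ψ` whose nonvanishing locus is where the mutation of index `i` is
biregular. For frozen `i` the mutation is the inclusion of the whole torus, so we take `1`. -/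
def wall (i : I) : AddMonoidAlgebra 𝕜 Q :=
  if i ∈ D.F then 1 else 1 + AddMonoidAlgebra.single (D.ψ i) 1

/-- The coordinate ring of the gluing locus of the chart `i`. -/
abbrev OverlapRing (i : I) : Type u := Localization.Away (D.wall 𝕜 i)

/-- `1 + z^ψ` as a unit on the gluing locus. -/
def wallUnit (i : I) : (D.OverlapRing 𝕜 i)ˣ :=
  (IsLocalization.Away.algebraMap_isUnit (S := D.OverlapRing 𝕜 i) (D.wall 𝕜 i)).unit

lemma val_wallUnit (i : I) :
    (D.wallUnit 𝕜 i : D.OverlapRing 𝕜 i) = algebraMap (AddMonoidAlgebra 𝕜 Q) _ (D.wall 𝕜 i) := rfl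

/-- `z^q ↦ z^q (1 + z^ψ)^(c ⟨u i, q⟩)` -/
def twistHom (i : I) (c : ℤ) : Multiplicative Q →* D.OverlapRing 𝕜 i where
  toFun q := algebraMap (AddMonoidAlgebra 𝕜 Q) _ (AddMonoidAlgebra.single q.toAdd 1) *
    ((D.wallUnit 𝕜 i ^ (c * D.u i q.toAdd) : (D.OverlapRing 𝕜 i)ˣ) : D.OverlapRing 𝕜 i)
  map_one' := by
    simp [← AddMonoidAlgebra.one_def]
  map_mul' a b := by
    rw [toAdd_mul, map_add, mul_add, zpow_add, Units.val_mul,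
      show AddMonoidAlgebra.single (a.toAdd + b.toAdd) (1 : 𝕜) =
        AddMonoidAlgebra.single a.toAdd 1 * AddMonoidAlgebra.single b.toAdd 1 by
        rw [AddMonoidAlgebra.single_mul_single, one_mul], map_mul]
    ring

/-- The map `z^q ↦ z^q (1 + z^ψ)^(-⟨u i, q⟩)` from functions on the chart of index `i` to functions
on the gluing locus: the pull back along the mutation `μ_{u i, ψ i}`, or the restriction along the
inclusion if `i` is frozen. -/
def mutationMap (i : I) : AddMonoidAlgebra 𝕜 (D.chartMonoid i) →ₐ[𝕜] D.OverlapRing 𝕜 i :=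
  AddMonoidAlgebra.lift 𝕜 _ _
    ((D.twistHom 𝕜 i (-1)).comp (AddMonoidHom.toMultiplicative (D.chartMonoid i).subtype))

lemma mutationMap_single (i : I) (q : D.chartMonoid i) :
    D.mutationMap 𝕜 i (AddMonoidAlgebra.single q 1) =
      algebraMap (AddMonoidAlgebra 𝕜 Q) _ (AddMonoidAlgebra.single q.1 1) *
        ((D.wallUnit 𝕜 i ^ (-D.u i q.1) : (D.OverlapRing 𝕜 i)ˣ) : D.OverlapRing 𝕜 i) := by
  simp [mutationMap, twistHom]

lemma twist_wall (i : I) (c : ℤ) :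
    AddMonoidAlgebra.lift 𝕜 _ _ (D.twistHom 𝕜 i c) (D.wall 𝕜 i) =
      algebraMap (AddMonoidAlgebra 𝕜 Q) _ (D.wall 𝕜 i) := by
  by_cases hi : i ∈ D.F
  · simp [wall, hi]
  · simp [wall, hi, twistHom, D.u_ψ i hi]

/-- The automorphism `z^q ↦ z^q (1 + z^ψ)^(c ⟨u i, q⟩)` of functions on the gluing locus. -/
def twist (i : I) (c : ℤ) : D.OverlapRing 𝕜 i →+* D.OverlapRing 𝕜 i :=
  IsLocalization.Away.lift (D.wall 𝕜 i)
    (g := (AddMonoidAlgebra.lift 𝕜 _ _ (D.twistHom 𝕜 i c)).toRingHom) <| by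
    change IsUnit (AddMonoidAlgebra.lift 𝕜 _ _ (D.twistHom 𝕜 i c) (D.wall 𝕜 i))
    rw [twist_wall]
    exact IsLocalization.Away.algebraMap_isUnit _

lemma twist_algebraMap (i : I) (c : ℤ) (x : AddMonoidAlgebra 𝕜 Q) :
    D.twist 𝕜 i c (algebraMap _ _ x) = AddMonoidAlgebra.lift 𝕜 _ _ (D.twistHom 𝕜 i c) x :=
  IsLocalization.Away.lift_eq _ _ _

lemma twist_wallUnit (i : I) (c n : ℤ) :
    D.twist 𝕜 i c ((D.wallUnit 𝕜 i ^ n : (D.OverlapRing 𝕜 i)ˣ) : D.OverlapRing 𝕜 i) =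
      ((D.wallUnit 𝕜 i ^ n : (D.OverlapRing 𝕜 i)ˣ) : D.OverlapRing 𝕜 i) := by
  have h : Units.map (D.twist 𝕜 i c).toMonoidHom (D.wallUnit 𝕜 i) = D.wallUnit 𝕜 i := by
    ext
    change D.twist 𝕜 i c _ = _
    rw [val_wallUnit, twist_algebraMap, twist_wall]
  change (Units.map (D.twist 𝕜 i c).toMonoidHom (D.wallUnit 𝕜 i ^ n) : D.OverlapRing 𝕜 i) = _
  rw [map_zpow, h]

lemma twist_comp_twist (i : I) {c d : ℤ} (h : c + d = 0) :
    (D.twist 𝕜 i c).comp (D.twist 𝕜 i d) = RingHom.id _ := by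
  refine IsLocalization.ringHom_ext (Submonoid.powers (D.wall 𝕜 i)) ?_
  refine AddMonoidAlgebra.ringHom_ext (fun r ↦ ?_) (fun q ↦ ?_)
  · have : (AddMonoidAlgebra.single (0 : Q) r : AddMonoidAlgebra 𝕜 Q) = algebraMap 𝕜 _ r := rfl
    simp only [RingHom.comp_apply, twist_algebraMap, RingHom.id_apply, this, AlgHom.commutes]
    rw [IsScalarTower.algebraMap_apply 𝕜 (AddMonoidAlgebra 𝕜 Q) (D.OverlapRing 𝕜 i),
      twist_algebraMap, AlgHom.commutes]
    rw [← IsScalarTower.algebraMap_apply]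
  · simp only [RingHom.comp_apply, twist_algebraMap, RingHom.id_apply,
      AddMonoidAlgebra.lift_single, one_smul, twistHom, MonoidHom.coe_mk, OneHom.coe_mk,
      toAdd_ofAdd, map_mul, twist_wallUnit]
    rw [mul_assoc, ← Units.val_mul, ← zpow_add, ← add_mul, h]
    simp

instance isIso_twist (i : I) (c : ℤ) : IsIso (Spec.map (CommRingCat.ofHom (D.twist 𝕜 i c))) := by
  have : IsIso (CommRingCat.ofHom (D.twist 𝕜 i c)) := by
    refine ⟨CommRingCat.ofHom (D.twist 𝕜 i (-c)), ?_, ?_⟩ <;>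
    · rw [← CommRingCat.ofHom_comp, twist_comp_twist _ _ _ (by ring)]
      rfl
  infer_instance

/-- The inclusion of functions on a chart into functions on the torus (with no mutation). -/
def chartIncl (i : I) : AddMonoidAlgebra 𝕜 (D.chartMonoid i) →+* AddMonoidAlgebra 𝕜 Q :=
  AddMonoidAlgebra.mapDomainRingHom 𝕜 (D.chartMonoid i).subtype

lemma exists_add_nsmul_mem (i : I) :
    ∃ v : D.chartMonoid i, ∀ q : Q, ∃ n₀ : ℕ, ∀ n ≥ n₀, q + n • v.1 ∈ D.chartMonoid i := by
  have key : ∀ v : Q, 0 < D.u i v → ∀ q : Q, ∃ n₀ : ℕ, ∀ n ≥ n₀, q + n • v ∈ D.chartMonoid i := by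
    intro v hv q
    refine ⟨(D.u i q).natAbs, fun n hn _ ↦ ?_⟩
    rw [map_add, map_nsmul, nsmul_eq_mul]
    have h1 : -((D.u i q).natAbs : ℤ) ≤ D.u i q := by omega
    have h2 : ((D.u i q).natAbs : ℤ) ≤ n := by exact_mod_cast hn
    nlinarith
  by_cases h : ∃ v, D.u i v ≠ 0
  · obtain ⟨v, hv⟩ := h
    rcases lt_or_gt_of_ne hv with hv | hv
    · have : 0 < D.u i (-v) := by rw [map_neg]; omega
      exact ⟨⟨-v, fun _ ↦ this.le⟩, key _ this⟩
    · exact ⟨⟨v, fun _ ↦ le_of_lt hv⟩, key _ hv⟩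
  · push Not at h
    exact ⟨0, fun q ↦ ⟨0, fun n _ _ ↦ by simp [h]⟩⟩

lemma chartIncl_single (i : I) (q : D.chartMonoid i) (r : 𝕜) :
    D.chartIncl 𝕜 i (AddMonoidAlgebra.single q r) = AddMonoidAlgebra.single q.1 r := by
  simp [chartIncl]

lemma chartIncl_injective (i : I) : Function.Injective (D.chartIncl 𝕜 i) :=
  AddMonoidAlgebra.mapDomain_injective Subtype.val_injective

lemma isLocalization_chartIncl (i : I) (v : D.chartMonoid i)
    (hv : ∀ q : Q, ∃ n₀ : ℕ, ∀ n ≥ n₀, q + n • v.1 ∈ D.chartMonoid i) :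
    letI := (D.chartIncl 𝕜 i).toAlgebra
    IsLocalization.Away (AddMonoidAlgebra.single v 1 : AddMonoidAlgebra 𝕜 (D.chartMonoid i))
      (AddMonoidAlgebra 𝕜 Q) := by
  let := (D.chartIncl 𝕜 i).toAlgebra
  have hpow : ∀ n : ℕ, D.chartIncl 𝕜 i (AddMonoidAlgebra.single v 1 ^ n) =
      AddMonoidAlgebra.single (n • v.1) 1 := fun n ↦ by
    rw [AddMonoidAlgebra.single_pow, chartIncl_single, one_pow]
    rfl
  have hs : ∀ z : AddMonoidAlgebra 𝕜 Q, ∃ n₀ : ℕ, ∀ n ≥ n₀,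
      ∃ y, z * AddMonoidAlgebra.single (n • v.1) 1 = D.chartIncl 𝕜 i y := by
    intro z
    induction z using AddMonoidAlgebra.induction_linear with
    | zero => exact ⟨0, fun n _ ↦ ⟨0, by simp⟩⟩
    | add f g hf hg =>
      obtain ⟨a, ha⟩ := hf
      obtain ⟨b, hb⟩ := hg
      refine ⟨max a b, fun n hn ↦ ?_⟩
      obtain ⟨y, hy⟩ := ha n (le_trans (le_max_left _ _) hn)
      obtain ⟨y', hy'⟩ := hb n (le_trans (le_max_right _ _) hn)
      exact ⟨y + y', by rw [add_mul, hy, hy', map_add]⟩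
    | single q r =>
      obtain ⟨n₀, h⟩ := hv q
      refine ⟨n₀, fun n hn ↦ ⟨AddMonoidAlgebra.single ⟨_, h n hn⟩ r, ?_⟩⟩
      rw [chartIncl_single, AddMonoidAlgebra.single_mul_single, mul_one]
  refine (isLocalization_iff _ _).mpr ⟨?_, ?_, ?_⟩
  · rintro ⟨_, n, rfl⟩
    refine IsUnit.of_mul_eq_one (AddMonoidAlgebra.single (-(n • v.1)) 1) ?_
    change D.chartIncl 𝕜 i (AddMonoidAlgebra.single v 1 ^ n) * _ = _
    rw [hpow, AddMonoidAlgebra.single_mul_single, add_neg_cancel, mul_one]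
    rfl
  · intro z
    obtain ⟨n, hn⟩ := hs z
    obtain ⟨y, hy⟩ := hn n le_rfl
    refine ⟨⟨y, ⟨_, n, rfl⟩⟩, ?_⟩
    change z * D.chartIncl 𝕜 i (AddMonoidAlgebra.single v 1 ^ n) = D.chartIncl 𝕜 i y
    rw [hpow, hy]
  · intro x y hxy
    exact ⟨1, by rw [D.chartIncl_injective 𝕜 i hxy]⟩

instance isOpenImmersion_chartIncl (i : I) :
    IsOpenImmersion (Spec.map (CommRingCat.ofHom (D.chartIncl 𝕜 i))) := by
  obtain ⟨v, hv⟩ := D.exists_add_nsmul_mem i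
  have := D.isLocalization_chartIncl 𝕜 i v hv
  let := (D.chartIncl 𝕜 i).toAlgebra
  exact IsOpenImmersion.of_isLocalization
    (AddMonoidAlgebra.single v 1 : AddMonoidAlgebra 𝕜 (D.chartMonoid i))

lemma mutationMap_eq (i : I) :
    (D.mutationMap 𝕜 i).toRingHom = ((D.twist 𝕜 i (-1)).comp
      (algebraMap (AddMonoidAlgebra 𝕜 Q) (D.OverlapRing 𝕜 i))).comp (D.chartIncl 𝕜 i) := by
  refine AddMonoidAlgebra.ringHom_ext (fun r ↦ ?_) (fun q ↦ ?_)
  · simp [mutationMap, chartIncl, twist_algebraMap]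
  · simp [mutationMap, chartIncl, twist_algebraMap]

instance isOpenImmersion_mutationMap (i : I) :
    IsOpenImmersion (Spec.map (CommRingCat.ofHom (D.mutationMap 𝕜 i).toRingHom)) := by
  rw [mutationMap_eq, CommRingCat.ofHom_comp, CommRingCat.ofHom_comp, Spec.map_comp, Spec.map_comp]
  have : IsOpenImmersion (Spec.map (CommRingCat.ofHom
      (algebraMap (AddMonoidAlgebra 𝕜 Q) (D.OverlapRing 𝕜 i)))) :=
    IsOpenImmersion.of_isLocalization (D.wall 𝕜 i)
  infer_instance

instance isOpenImmersion_overlap (i : I) :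
    IsOpenImmersion (Spec.map (CommRingCat.ofHom
      (algebraMap (AddMonoidAlgebra 𝕜 Q) (D.OverlapRing 𝕜 i)))) :=
  IsOpenImmersion.of_isLocalization (D.wall 𝕜 i)

/-- The torus `Spec 𝕜[Q]` together with the charts to be glued to it by (frozen) mutations. -/
def star : StarDatum I :=
  StarDatum.ofSpans (Spec (.of (AddMonoidAlgebra 𝕜 Q)))
    (fun i ↦ Spec (.of (AddMonoidAlgebra 𝕜 (D.chartMonoid i))))
    (fun i ↦ Spec (.of (D.OverlapRing 𝕜 i)))
    (fun i ↦ Spec.map (CommRingCat.ofHom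
      (algebraMap (AddMonoidAlgebra 𝕜 Q) (D.OverlapRing 𝕜 i))))
    (fun i ↦ Spec.map (CommRingCat.ofHom (D.mutationMap 𝕜 i).toRingHom))

/-- The scheme obtained from the torus by gluing in all charts. -/
def space : Scheme.{u} := (D.star 𝕜).glued

/-- The inclusion of the torus. -/
def torus : Spec (.of (AddMonoidAlgebra 𝕜 Q)) ⟶ D.space 𝕜 := (D.star 𝕜).ι₀

/-- The inclusion of the chart of index `i`. -/
def chart (i : I) : Spec (.of (AddMonoidAlgebra 𝕜 (D.chartMonoid i))) ⟶ D.space 𝕜 :=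
  (D.star 𝕜).ι i

instance : IsOpenImmersion (D.torus 𝕜) := inferInstanceAs (IsOpenImmersion (D.star 𝕜).ι₀)

instance (i : I) : IsOpenImmersion (D.chart 𝕜 i) :=
  inferInstanceAs (IsOpenImmersion ((D.star 𝕜).ι i))

/-- The gluing condition. -/
lemma overlap_torus (i : I) :
    Spec.map (CommRingCat.ofHom (algebraMap (AddMonoidAlgebra 𝕜 Q) (D.OverlapRing 𝕜 i))) ≫
        D.torus 𝕜 =
      Spec.map (CommRingCat.ofHom (D.mutationMap 𝕜 i).toRingHom) ≫ D.chart 𝕜 i :=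
  (StarDatum.ofSpans_glue_iff i _ _).mp ((D.star 𝕜).ι_comp_ι₀ i)

/-- Morphisms out of the glued space. -/
def desc {Y : Scheme.{u}} (f₀ : Spec (.of (AddMonoidAlgebra 𝕜 Q)) ⟶ Y)
    (f : ∀ i, Spec (.of (AddMonoidAlgebra 𝕜 (D.chartMonoid i))) ⟶ Y)
    (h : ∀ i, Spec.map (CommRingCat.ofHom
        (algebraMap (AddMonoidAlgebra 𝕜 Q) (D.OverlapRing 𝕜 i))) ≫ f₀ =
      Spec.map (CommRingCat.ofHom (D.mutationMap 𝕜 i).toRingHom) ≫ f i) : D.space 𝕜 ⟶ Y :=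
  (D.star 𝕜).desc f₀ f fun i ↦ (StarDatum.ofSpans_glue_iff i _ _).mpr (h i)

section desc

variable {Y : Scheme.{u}} (f₀ : Spec (.of (AddMonoidAlgebra 𝕜 Q)) ⟶ Y)
    (f : ∀ i, Spec (.of (AddMonoidAlgebra 𝕜 (D.chartMonoid i))) ⟶ Y)
    (h : ∀ i, Spec.map (CommRingCat.ofHom
        (algebraMap (AddMonoidAlgebra 𝕜 Q) (D.OverlapRing 𝕜 i))) ≫ f₀ =
      Spec.map (CommRingCat.ofHom (D.mutationMap 𝕜 i).toRingHom) ≫ f i)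

lemma torus_desc : D.torus 𝕜 ≫ D.desc 𝕜 f₀ f h = f₀ := (D.star 𝕜).ι₀_desc _ _ _

lemma chart_desc (i : I) : D.chart 𝕜 i ≫ D.desc 𝕜 f₀ f h = f i := (D.star 𝕜).ι_desc _ _ _ i

end desc

lemma hom_ext {Y : Scheme.{u}} {f g : D.space 𝕜 ⟶ Y} (h₀ : D.torus 𝕜 ≫ f = D.torus 𝕜 ≫ g)
    (h : ∀ i, D.chart 𝕜 i ≫ f = D.chart 𝕜 i ≫ g) : f = g :=
  (D.star 𝕜).hom_ext h₀ h

/-! ### Monomial morphisms -/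

section Hom

variable {D} {D' : MutationDatum Q' I}

/-- A homomorphism of character lattices compatible with the mutation data. -/
structure Hom (D : MutationDatum Q I) (D' : MutationDatum Q' I) where
  toHom : Q →+ Q'
  F_eq : D'.F = D.F
  u_apply : ∀ i q, D'.u i (toHom q) = D.u i q
  ψ_apply : ∀ i, toHom (D.ψ i) = D'.ψ i

variable (h : Hom D D')

/-- The restriction of a homomorphism of character lattices to the charts. -/
def Hom.onChart (i : I) : D.chartMonoid i →+ D'.chartMonoid i where
  toFun q := ⟨h.toHom q.1, fun hi ↦ by rw [h.u_apply]; exact q.2 (h.F_eq ▸ hi)⟩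
  map_zero' := Subtype.ext (map_zero _)
  map_add' _ _ := Subtype.ext (map_add _ _ _)

lemma Hom.map_wall (i : I) :
    AddMonoidAlgebra.mapDomainRingHom 𝕜 h.toHom (D.wall 𝕜 i) = D'.wall 𝕜 i := by
  by_cases hi : i ∈ D.F
  · simp [wall, hi, h.F_eq]
  · simp only [wall, hi, h.F_eq, if_false, map_add, map_one]
    rw [AddMonoidAlgebra.mapDomainRingHom_apply, AddMonoidAlgebra.mapDomain_single]
    exact congrArg (fun q ↦ 1 + AddMonoidAlgebra.single q 1) (h.ψ_apply i)

/-- The map induced on functions on the gluing loci. -/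
def Hom.onOverlap (i : I) : D.OverlapRing 𝕜 i →+* D'.OverlapRing 𝕜 i :=
  IsLocalization.Away.lift (D.wall 𝕜 i)
    (g := (algebraMap _ (D'.OverlapRing 𝕜 i)).comp
      (AddMonoidAlgebra.mapDomainRingHom 𝕜 h.toHom)) <| by
    rw [RingHom.comp_apply, h.map_wall 𝕜]
    exact IsLocalization.Away.algebraMap_isUnit _

lemma Hom.onOverlap_algebraMap (i : I) (x : AddMonoidAlgebra 𝕜 Q) :
    h.onOverlap 𝕜 i (algebraMap _ _ x) =
      algebraMap _ _ (AddMonoidAlgebra.mapDomainRingHom 𝕜 h.toHom x) :=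
  IsLocalization.Away.lift_eq _ _ _

lemma Hom.onOverlap_wallUnit (i : I) (n : ℤ) :
    h.onOverlap 𝕜 i ((D.wallUnit 𝕜 i ^ n : (D.OverlapRing 𝕜 i)ˣ) : D.OverlapRing 𝕜 i) =
      ((D'.wallUnit 𝕜 i ^ n : (D'.OverlapRing 𝕜 i)ˣ) : D'.OverlapRing 𝕜 i) := by
  have e : Units.map (h.onOverlap 𝕜 i).toMonoidHom (D.wallUnit 𝕜 i) = D'.wallUnit 𝕜 i := by
    ext
    change h.onOverlap 𝕜 i _ = _
    rw [val_wallUnit, onOverlap_algebraMap, map_wall, val_wallUnit]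
  change (Units.map (h.onOverlap 𝕜 i).toMonoidHom (D.wallUnit 𝕜 i ^ n) : D'.OverlapRing 𝕜 i) = _
  rw [map_zpow, e]

lemma Hom.onOverlap_comp_mutationMap (i : I) :
    (h.onOverlap 𝕜 i).comp (D.mutationMap 𝕜 i).toRingHom =
      (D'.mutationMap 𝕜 i).toRingHom.comp
        (AddMonoidAlgebra.mapDomainRingHom 𝕜 (h.onChart i)) := by
  refine AddMonoidAlgebra.ringHom_ext (fun r ↦ ?_) (fun q ↦ ?_)
  · have e : (AddMonoidAlgebra.single 0 r : AddMonoidAlgebra 𝕜 (D.chartMonoid i)) =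
      algebraMap 𝕜 _ r := rfl
    have e' : (AddMonoidAlgebra.single 0 r : AddMonoidAlgebra 𝕜 (D'.chartMonoid i)) =
      algebraMap 𝕜 _ r := rfl
    have e₀ : (AddMonoidAlgebra.single 0 r : AddMonoidAlgebra 𝕜 Q') =
      algebraMap 𝕜 _ r := rfl
    change h.onOverlap 𝕜 i (D.mutationMap 𝕜 i _) = D'.mutationMap 𝕜 i _
    rw [AddMonoidAlgebra.mapDomainRingHom_apply, AddMonoidAlgebra.mapDomain_single, map_zero, e, e',
      AlgHom.commutes, AlgHom.commutes,
      IsScalarTower.algebraMap_apply 𝕜 (AddMonoidAlgebra 𝕜 Q) (D.OverlapRing 𝕜 i),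
      IsScalarTower.algebraMap_apply 𝕜 (AddMonoidAlgebra 𝕜 Q') (D'.OverlapRing 𝕜 i),
      onOverlap_algebraMap]
    simp
  · change h.onOverlap 𝕜 i (D.mutationMap 𝕜 i _) = D'.mutationMap 𝕜 i _
    rw [AddMonoidAlgebra.mapDomainRingHom_apply, AddMonoidAlgebra.mapDomain_single,
      mutationMap_single, mutationMap_single, map_mul, onOverlap_algebraMap, onOverlap_wallUnit,
      AddMonoidAlgebra.mapDomainRingHom_apply, AddMonoidAlgebra.mapDomain_single]
    congr 4
    rw [← h.u_apply]
    rfl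

/-- The morphism of glued spaces which is `z^q ↦ z^(h q)` on the tori and on all charts. -/
def Hom.spaceMap : D'.space 𝕜 ⟶ D.space 𝕜 :=
  D'.desc 𝕜
    (Spec.map (CommRingCat.ofHom (AddMonoidAlgebra.mapDomainRingHom 𝕜 h.toHom)) ≫ D.torus 𝕜)
    (fun i ↦ Spec.map (CommRingCat.ofHom
      (AddMonoidAlgebra.mapDomainRingHom 𝕜 (h.onChart i))) ≫ D.chart 𝕜 i)
    (fun i ↦ by
      have e : (algebraMap (AddMonoidAlgebra 𝕜 Q') (D'.OverlapRing 𝕜 i)).comp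
            (AddMonoidAlgebra.mapDomainRingHom 𝕜 h.toHom) =
          (h.onOverlap 𝕜 i).comp (algebraMap (AddMonoidAlgebra 𝕜 Q) (D.OverlapRing 𝕜 i)) :=
        RingHom.ext fun x ↦ (h.onOverlap_algebraMap 𝕜 i x).symm
      have e₁ := congrArg (fun f ↦ Spec.map (CommRingCat.ofHom f)) e
      have e₂ := congrArg (fun f ↦ Spec.map (CommRingCat.ofHom f))
        (h.onOverlap_comp_mutationMap 𝕜 i)
      simp only [CommRingCat.ofHom_comp, Spec.map_comp] at e₁ e₂
      rw [← Category.assoc, e₁, ← Category.assoc, ← e₂, Category.assoc, Category.assoc,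
        overlap_torus])

lemma Hom.torus_spaceMap :
    D'.torus 𝕜 ≫ h.spaceMap 𝕜 =
      Spec.map (CommRingCat.ofHom (AddMonoidAlgebra.mapDomainRingHom 𝕜 h.toHom)) ≫ D.torus 𝕜 :=
  D'.torus_desc 𝕜 _ _ _

lemma Hom.chart_spaceMap (i : I) :
    D'.chart 𝕜 i ≫ h.spaceMap 𝕜 = Spec.map (CommRingCat.ofHom
      (AddMonoidAlgebra.mapDomainRingHom 𝕜 (h.onChart i))) ≫ D.chart 𝕜 i :=
  D'.chart_desc 𝕜 _ _ _ i

end Hom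

section Invariant

variable {K : Type u} [AddCommGroup K] (k : K →+ Q) (hk : ∀ i x, D.u i (k x) = 0)

/-- Characters of `K` as monomials on the charts. -/
def invariantOnChart (i : I) : K →+ D.chartMonoid i where
  toFun x := ⟨k x, fun _ ↦ (hk i x).ge⟩
  map_zero' := Subtype.ext (map_zero _)
  map_add' _ _ := Subtype.ext (map_add _ _ _)

lemma mutationMap_comp_invariant (i : I) :
    (D.mutationMap 𝕜 i).toRingHom.comp
        (AddMonoidAlgebra.mapDomainRingHom 𝕜 (D.invariantOnChart k hk i)) =
      (algebraMap (AddMonoidAlgebra 𝕜 Q) (D.OverlapRing 𝕜 i)).comp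
        (AddMonoidAlgebra.mapDomainRingHom 𝕜 k) := by
  refine AddMonoidAlgebra.ringHom_ext (fun r ↦ ?_) (fun q ↦ ?_)
  · have e' : (AddMonoidAlgebra.single 0 r : AddMonoidAlgebra 𝕜 (D.chartMonoid i)) =
      algebraMap 𝕜 _ r := rfl
    change D.mutationMap 𝕜 i _ = algebraMap (AddMonoidAlgebra 𝕜 Q) (D.OverlapRing 𝕜 i) _
    rw [AddMonoidAlgebra.mapDomainRingHom_apply, AddMonoidAlgebra.mapDomain_single, map_zero,
      e', AlgHom.commutes,
      IsScalarTower.algebraMap_apply 𝕜 (AddMonoidAlgebra 𝕜 Q) (D.OverlapRing 𝕜 i)]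
    simp
  · change D.mutationMap 𝕜 i _ = algebraMap (AddMonoidAlgebra 𝕜 Q) (D.OverlapRing 𝕜 i) _
    rw [AddMonoidAlgebra.mapDomainRingHom_apply, AddMonoidAlgebra.mapDomain_single,
      mutationMap_single]
    have e₀ : AddMonoidAlgebra.mapDomainRingHom 𝕜 k (AddMonoidAlgebra.single q 1) =
        AddMonoidAlgebra.single (k q) 1 := by
      rw [AddMonoidAlgebra.mapDomainRingHom_apply, AddMonoidAlgebra.mapDomain_single]
    have e : D.u i (D.invariantOnChart k hk i q).1 = 0 := hk i q
    rw [e, neg_zero, zpow_zero, Units.val_one, mul_one]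
    exact congrArg _ e₀.symm

/-- The fibration of the glued space over a torus defined by a lattice of monomials which are
invariant under all mutations. -/
def fibration : D.space 𝕜 ⟶ Spec (.of (AddMonoidAlgebra 𝕜 K)) :=
  D.desc 𝕜 (Spec.map (CommRingCat.ofHom (AddMonoidAlgebra.mapDomainRingHom 𝕜 k)))
    (fun i ↦ Spec.map (CommRingCat.ofHom
      (AddMonoidAlgebra.mapDomainRingHom 𝕜 (D.invariantOnChart k hk i))))
    (fun i ↦ by
      rw [← Spec.map_comp, ← Spec.map_comp, ← CommRingCat.ofHom_comp, ← CommRingCat.ofHom_comp,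
        mutationMap_comp_invariant])

lemma torus_fibration :
    D.torus 𝕜 ≫ D.fibration 𝕜 k hk =
      Spec.map (CommRingCat.ofHom (AddMonoidAlgebra.mapDomainRingHom 𝕜 k)) :=
  D.torus_desc 𝕜 _ _ _

lemma chart_fibration (i : I) :
    D.chart 𝕜 i ≫ D.fibration 𝕜 k hk = Spec.map (CommRingCat.ofHom
      (AddMonoidAlgebra.mapDomainRingHom 𝕜 (D.invariantOnChart k hk i))) :=
  D.chart_desc 𝕜 _ _ _ i

end Invariant

/-! ### Regular functions on the torus and on the charts -/

/-- The torus as an open subset. -/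
def torusOpen : (D.space 𝕜).Opens := D.torus 𝕜 ''ᵁ ⊤

/-- The chart of index `i` as an open subset. -/
def chartOpen (i : I) : (D.space 𝕜).Opens := D.chart 𝕜 i ''ᵁ ⊤

/-- A Laurent polynomial as a regular function on the torus. -/
def torusFun (a : AddMonoidAlgebra 𝕜 Q) : Γ(D.space 𝕜, D.torusOpen 𝕜) :=
  ((D.torus 𝕜).appIso ⊤).inv ((Scheme.ΓSpecIso (.of (AddMonoidAlgebra 𝕜 Q))).inv a)

/-- An element of the coordinate ring of a chart as a regular function on the chart. -/
def chartFun (i : I) (a : AddMonoidAlgebra 𝕜 (D.chartMonoid i)) :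
    Γ(D.space 𝕜, D.chartOpen 𝕜 i) :=
  ((D.chart 𝕜 i).appIso ⊤).inv
    ((Scheme.ΓSpecIso (.of (AddMonoidAlgebra 𝕜 (D.chartMonoid i)))).inv a)

end MutationDatum

/-! ## Lattices of Cartier divisors and universal torsors -/

section Torsor

variable {X : Scheme.{u}} [IsIntegral X]

/-- A regular function on an open subset as a rational function on `X` (and `0` if the open subset
is empty). -/
def ratFun {U : X.Opens} (s : Γ(X, U)) : X.functionField :=
  open Classical in if h : genericPoint X ∈ U then X.presheaf.germ U (genericPoint X) h s else 0

lemma algebraMap_germ_eq_ratFun {U : X.Opens} {x : X} (hx : x ∈ U) (s : Γ(X, U)) :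
    algebraMap (X.presheaf.stalk x) X.functionField (X.presheaf.germ U x hx s) = ratFun s := by
  have : Nonempty U := ⟨⟨x, hx⟩⟩
  have h : genericPoint X ∈ U :=
    ((genericPoint_spec X).mem_open_set_iff U.isOpen).mpr ⟨x, trivial, hx⟩
  rw [ratFun, dif_pos h, Scheme.algebraMap_germ_eq_germToFunctionField]

/-- A nonzero rational function as a unit of the function field (and `1` for the function `0`). -/
def ratUnit (f : X.functionField) : (X.functionField)ˣ :=
  open Classical in if h : f = 0 then 1 else Units.mk0 f h

/-- Local equations for a family of divisors on `X` indexed by a lattice `Λ`: on the open subset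
`U j`, the divisor `m ∈ Λ` has the local equation `eqn j m ∈ K(X)ˣ`, which is additive in `m`. -/
structure DivisorLattice (X : Scheme.{u}) [IsIntegral X] (Λ : Type u) [AddCommGroup Λ] where
  J : Type u
  U : J → X.Opens
  eqn : J → Λ →+ Additive (X.functionField)ˣ

namespace DivisorLattice

variable {Λ : Type u} [AddCommGroup Λ] (W : DivisorLattice X Λ)

/-- The local equations define Cartier divisors: they are given on an open cover, and any two of
them differ by a unit of the local ring wherever both are given. -/
def IsCartier : Prop :=
  (∀ x : X, ∃ j, x ∈ W.U j) ∧
    ∀ j j' x, x ∈ W.U j → x ∈ W.U j' → ∀ m, ∃ v : (X.presheaf.stalk x)ˣ,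
      ((W.eqn j m).toMul : X.functionField) =
        algebraMap (X.presheaf.stalk x) X.functionField v * ((W.eqn j' m).toMul : X.functionField)

/-- The stalk at `x` of the sheaf `𝒪_X(m)`, as a subgroup of the function field: `f` belongs to it
if `f` times a local equation of the divisor `m` at `x` is regular at `x`. -/
def stalk (x : X) (m : Λ) : AddSubgroup X.functionField where
  carrier := {f | ∀ j, x ∈ W.U j →
    ((W.eqn j m).toMul : X.functionField) * f ∈
      (algebraMap (X.presheaf.stalk x) X.functionField).range}
  zero_mem' j _ := by rw [mul_zero]; exact zero_mem _
  add_mem' ha hb j hj := by rw [mul_add]; exact add_mem (ha j hj) (hb j hj)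
  neg_mem' ha j hj := by rw [mul_neg]; exact neg_mem (ha j hj)

/-- The rational functions which are sections of `𝒪_X(m)` over `U`. -/
def sections (m : Λ) (U : X.Opens) : Set X.functionField :=
  {f | ∀ x ∈ U, f ∈ W.stalk x m}

lemma one_mem_stalk (x : X) : (1 : X.functionField) ∈ W.stalk x 0 := fun j _ ↦ by
  rw [map_zero, toMul_zero, Units.val_one, mul_one]
  exact one_mem _

lemma mul_mem_stalk {x : X} {m m' : Λ} {f g : X.functionField} (hf : f ∈ W.stalk x m)
    (hg : g ∈ W.stalk x m') : f * g ∈ W.stalk x (m + m') := fun j hj ↦ by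
  rw [map_add, toMul_add, Units.val_mul, mul_mul_mul_comm]
  exact mul_mem (hf j hj) (hg j hj)

/-- The stalk at `x` of `ℛ_{X,Λ} = ⨁ 𝒪_X(m) z^m`, as a subring of `K(X)[Λ]`. -/
def stalkRing (x : X) : Subring (AddMonoidAlgebra X.functionField Λ) where
  carrier := {F | ∀ m, F.coeff m ∈ W.stalk x m}
  zero_mem' _ := zero_mem _
  one_mem' m := by
    classical
    rw [AddMonoidAlgebra.one_def, AddMonoidAlgebra.coeff_single, Finsupp.single_apply]
    split_ifs with h
    · exact h ▸ W.one_mem_stalk x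
    · exact zero_mem _
  add_mem' ha hb m := add_mem (ha m) (hb m)
  neg_mem' ha m := neg_mem (ha m)
  mul_mem' {F G} ha hb m := by
    classical
    rw [AddMonoidAlgebra.coeff_mul]
    refine sum_mem fun a _ ↦ sum_mem fun b _ ↦ ?_
    dsimp only
    split_ifs with h
    · exact h ▸ W.mul_mem_stalk (ha a) (hb b)
    · exact zero_mem _

/-- The sections over `U` of `ℛ_{X,Λ} = ⨁ 𝒪_X(m) z^m`, inside those of the constant sheaf
`K(X)[Λ]`: constant functions on `U` whose value lies in the stalk at every point of `U`. (Constant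
functions on `U`, rather than just their values, so that the ring is `0` if `U` is empty.) -/
def ring (U : X.Opens) : Subring (U → AddMonoidAlgebra X.functionField Λ) where
  carrier := {F | (∀ x y, F x = F y) ∧ ∀ x : U, F x ∈ W.stalkRing x.1}
  zero_mem' := ⟨fun _ _ ↦ rfl, fun _ ↦ zero_mem _⟩
  one_mem' := ⟨fun _ _ ↦ rfl, fun _ ↦ one_mem _⟩
  add_mem' {F G} ha hb := ⟨fun x y ↦ by rw [Pi.add_apply, Pi.add_apply, ha.1 x y, hb.1 x y],
    fun x ↦ by rw [Pi.add_apply]; exact add_mem (ha.2 x) (hb.2 x)⟩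
  neg_mem' {F} ha := ⟨fun x y ↦ by rw [Pi.neg_apply, Pi.neg_apply, ha.1 x y],
    fun x ↦ by rw [Pi.neg_apply]; exact neg_mem (ha.2 x)⟩
  mul_mem' {F G} ha hb := ⟨fun x y ↦ by rw [Pi.mul_apply, Pi.mul_apply, ha.1 x y, hb.1 x y],
    fun x ↦ by rw [Pi.mul_apply]; exact mul_mem (ha.2 x) (hb.2 x)⟩

/-- Restriction of sections of `ℛ_{X,Λ}`. -/
def res {U V : X.Opens} (h : V ≤ U) : W.ring U →+* W.ring V :=
  RingHom.codRestrict
    ((RingHom.pi fun x : V ↦ Pi.evalRingHom _ (⟨x.1, h x.2⟩ : U)).comp (W.ring U).subtype) (W.ring V)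
    fun F ↦ ⟨fun _ _ ↦ F.2.1 _ _, fun x ↦ F.2.2 ⟨x.1, h x.2⟩⟩

lemma res_apply {U V : X.Opens} (h : V ≤ U) (F : W.ring U) (x : V) :
    (W.res h F).1 x = F.1 ⟨x.1, h x.2⟩ := rfl

/-- The sheaf of `Λ`-graded rings `ℛ_{X,Λ} = ⨁ 𝒪_X(m) z^m`. -/
def sheafR : X.Opensᵒᵖ ⥤ CommRingCat.{u} where
  obj U := .of (W.ring U.unop)
  map i := CommRingCat.ofHom (W.res i.unop.le)

/-- The regular function `s` as a section of `ℛ_{X,Λ}` of degree `0`. -/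
def ofRegular (U : X.Opens) : Γ(X, U) →+* W.ring U :=
  RingHom.codRestrict
    (RingHom.pi fun x : U ↦ AddMonoidAlgebra.singleZeroRingHom.comp
      ((algebraMap (X.presheaf.stalk x.1) X.functionField).comp
        (X.presheaf.germ U x.1 x.2).hom)) (W.ring U)
    fun s ↦ by
      refine ⟨fun x y ↦ ?_, fun x m ↦ ?_⟩
      · have := (algebraMap_germ_eq_ratFun x.2 s).trans (algebraMap_germ_eq_ratFun y.2 s).symm
        exact congrArg (AddMonoidAlgebra.single 0) this
      · change (AddMonoidAlgebra.single 0 (algebraMap (X.presheaf.stalk x.1) X.functionField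
          (X.presheaf.germ U x.1 x.2 s))).coeff m ∈ _
        classical
        rw [AddMonoidAlgebra.coeff_single, Finsupp.single_apply]
        split_ifs with h
        · subst h
          intro j _
          rw [map_zero, toMul_zero, Units.val_one, one_mul]
          exact ⟨_, rfl⟩
        · exact zero_mem _

lemma ofRegular_apply (U : X.Opens) (s : Γ(X, U)) (x : U) :
    (W.ofRegular U s).1 x = AddMonoidAlgebra.single 0
      (algebraMap (X.presheaf.stalk x.1) X.functionField (X.presheaf.germ U x.1 x.2 s)) := rfl

variable {Λ₀ : AddSubgroup Λ} (ρ : Λ₀ →+ Additive (X.functionField)ˣ)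

/-- `ρ` is a shifting family: multiplication by `ρ m₀` maps `𝒪_X(m)` into `𝒪_X(m + m₀)`. -/
def IsShiftingFamily : Prop :=
  ∀ (m₀ : Λ₀) (m : Λ) (U : X.Opens), ∀ f ∈ W.sections m U,
    ((ρ m₀).toMul : X.functionField) * f ∈ W.sections (m + m₀) U

/-- The ideal of `ℛ_{X,Λ}(U)` generated by the elements `f - f ρ(m₀) z^{m₀}`. -/
def shiftIdeal (U : X.Opens) : Ideal (W.ring U) :=
  Ideal.span {r | ∃ (f : W.ring U) (m₀ : Λ₀), ∀ x : U,
    r.1 x = f.1 x - f.1 x * AddMonoidAlgebra.single (m₀ : Λ) ((ρ m₀).toMul : X.functionField)}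

lemma shiftIdeal_le {U V : X.Opens} (h : V ≤ U) :
    W.shiftIdeal ρ U ≤ (W.shiftIdeal ρ V).comap (W.res h) := by
  rw [shiftIdeal, Ideal.span_le]
  rintro r ⟨f, m₀, hr⟩
  exact Ideal.subset_span ⟨W.res h f, m₀, fun x ↦ hr ⟨x.1, h x.2⟩⟩

/-- The quotient `ℛ_{X,Λ} / ℐ_{X,Λ,ρ}`. -/
def quotientAlgebra : X.Opensᵒᵖ ⥤ CommRingCat.{u} where
  obj U := .of (W.ring U.unop ⧸ W.shiftIdeal ρ U.unop)
  map i := CommRingCat.ofHom (Ideal.quotientMap _ (W.res i.unop.le) (W.shiftIdeal_le ρ i.unop.le))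
  map_id U := by
    refine CommRingCat.hom_ext (Ideal.Quotient.ringHom_ext ?_)
    rfl
  map_comp f g := by
    refine CommRingCat.hom_ext (Ideal.Quotient.ringHom_ext ?_)
    rfl

/-- The structure of an `𝒪_X`-algebra on `ℛ_{X,Λ} / ℐ_{X,Λ,ρ}`. -/
def quotientStructure : X.presheaf ⟶ W.quotientAlgebra ρ where
  app U := CommRingCat.ofHom ((Ideal.Quotient.mk _).comp (W.ofRegular U.unop))
  naturality U V i := by
    refine CommRingCat.hom_ext (RingHom.ext fun s ↦ ?_)
    refine congrArg (Ideal.Quotient.mk (W.shiftIdeal ρ V.unop)) (Subtype.ext (funext fun x ↦ ?_))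
    refine congrArg (AddMonoidAlgebra.single 0) ?_
    refine congrArg (algebraMap (X.presheaf.stalk x.1) X.functionField) ?_
    exact X.presheaf.germ_res_apply i.unop x.1 x.2 s

open Scheme.AffineZariskiSite in
/-- The `𝒪_X`-algebra `ℛ_{X,Λ} / ℐ_{X,Λ,ρ}` is quasi-coherent, in the form in which this is needed
to take its relative spectrum: for an affine open `U` and `f ∈ 𝒪_X(U)`, the sections over `D(f)` are
the localization at `f` of the sections over `U`. -/
def IsQuasiCoherent : Prop :=
  ((toOpensFunctor X).op.whiskerLeft (W.quotientStructure ρ)).Coequifibered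

open Scheme.AffineZariskiSite in
/-- The universal torsor `UT_X`: the relative spectrum of `ℛ_{X,Λ} / ℐ_{X,Λ,ρ}`, glued from the
affine schemes `Spec (ℛ_{X,Λ}(U) / ℐ_{X,Λ,ρ}(U))` over all affine open subsets `U` of `X`. -/
def universalTorsor (h : W.IsQuasiCoherent ρ) : Scheme.{u} :=
  (relativeGluingData h).glued

namespace universalTorsor

variable {W ρ} (h : W.IsQuasiCoherent ρ)

open Scheme.AffineZariskiSite in
/-- The structure morphism `UT_X ⟶ X`. -/
def toBase : universalTorsor W ρ h ⟶ X := (relativeGluingData h).toBase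

open Scheme.AffineZariskiSite in
/-- The inclusion of the part of `UT_X` over an affine open subset `U` of `X`. -/
def overAffine (U : X.affineOpens) :
    Spec (.of (W.ring U.1 ⧸ W.shiftIdeal ρ U.1)) ⟶ universalTorsor W ρ h :=
  (relativeGluingData h).cover.f U

end universalTorsor

end DivisorLattice

end Torsor

/-! ## Seeds and cluster varieties -/

/-- A seed `(N, I, E = {e i}, F, [·,·])`. No skew-symmetrizability is assumed. -/
structure Seed (N I : Type u) [AddCommGroup N] where
  /-- The elements `e i`, a basis of the sublattice `N_I` which they span. -/
  e : I → N
  linearIndependent_e : LinearIndependent ℤ e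
  /-- `N_I` is saturated in `N`. -/
  saturated : ∀ (c : ℤ) (n : N), c ≠ 0 →
    c • n ∈ Submodule.span ℤ (Set.range e) → n ∈ Submodule.span ℤ (Set.range e)
  /-- The frozen indices. -/
  F : Set I
  bracket : N →ₗ[ℤ] N →ₗ[ℤ] ℤ
  bracket_self : ∀ i, i ∉ F → bracket (e i) (e i) = 0

namespace Seed

variable {N I : Type u} [AddCommGroup N] (S : Seed N I)

/-- The sublattice `N_I` spanned by the `e i`. -/
def NI : Submodule ℤ N := Submodule.span ℤ (Set.range S.e)

/-- `e i` as an element of `N_I`. -/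
def eI (i : I) : S.NI := ⟨S.e i, Submodule.subset_span ⟨i, rfl⟩⟩

/-- `p₁ : N → M`, `n ↦ [n, ·]`. -/
def p₁ : N →ₗ[ℤ] Module.Dual ℤ N := S.bracket

/-- `p₂ : N → M`, `n ↦ [·, n]`. -/
def p₂ : N →ₗ[ℤ] Module.Dual ℤ N := S.bracket.flip

/-- `p̄₁ : N → M_I`, `n ↦ [n, ·]` restricted to `N_I`. -/
def pbar₁ : N →ₗ[ℤ] Module.Dual ℤ S.NI := S.NI.subtype.dualMap ∘ₗ S.p₁

/-- `K₁ = ker p₁`. -/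
def K₁ : Submodule ℤ N := LinearMap.ker S.p₁

/-- `p₂(e i) ≠ 0` for all `i`, and `p₂(e i)` is primitive in `M` for all frozen `i`. -/
structure IsAdmissible : Prop where
  p₂_ne_zero : ∀ i, S.p₂ (S.e i) ≠ 0
  p₂_primitive : ∀ i ∈ S.F, ∀ (c : ℤ) (m : Module.Dual ℤ N), S.p₂ (S.e i) = c • m → IsUnit c

/-- The `𝒜`-mutations `z^m ↦ z^m (1 + z^{p₁(e i)})^(-⟨e i, m⟩)` of `T_N = Spec 𝕜[M]`. -/
def aDatum : MutationDatum (Module.Dual ℤ N) I where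
  u i := (Module.Dual.eval ℤ N (S.e i)).toAddMonoidHom
  ψ i := S.p₁ (S.e i)
  F := S.F
  u_ψ i hi := S.bracket_self i hi

/-- The `𝒳`-mutations `z^n ↦ z^n (1 + z^{e i})^(-[n, e i])` of `T_M = Spec 𝕜[N]`. -/
def xDatum : MutationDatum N I where
  u i := (S.p₂ (S.e i)).toAddMonoidHom
  ψ i := S.e i
  F := S.F
  u_ψ i hi := S.bracket_self i hi

lemma linearIndependent_eI : LinearIndependent ℤ S.eI :=
  linearIndependent_span S.linearIndependent_e

lemma span_eI : Submodule.span ℤ (Set.range S.eI) = ⊤ := by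
  refine Submodule.map_injective_of_injective S.NI.subtype_injective ?_
  rw [Submodule.map_span, ← Set.range_comp, Submodule.map_top, Submodule.range_subtype]
  rfl

/-- The bilinear form `[(n₁, m₁), (n₂, m₂)] = [n₁, n₂] + ⟨n₁, m₂⟩ - ⟨n₂, m₁⟩` on `N_I ⊕ M`. -/
def prinBracket :
    (S.NI × Module.Dual ℤ N) →ₗ[ℤ] (S.NI × Module.Dual ℤ N) →ₗ[ℤ] ℤ :=
  LinearMap.mk₂ ℤ (fun x y ↦ S.bracket x.1 y.1 + y.2 x.1 - x.2 y.1)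
    (fun _ _ _ ↦ by simp; ring) (fun _ _ _ ↦ by simp; ring)
    (fun _ _ _ ↦ by simp; ring) (fun _ _ _ ↦ by simp; ring)

/-- The seed with principal coefficients. -/
def prin : Seed (S.NI × Module.Dual ℤ N) I where
  e i := (S.eI i, 0)
  linearIndependent_e := S.linearIndependent_eI.map'
    (LinearMap.inl ℤ S.NI (Module.Dual ℤ N)) (LinearMap.ker_eq_bot.mpr LinearMap.inl_injective)
  saturated c x hc h := by
    have hs : Submodule.span ℤ (Set.range fun i ↦ ((S.eI i, 0) : S.NI × Module.Dual ℤ N)) =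
        LinearMap.range (LinearMap.inl ℤ S.NI (Module.Dual ℤ N)) := by
      rw [LinearMap.range_eq_map, ← S.span_eI, Submodule.map_span, ← Set.range_comp]
      rfl
    rw [hs] at h ⊢
    obtain ⟨y, hy⟩ := h
    have hx : x.2 = 0 := by
      have h2 : (0 : Module.Dual ℤ N) = c • x.2 := congrArg Prod.snd hy
      refine LinearMap.ext fun n ↦ ?_
      have h3 : (0 : ℤ) = c * x.2 n := LinearMap.congr_fun h2 n
      exact (mul_eq_zero.mp h3.symm).resolve_left hc
    exact ⟨x.1, Prod.ext rfl hx.symm⟩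
  F := S.F
  bracket := S.prinBracket
  bracket_self i hi := by
    change S.bracket (S.e i) (S.e i) + (0 : Module.Dual ℤ N) (S.e i) -
      (0 : Module.Dual ℤ N) (S.e i) = 0
    rw [S.bracket_self i hi]
    rfl

variable (𝕜 : Type u) [Field 𝕜]

/-- The cluster variety `𝒜^⋆`. -/
abbrev aSpace : Scheme.{u} := S.aDatum.space 𝕜

/-- The cluster variety `𝒳^⋆`. -/
abbrev xSpace : Scheme.{u} := S.xDatum.space 𝕜

/-- The cluster variety `𝒜_prin^⋆` with principal coefficients. -/
abbrev aPrin : Scheme.{u} := S.prin.aSpace 𝕜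

/-- The element `(m, n)` of `M_prin = M_I ⊕ N`. -/
def prinChar (m : Module.Dual ℤ S.NI) (n : N) : Module.Dual ℤ (S.NI × Module.Dual ℤ N) :=
  m.coprod (Module.Dual.eval ℤ N n)

lemma prinChar_apply (m : Module.Dual ℤ S.NI) (n : N) (x : S.NI × Module.Dual ℤ N) :
    S.prinChar m n x = m x.1 + x.2 n := rfl

/-- The homomorphism `N → M_I ⊕ N`, `n ↦ (0, n)`. -/
def piHom : N →+ Module.Dual ℤ (S.NI × Module.Dual ℤ N) where
  toFun n := S.prinChar 0 n
  map_zero' := LinearMap.ext fun x ↦ by simp [prinChar_apply]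
  map_add' _ _ := LinearMap.ext fun x ↦ by simp [prinChar_apply]

/-- The morphism `π : 𝒜_prin^⋆ ⟶ T_M`, `z^n ↦ z^(0, n)`. -/
def pi : S.aPrin 𝕜 ⟶ Spec (.of (AddMonoidAlgebra 𝕜 N)) :=
  S.prin.aDatum.fibration 𝕜 S.piHom
    (fun i n ↦ by
      change S.prinChar 0 n (S.eI i, 0) = 0
      simp [prinChar_apply])

/-- The morphism `λ : 𝒳^⋆ ⟶ T_{K₁*}`, `z^k ↦ z^k`. -/
def lam : S.xSpace 𝕜 ⟶ Spec (.of (AddMonoidAlgebra 𝕜 S.K₁)) :=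
  S.xDatum.fibration 𝕜 S.K₁.subtype.toAddMonoidHom (fun i k ↦ by
    change S.p₁ k.1 (S.e i) = 0
    rw [LinearMap.mem_ker.mp k.2]
    rfl)

/-- The homomorphism `N → M_I ⊕ N`, `n ↦ (p̄₁(n), n)`, compatible with mutations. -/
def ptildeHom : S.xDatum.Hom S.prin.aDatum where
  toHom :=
    { toFun := fun n ↦ S.prinChar (S.pbar₁ n) n
      map_zero' := LinearMap.ext fun x ↦ by simp [prinChar_apply]
      map_add' := fun _ _ ↦ LinearMap.ext fun x ↦ by simp [prinChar_apply]; ring }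
  F_eq := rfl
  u_apply i n := by
    change S.prinChar (S.pbar₁ n) n (S.eI i, 0) = S.bracket n (S.e i)
    rw [prinChar_apply]
    exact add_zero _
  ψ_apply i := by
    refine LinearMap.ext fun x ↦ ?_
    change S.bracket (S.e i) x.1 + x.2 (S.e i) =
      S.bracket (S.e i) x.1 + x.2 (S.e i) - (0 : Module.Dual ℤ N) x.1
    simp

/-- The morphism `p̃₂ : 𝒜_prin^⋆ ⟶ 𝒳^⋆`, `z^n ↦ z^(p̄₁(n), n)` on the tori and on all charts. -/
def ptilde : S.aPrin 𝕜 ⟶ S.xSpace 𝕜 := S.ptildeHom.spaceMap 𝕜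

/-- The morphism of tori `i : T_M ⟶ T_{K₁*}`, `z^k ↦ z^k`. -/
def torusMap : Spec (.of (AddMonoidAlgebra 𝕜 N)) ⟶ Spec (.of (AddMonoidAlgebra 𝕜 S.K₁)) :=
  Spec.map (CommRingCat.ofHom (AddMonoidAlgebra.mapDomainRingHom 𝕜 S.K₁.subtype.toAddMonoidHom))

/-- The commutative square relating `p̃₂`, `λ`, `π` and `i`. -/
lemma ptilde_lam : S.ptilde 𝕜 ≫ S.lam 𝕜 = S.pi 𝕜 ≫ S.torusMap 𝕜 := by
  have key : ∀ k : S.K₁, S.ptildeHom.toHom k.1 = S.prinChar 0 k.1 := fun k ↦ by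
    refine LinearMap.ext fun x ↦ ?_
    change S.p₁ k.1 x.1 + x.2 k.1 = 0 + x.2 k.1
    rw [LinearMap.mem_ker.mp k.2]
    rfl
  refine MutationDatum.hom_ext 𝕜 S.prin.aDatum ?_ fun i ↦ ?_
  · rw [ptilde, lam, pi, torusMap, ← Category.assoc, MutationDatum.Hom.torus_spaceMap,
      Category.assoc, MutationDatum.torus_fibration, ← Category.assoc,
      MutationDatum.torus_fibration, ← Spec.map_comp, ← Spec.map_comp, ← CommRingCat.ofHom_comp,
      ← CommRingCat.ofHom_comp, ← AddMonoidAlgebra.mapDomainRingHom_comp,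
      ← AddMonoidAlgebra.mapDomainRingHom_comp]
    congr 3
    exact AddMonoidHom.ext key
  · rw [ptilde, lam, pi, torusMap, ← Category.assoc, MutationDatum.Hom.chart_spaceMap,
      Category.assoc, MutationDatum.chart_fibration, ← Category.assoc,
      MutationDatum.chart_fibration, ← Spec.map_comp, ← Spec.map_comp, ← CommRingCat.ofHom_comp,
      ← CommRingCat.ofHom_comp, ← AddMonoidAlgebra.mapDomainRingHom_comp,
      ← AddMonoidAlgebra.mapDomainRingHom_comp]
    congr 3
    exact AddMonoidHom.ext fun k ↦ Subtype.ext (key k)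

variable {𝕜}

/-- The `𝕜`-point of the torus `Spec 𝕜[Q]` at which the monomial `z^q` takes the value `t q`. -/
def point {Q : Type u} [AddCommGroup Q] (t : AddChar Q 𝕜) :
    Spec (.of 𝕜) ⟶ Spec (.of (AddMonoidAlgebra 𝕜 Q)) :=
  Spec.map (CommRingCat.ofHom (AddMonoidAlgebra.lift 𝕜 𝕜 Q t.toMonoidHom).toRingHom)

/-- The image in `T_{K₁*}` of a point of `T_M` under `i`. -/
def imagePoint (t : AddChar N 𝕜) : AddChar S.K₁ 𝕜 :=
  t.compAddMonoidHom S.K₁.subtype.toAddMonoidHom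

lemma point_torusMap (t : AddChar N 𝕜) :
    point t ≫ S.torusMap 𝕜 = point (S.imagePoint t) := by
  rw [point, torusMap, ← Spec.map_comp, ← CommRingCat.ofHom_comp, point]
  congr 2
  refine AddMonoidAlgebra.ringHom_ext (fun r ↦ ?_) (fun q ↦ ?_)
  · change AddMonoidAlgebra.lift 𝕜 𝕜 N t.toMonoidHom (AddMonoidAlgebra.mapDomainRingHom 𝕜
      S.K₁.subtype.toAddMonoidHom (AddMonoidAlgebra.single 0 r)) =
        AddMonoidAlgebra.lift 𝕜 𝕜 S.K₁ (S.imagePoint t).toMonoidHom (AddMonoidAlgebra.single 0 r)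
    simp
  · change AddMonoidAlgebra.lift 𝕜 𝕜 N t.toMonoidHom (AddMonoidAlgebra.mapDomainRingHom 𝕜
      S.K₁.subtype.toAddMonoidHom (AddMonoidAlgebra.single q 1)) =
        AddMonoidAlgebra.lift 𝕜 𝕜 S.K₁ (S.imagePoint t).toMonoidHom (AddMonoidAlgebra.single q 1)
    simp [imagePoint]

lemma fibre_condition (t : AddChar N 𝕜) :
    (pullback.fst (S.pi 𝕜) (point t) ≫ S.ptilde 𝕜) ≫ S.lam 𝕜 =
      pullback.snd (S.pi 𝕜) (point t) ≫ point (S.imagePoint t) := by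
  rw [Category.assoc, ptilde_lam, ← point_torusMap, pullback.condition_assoc]

/-- The fibre `𝒳^⋆_φ` of `λ` over `φ ∈ T_{K₁*}`. -/
def xLeaf (φ : AddChar S.K₁ 𝕜) : Scheme.{u} := pullback (S.lam 𝕜) (point φ)

/-- The fibre `𝒜^⋆_t` of `π` over `t ∈ T_M`. -/
def aFibre (t : AddChar N 𝕜) : Scheme.{u} := pullback (S.pi 𝕜) (point t)

/-- The inclusion of `𝒳^⋆_φ` into `𝒳^⋆`. -/
def xLeafIncl (φ : AddChar S.K₁ 𝕜) : S.xLeaf φ ⟶ S.xSpace 𝕜 := pullback.fst _ _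

/-- The inclusion of `𝒜^⋆_t` into `𝒜_prin^⋆`. -/
def aFibreIncl (t : AddChar N 𝕜) : S.aFibre t ⟶ S.aPrin 𝕜 := pullback.fst _ _

/-- The morphism `p_{2,t} : 𝒜^⋆_t ⟶ 𝒳^⋆_φ` to which `p̃₂` restricts if `i(t) = φ`. -/
def pFibre {φ : AddChar S.K₁ 𝕜} {t : AddChar N 𝕜} (h : S.imagePoint t = φ) :
    S.aFibre t ⟶ S.xLeaf φ :=
  pullback.lift (S.aFibreIncl t ≫ S.ptilde 𝕜) (pullback.snd _ _)
    (h ▸ S.fibre_condition t)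

lemma pFibre_incl {φ : AddChar S.K₁ 𝕜} {t : AddChar N 𝕜} (h : S.imagePoint t = φ) :
    S.pFibre h ≫ S.xLeafIncl φ = S.aFibreIncl t ≫ S.ptilde 𝕜 := pullback.lift_fst _ _ _

/-! ### The divisors on the leaves and the extension of `p̃₂^♯` -/

/-- The torus `U₀` in `𝒳^⋆_φ`. -/
def leafTorus (φ : AddChar S.K₁ 𝕜) : (S.xLeaf φ).Opens :=
  S.xLeafIncl φ ⁻¹ᵁ S.xDatum.torusOpen 𝕜

/-- The chart `U i` in `𝒳^⋆_φ`. -/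
def leafChart (φ : AddChar S.K₁ 𝕜) (i : I) : (S.xLeaf φ).Opens :=
  S.xLeafIncl φ ⁻¹ᵁ S.xDatum.chartOpen 𝕜 i

/-- A Laurent polynomial as a regular function on the torus `U₀` in `𝒳^⋆_φ`. -/
def leafTorusFun (φ : AddChar S.K₁ 𝕜) (a : AddMonoidAlgebra 𝕜 N) : Γ(S.xLeaf φ, S.leafTorus φ) :=
  (S.xLeafIncl φ).app _ (S.xDatum.torusFun 𝕜 a)

/-- An element of the coordinate ring of the chart `i` as a regular function on the chart `U i` in
`𝒳^⋆_φ`. -/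
def leafChartFun (φ : AddChar S.K₁ 𝕜) (i : I)
    (a : AddMonoidAlgebra 𝕜 (S.xDatum.chartMonoid i)) : Γ(S.xLeaf φ, S.leafChart φ i) :=
  (S.xLeafIncl φ).app _ (S.xDatum.chartFun 𝕜 i a)

/-- The open sets on which the local equations of the divisors are given: the torus, the charts
of the indices that are not frozen, and the charts of the frozen indices, with every choice of an
element `n ∈ N` such that `[n, e i] = 1`. -/
inductive EqnIdx : Type u
  | torus
  | unfrozen (i : I) (hi : i ∉ S.F)
  | frozen (i : I) (hi : i ∈ S.F) (n : N) (hn : S.bracket n (S.e i) = 1)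

/-- The monomial `z^{e i}` on the chart of an index which is not frozen. -/
def chartE (i : I) (hi : i ∉ S.F) : S.xDatum.chartMonoid i := ⟨S.e i, fun h ↦ (hi h).elim⟩

/-- The monomial `z^n` with `[n, e i] = 1` on the chart of a frozen index. -/
def chartN (i : I) (n : N) (hn : S.bracket n (S.e i) = 1) : S.xDatum.chartMonoid i :=
  ⟨n, fun _ ↦ by
    change 0 ≤ S.bracket n (S.e i)
    rw [hn]
    exact zero_le_one⟩

/-- The open sets on which the local equations of the divisors are given. -/
def eqnOpen (φ : AddChar S.K₁ 𝕜) : S.EqnIdx → (S.xLeaf φ).Opens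
  | .torus => S.leafTorus φ
  | .unfrozen i _ => S.leafChart φ i
  | .frozen i _ _ _ => S.leafChart φ i

/-- The divisors `W_φ(∑ aᵢ eᵢ*) = ∑ aᵢ E_{i,φ} + ∑ aᵢ D_{i,φ}` on `𝒳^⋆_φ`. Here `E_{i,φ}`, for `i`
not frozen, has the equation `1 + z^{e i}` on the chart `U i` and the equation `1` elsewhere, and
`D_{i,φ}`, for `i` frozen, has the equation `z^n`, where `[n, e i] = 1`, on the chart `U i`, and the
equation `1` elsewhere. -/
def divisors (φ : AddChar S.K₁ 𝕜) [IsIntegral (S.xLeaf φ)] :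
    DivisorLattice (S.xLeaf φ) (Module.Dual ℤ S.NI) where
  J := S.EqnIdx
  U := S.eqnOpen φ
  eqn
    | .torus => 0
    | .unfrozen i hi => AddMonoidHom.mk' (fun m ↦ m (S.eI i) • Additive.ofMul (ratUnit (ratFun
        (S.leafChartFun φ i (1 + AddMonoidAlgebra.single (S.chartE i hi) 1)))))
        fun m m' ↦ by rw [LinearMap.add_apply, add_zsmul]
    | .frozen i _ n hn => AddMonoidHom.mk' (fun m ↦ m (S.eI i) • Additive.ofMul (ratUnit (ratFun
        (S.leafChartFun φ i (AddMonoidAlgebra.single (S.chartN i n hn) 1)))))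
        fun m m' ↦ by rw [LinearMap.add_apply, add_zsmul]

/-- The sublattice `Λ₀ = p̄₁(N)` of `Λ = M_I`. -/
def Λ₀ : AddSubgroup (Module.Dual ℤ S.NI) := (LinearMap.range S.pbar₁).toAddSubgroup

/-- `p̄₁(n)` as an element of `p̄₁(N)`. -/
def pbar₁Λ₀ (n : N) : S.Λ₀ := ⟨S.pbar₁ n, n, rfl⟩

/-- The torus in `𝒜^⋆_t`. -/
def fibreTorus (t : AddChar N 𝕜) : (S.aFibre t).Opens :=
  S.aFibreIncl t ⁻¹ᵁ S.prin.aDatum.torusOpen 𝕜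

/-- The monomial `z^m = z^(m, 0)`, for `m ∈ M_I`, on the torus in `𝒜^⋆_t`. -/
def fibreMonomial (t : AddChar N 𝕜) (m : Module.Dual ℤ S.NI) :
    Γ(S.aFibre t, S.fibreTorus t) :=
  (S.aFibreIncl t).app _
    (S.prin.aDatum.torusFun 𝕜 (AddMonoidAlgebra.single (S.prinChar m 0) 1))

open Opposite in
/-- `θ` is the map `ℛ_{𝒳_φ, M_I} ⟶ (p_{2,t})_* 𝒪_{𝒜_t}` defined by `p̃₂^♯`: it extends the pull back
of functions along `p_{2,t}`, and over open subsets of the torus it maps `s z^m`, for a regular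
function `s` and `m ∈ M_I`, to `p_{2,t}^♯(s) z^(m, 0)`. -/
def IsPtildeSharp {φ : AddChar S.K₁ 𝕜} {t : AddChar N 𝕜} (h : S.imagePoint t = φ)
    [IsIntegral (S.xLeaf φ)]
    (θ : (S.divisors φ).sheafR ⟶
      (TopologicalSpace.Opens.map (S.pFibre h).base).op ⋙ (S.aFibre t).presheaf) : Prop :=
  (∀ (U : (S.xLeaf φ).Opens) (s : Γ(S.xLeaf φ, U)),
    θ.app (op U) ((S.divisors φ).ofRegular U s) = (S.pFibre h).app U s) ∧
  ∀ (U : (S.xLeaf φ).Opens), U ≤ S.leafTorus φ →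
    ∀ (s : Γ(S.xLeaf φ, U)) (m : Module.Dual ℤ S.NI) (r : (S.divisors φ).ring U),
      (∀ x : U, r.1 x = AddMonoidAlgebra.single m (ratFun s)) →
      (S.aFibre t).presheaf.map (homOfLE inf_le_left).op (θ.app (op U) r) =
        (S.aFibre t).presheaf.map
            (homOfLE (inf_le_left : (S.pFibre h ⁻¹ᵁ U) ⊓ S.fibreTorus t ≤ _)).op
            ((S.pFibre h).app U s) *
          (S.aFibre t).presheaf.map (homOfLE inf_le_right).op (S.fibreMonomial t m)

end Seed

end Cluster

end

/-!
A fibre of a cluster variety over a torus of invariant monomials is again glued from a torus and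
from charts attached to it by mutations, see `Cluster.MutationDatum.FibreDatum`. Choosing an
extension of the point of the base torus to a character of the lattice of all monomials amounts to
choosing coordinates on the fibre. The point `t` provides such characters for both fibres. With
`Λ₀ = p̄₁(N)`, the leaf `X = 𝒳^⋆_φ` is then glued from the torus `Spec 𝕜[Λ₀]` and its charts, the
fibre `Y = 𝒜^⋆_t` is glued from `Spec 𝕜[M_I]` and its charts, and `p : Y → X` is given by the
inclusion `Λ₀ ⊆ M_I` on the tori and on all charts (`Cluster.Seed.IsRegularPoint.leafFibre`,
`torsorFibre` and `isMap_pFibre`). The walls become `1 + z^{e_i}(t) z^{p̄₁(e_i)}`; the condition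
on `φ` says that they do not vanish identically, so that all charts meet the torus and `X` and `Y`
are integral. Since the exceptional and boundary loci on `Y` are the preimages of those on `X`,
the charts of `Y` are the preimages of the charts of `X`, and `p` is affine.

Everything else is a computation with rational functions on `X` and `Y`. The coordinates on the
chart of an index `i` are `z^m (1 + z^{e_i})^{-⟨m, e_i⟩}` if `i` is unfrozen, and the `z^m` with
`⟨m, e_i⟩ ≥ 0` if `i` is frozen. Comparing them with the local equations of the divisors `W_φ(m)`
shows two things. On `X`, the monomial `z^{-m}` for `m ∈ Λ₀` is a local generator of `𝒪_X(m)`, so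
that `ρ(m) = z^{-m}` is a shifting family (`isShiftingFamily_shift`). On `Y`, the pull back of the
divisor `W_φ(m)` is trivialized by the monomial `z^m`, for all `m ∈ M_I` (`isTrivializedBy`).
Therefore `∑ f_m z^m ↦ ∑ p^♯(f_m) z^m` is a homomorphism `θ : ℛ → p_* 𝒪_Y`
(`DivisorLattice.evalSheafHom`), and it kills the shift ideal.

The induced map from `ℛ / ℐ` is bijective over every open set
(`DivisorLattice.evalSheafHom_bijective`). Modulo `ℐ`, every section is congruent to a unique
normal form, in which the exponents are chosen representatives of `M_I / Λ₀`. Injectivity holds as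
monomials of different classes modulo `Λ₀` are linearly independent over `K(X) = Frac 𝕜[Λ₀]`.
Surjectivity holds locally since `θ` hits the coordinates on every chart, and then globally
because the normal forms of local preimages are unique and hence glue. So `ℛ / ℐ ≅ p_* 𝒪_Y`; in
particular `ℛ / ℐ` is quasi-coherent, and, as `p` is affine, its relative spectrum is `Y`
(`DivisorLattice.exists_iso_universalTorsor`).
-/

noncomputable section

namespace Cluster

/-! ### Relative spectra and affine morphisms -/

section RelativeSpec

open Opposite Scheme.AffineZariskiSite

variable {X Y : Scheme.{u}} (p : Y ⟶ X) [IsAffineHom p]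

lemma coequifibered_pushforward :
    ((toOpensFunctor X).op.whiskerLeft p.c).Coequifibered := by
  refine coequifibered_iff_forall_isLocalizationAway.mpr fun U f ↦ ?_
  exact (U.2.preimage p).isLocalization_of_eq_basicOpen (p.app U.1 f) _
    (Scheme.preimage_basicOpen p f)

variable {F : X.Opensᵒᵖ ⥤ CommRingCat.{u}} {α : X.presheaf ⟶ F}
  (e : F ≅ (TopologicalSpace.Opens.map p.base).op ⋙ Y.presheaf)

/-- An algebra isomorphic to `p_* 𝒪_Y`, for an affine morphism `p`, is quasi-coherent. -/
lemma coequifibered_of_iso_pushforward (he : α ≫ e.hom = p.c) :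
    ((toOpensFunctor X).op.whiskerLeft α).Coequifibered := by
  have h : (toOpensFunctor X).op.whiskerLeft α =
      (toOpensFunctor X).op.whiskerLeft p.c ≫ (toOpensFunctor X).op.whiskerLeft e.inv := by
    rw [← Functor.whiskerLeft_comp, ← he, Category.assoc, e.hom_inv_id, Category.comp_id]
  rw [h]
  exact (coequifibered_pushforward p).comp (.of_isIso _)

/-- The isomorphism `Spec F(U) ≅ p⁻¹(U)` for an affine open subset `U`. -/
def relativeSpecChart {U : X.Opens} (hU : IsAffineOpen U) :
    Spec (F.obj (op U)) ≅ (p ⁻¹ᵁ U).toScheme :=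
  Scheme.Spec.mapIso (e.symm.app (op U)).op ≪≫ (hU.preimage p).isoSpec.symm

lemma relativeSpecChart_hom_ι {U : X.Opens} (hU : IsAffineOpen U) :
    (relativeSpecChart p e hU).hom ≫ (p ⁻¹ᵁ U).ι =
      Spec.map (e.inv.app (op U)) ≫ (hU.preimage p).fromSpec := Category.assoc _ _ _

lemma map_relativeSpecChart {U V : X.Opens} (hU : IsAffineOpen U) (hV : IsAffineOpen V)
    (f : U ⟶ V) :
    Spec.map (F.map f.op) ≫ (relativeSpecChart p e hV).hom ≫ (p ⁻¹ᵁ V).ι =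
      (relativeSpecChart p e hU).hom ≫ (p ⁻¹ᵁ U).ι := by
  rw [relativeSpecChart_hom_ι, relativeSpecChart_hom_ι,
    ← (hV.preimage p).map_fromSpec (hU.preimage p) (homOfLE (p.preimage_mono f.le)).op,
    ← Category.assoc, ← Category.assoc, ← Spec.map_comp, ← Spec.map_comp]
  congr 2
  exact (e.inv.naturality f.op).symm

lemma relativeSpecChart_comp (he : α ≫ e.hom = p.c) {U : X.Opens}
    (hU : IsAffineOpen U) :
    (relativeSpecChart p e hU).hom ≫ p ∣_ U = Spec.map (α.app (op U)) ≫ hU.isoSpec.inv := by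
  have h1 : p.app U ≫ e.inv.app (op U) = α.app (op U) := by
    have := congrArg (fun g ↦ g.app (op U) ≫ e.inv.app (op U)) he
    simpa using this.symm
  rw [← cancel_mono U.ι, Category.assoc, Category.assoc, morphismRestrict_ι, ← Category.assoc,
    relativeSpecChart_hom_ι, Category.assoc,
    ← hU.SpecMap_appLE_fromSpec p (hU.preimage p) le_rfl,
    ← Category.assoc, ← Spec.map_comp, ← h1, Scheme.Hom.app_eq_appLE]
  rfl

variable (h : ((toOpensFunctor X).op.whiskerLeft α).Coequifibered)

instance : ((relativeGluingData h).functor ⋙ Scheme.forget).IsLocallyDirected :=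
  Scheme.Cover.RelativeGluingData.instIsLocallyDirectedI₀CompFunctorForgetOfIsThin ..

/-- The part of the relative spectrum over an affine open subset. -/
def relativeSpecι {U : X.Opens} (hU : IsAffineOpen U) :
    Spec (F.obj (op U)) ⟶ (relativeGluingData h).glued :=
  colimit.ι (relativeGluingData h).functor (⟨U, hU⟩ : X.AffineZariskiSite)

lemma isPullback_relativeSpecι {U : X.Opens} (hU : IsAffineOpen U) :
    IsPullback (relativeSpecι h hU) (Spec.map (α.app (op U)) ≫ hU.isoSpec.inv)
      (relativeGluingData h).toBase U.ι :=
  ((relativeGluingData h).isPullback_natTrans_ι_toBase ⟨U, hU⟩).flip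

lemma relativeSpec_hom_ext {Z : Scheme.{u}} {f g : (relativeGluingData h).glued ⟶ Z}
    (hfg : ∀ (U : X.Opens) (hU : IsAffineOpen U),
      relativeSpecι h hU ≫ f = relativeSpecι h hU ≫ g) : f = g :=
  colimit.hom_ext fun U ↦ hfg U.1 U.2

/-- The comparison morphism from the relative spectrum of `F ≅ p_* 𝒪_Y` to `Y`. -/
def relativeSpecDesc : (relativeGluingData h).glued ⟶ Y :=
  colimit.desc (relativeGluingData h).functor
    { pt := Y
      ι :=
        { app := fun U ↦ (relativeSpecChart p e U.2).hom ≫ (p ⁻¹ᵁ U.1).ι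
          naturality := fun U V f ↦
            (map_relativeSpecChart p e U.2 V.2 ((toOpensFunctor X).map f)).trans
              (Category.comp_id _).symm } }

lemma ι_relativeSpecDesc {U : X.Opens} (hU : IsAffineOpen U) :
    relativeSpecι h hU ≫ relativeSpecDesc p e h =
      (relativeSpecChart p e hU).hom ≫ (p ⁻¹ᵁ U).ι :=
  colimit.ι_desc _ _

lemma relativeSpecDesc_comp (he : α ≫ e.hom = p.c) :
    relativeSpecDesc p e h ≫ p = (relativeGluingData h).toBase := by
  refine relativeSpec_hom_ext h fun U hU ↦ ?_
  rw [← Category.assoc, ι_relativeSpecDesc, (isPullback_relativeSpecι h hU).w, Category.assoc,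
    ← morphismRestrict_ι, ← Category.assoc, relativeSpecChart_comp p e he]

/-- An affine morphism `p : Y ⟶ X` is the relative spectrum of `p_* 𝒪_Y`. -/
lemma isIso_relativeSpecDesc (he : α ≫ e.hom = p.c) : IsIso (relativeSpecDesc p e h) := by
  have hcov : ⨆ U : X.affineOpens, p ⁻¹ᵁ U.1 = ⊤ := by
    rw [← p.preimage_iSup, iSup_affineOpens_eq_top X, p.preimage_top]
  refine (IsZariskiLocalAtTarget.iff_of_openCover (P := .isomorphisms _)
    (Y.openCoverOfIsOpenCover _ hcov)).mpr fun U ↦ ?_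
  obtain ⟨U, hU⟩ := U
  replace hU : IsAffineOpen U := hU
  change IsIso (pullback.snd (relativeSpecDesc p e h) (p ⁻¹ᵁ U).ι)
  have h1 := isPullback_relativeSpecι h hU
  rw [← relativeSpecDesc_comp p e h he, ← relativeSpecChart_comp p e he] at h1
  have h3 : IsPullback (relativeSpecι h hU) (relativeSpecChart p e hU).hom
      (relativeSpecDesc p e h) (p ⁻¹ᵁ U).ι :=
    IsPullback.of_bot h1 (ι_relativeSpecDesc p e h hU)
      (isPullback_morphismRestrict p U).flip
  rw [← h3.isoPullback_inv_snd]
  infer_instance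

end RelativeSpec

section Recognition

open Opposite

variable {X Y : Scheme.{u}} [IsIntegral X] {Λ : Type u} [AddCommGroup Λ] (W : DivisorLattice X Λ)
  {Λ₀ : AddSubgroup Λ} (ρ : Λ₀ →+ Additive (X.functionField)ˣ) (p : Y ⟶ X) [IsAffineHom p]

/-- A criterion for an affine morphism `p : Y ⟶ X` to be the universal torsor of `X`: a map of
presheaves of algebras from `ℛ` to `p_* 𝒪_Y` which induces bijections on the quotients by the
shift ideals. -/
theorem DivisorLattice.exists_iso_universalTorsor
    (θ : W.sheafR ⟶ (TopologicalSpace.Opens.map p.base).op ⋙ Y.presheaf)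
    (hθ : ∀ U : X.Opens, ∀ r ∈ W.shiftIdeal ρ U, (θ.app (op U)).hom r = 0)
    (hreg : ∀ (U : X.Opens) (s : Γ(X, U)), θ.app (op U) (W.ofRegular U s) = p.app U s)
    (hbij : ∀ U : X.Opens, Function.Bijective
      (Ideal.Quotient.lift (W.shiftIdeal ρ U) (θ.app (op U)).hom (hθ U))) :
    ∃ (hρ : W.IsQuasiCoherent ρ) (Φ : Y ≅ W.universalTorsor ρ hρ),
      Φ.hom ≫ universalTorsor.toBase hρ = p ∧
      ∀ U : X.affineOpens, (p ⁻¹ᵁ U.1).ι ≫ Φ.hom = (p ⁻¹ᵁ U.1).toSpecΓ ≫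
        Spec.map (CommRingCat.ofHom (Ideal.Quotient.lift (W.shiftIdeal ρ U.1)
          (θ.app (op U.1)).hom (hθ U.1))) ≫ universalTorsor.overAffine hρ U := by
  -- The bijections make `ℛ / ℐ` isomorphic to `p_* 𝒪_Y`. This gives the quasi-coherence of `ℛ / ℐ`,
  -- and `Φ` is the inverse of the comparison morphism.
  let e : W.quotientAlgebra ρ ≅ (TopologicalSpace.Opens.map p.base).op ⋙ Y.presheaf :=
    NatIso.ofComponents
      (fun U ↦ (RingEquiv.ofBijective _ (hbij U.unop)).toCommRingCatIso)
      (fun {U V} i ↦ by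
        refine CommRingCat.hom_ext (Ideal.Quotient.ringHom_ext (RingHom.ext fun r ↦ ?_))
        exact congrArg (fun g ↦ g.hom r) (θ.naturality i))
  have he : W.quotientStructure ρ ≫ e.hom = p.c := by
    ext U s
    exact hreg U s
  have hρ : W.IsQuasiCoherent ρ := coequifibered_of_iso_pushforward p e he
  have := isIso_relativeSpecDesc p e hρ he
  let Ψ : W.universalTorsor ρ hρ ⟶ Y := relativeSpecDesc p e hρ
  have hΨ : IsIso Ψ := this
  refine ⟨hρ, (asIso Ψ).symm, ?_, fun U ↦ ?_⟩
  · change inv Ψ ≫ _ = p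
    rw [IsIso.inv_comp_eq]
    exact (relativeSpecDesc_comp p e hρ he).symm
  · change (p ⁻¹ᵁ U.1).ι ≫ inv Ψ = _
    rw [IsIso.comp_inv_eq]
    have h1 : universalTorsor.overAffine hρ U ≫ Ψ =
        Spec.map (e.inv.app (op U.1)) ≫ (U.2.preimage p).fromSpec :=
      (ι_relativeSpecDesc p e hρ U.2).trans (relativeSpecChart_hom_ι p e U.2)
    have h2 : Spec.map (e.hom.app (op U.1)) ≫ Spec.map (e.inv.app (op U.1)) = 𝟙 _ := by
      rw [← Spec.map_comp, Iso.inv_hom_id_app, Spec.map_id]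
    have h3 : (p ⁻¹ᵁ U.1).toSpecΓ ≫ Spec.map (e.hom.app (op U.1)) ≫
        Spec.map (e.inv.app (op U.1)) ≫ (U.2.preimage p).fromSpec = (p ⁻¹ᵁ U.1).ι := by
      rw [reassoc_of% h2]
      exact (U.2.preimage p).toSpecΓ_fromSpec
    rw [Category.assoc, Category.assoc, h1]
    exact h3.symm

end Recognition

/-! ### Monomials over a field and normal forms modulo a sublattice -/

section NormalForm

variable {K L Λ : Type u} [Field K] [Field L] [AddCommGroup Λ]

/-- The ring homomorphism `K[Λ] → L` which is `f` on the coefficients and maps `z^m` to `ζ m`. -/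
def monomialEval (f : K →+* L) (ζ : Λ →+ Additive Lˣ) : AddMonoidAlgebra K Λ →+* L :=
  AddMonoidAlgebra.liftNCRingHom f ((Units.coeHom L).comp (AddMonoidHom.toMultiplicativeLeft ζ))
    fun _ _ ↦ Commute.all _ _

lemma monomialEval_single (f : K →+* L) (ζ : Λ →+ Additive Lˣ) (m : Λ) (c : K) :
    monomialEval f ζ (AddMonoidAlgebra.single m c) = f c * ((ζ m).toMul : L) :=
  AddMonoidAlgebra.liftNC_single _ _ _ _

variable (Λ₀ : AddSubgroup Λ) (ρ : Λ₀ →+ Additive Kˣ)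

/-- A representative of the class of `m` modulo `Λ₀`. -/
def cosetRep (m : Λ) : Λ := (m : Λ ⧸ Λ₀).out

lemma cosetRep_sub_mem (m : Λ) : cosetRep Λ₀ m - m ∈ Λ₀ := by
  have h : ((cosetRep Λ₀ m : Λ) : Λ ⧸ Λ₀) = m := Quotient.out_eq' _
  rw [← neg_add_eq_sub]
  exact QuotientAddGroup.eq.mp h.symm

lemma cosetRep_eq {m m' : Λ} (h : m' - m ∈ Λ₀) : cosetRep Λ₀ m = cosetRep Λ₀ m' := by
  have h : (m : Λ ⧸ Λ₀) = m' := QuotientAddGroup.eq.mpr (by rwa [neg_add_eq_sub])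
  rw [cosetRep, h, cosetRep]

/-- The element `z^m` is replaced by `ρ(m₀) z^(m + m₀)`, where `m + m₀` is the representative of `m`
modulo `Λ₀`. -/
def normalForm : AddMonoidAlgebra K Λ →+ AddMonoidAlgebra K Λ :=
  (Finsupp.liftAddHom fun m : Λ ↦ (AddMonoidAlgebra.singleAddHom (cosetRep Λ₀ m)).comp
    (AddMonoidHom.mulRight ((ρ ⟨_, cosetRep_sub_mem Λ₀ m⟩).toMul : K))).comp
      AddMonoidAlgebra.coeffAddEquiv.toAddMonoidHom

lemma normalForm_single (m : Λ) (c : K) :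
    normalForm Λ₀ ρ (AddMonoidAlgebra.single m c) = AddMonoidAlgebra.single (cosetRep Λ₀ m)
      (c * ((ρ ⟨_, cosetRep_sub_mem Λ₀ m⟩).toMul : K)) := by
  change Finsupp.liftAddHom _ (Finsupp.single m c) = _
  rw [Finsupp.liftAddHom_apply_single]
  rfl

/-- An element is in normal form if its exponents lie in different classes modulo `Λ₀`. -/
def IsNormal (G : AddMonoidAlgebra K Λ) : Prop :=
  ∀ m m', G.coeff m ≠ 0 → G.coeff m' ≠ 0 → m' - m ∈ Λ₀ → m = m'

lemma normalForm_coeff_ne_zero {F : AddMonoidAlgebra K Λ} {m : Λ}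
    (h : (normalForm Λ₀ ρ F).coeff m ≠ 0) : cosetRep Λ₀ m = m := by
  classical
  by_contra hm
  refine h ?_
  clear h
  induction F using AddMonoidAlgebra.induction_linear with
  | zero => rw [map_zero]; rfl
  | add F G hF hG => rw [map_add, AddMonoidAlgebra.coeff_add, Finsupp.add_apply, hF, hG, add_zero]
  | single a c =>
    rw [normalForm_single, AddMonoidAlgebra.coeff_single, Finsupp.single_apply, if_neg]
    rintro rfl
    refine hm (cosetRep_eq Λ₀ ?_)
    rw [← neg_sub]
    exact neg_mem (cosetRep_sub_mem Λ₀ a)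

lemma isNormal_normalForm_sub (F G : AddMonoidAlgebra K Λ) :
    IsNormal Λ₀ (normalForm Λ₀ ρ F - normalForm Λ₀ ρ G) := by
  intro m m' hm hm' h
  rw [← map_sub] at hm hm'
  rw [← normalForm_coeff_ne_zero Λ₀ ρ hm, ← normalForm_coeff_ne_zero Λ₀ ρ hm', cosetRep_eq Λ₀ h]

variable {Λ₀ ρ}

lemma monomialEval_normalForm {f : K →+* L} {ζ : Λ →+ Additive Lˣ}
    (h : ∀ m : Λ₀, f ((ρ m).toMul : K) * ((ζ m).toMul : L) = 1) (F : AddMonoidAlgebra K Λ) :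
    monomialEval f ζ (normalForm Λ₀ ρ F) = monomialEval f ζ F := by
  induction F using AddMonoidAlgebra.induction_linear with
  | zero => rw [map_zero]
  | add F G hF hG => rw [map_add, map_add, map_add, hF, hG]
  | single m c =>
    have h1 := h ⟨_, cosetRep_sub_mem Λ₀ m⟩
    have h2 : ζ (cosetRep Λ₀ m) = ζ (cosetRep Λ₀ m - m) + ζ m := by
      rw [← map_add, sub_add_cancel]
    rw [normalForm_single, monomialEval_single, monomialEval_single, h2, toMul_add, Units.val_mul,
      map_mul, mul_assoc, ← mul_assoc (f _) _ ((ζ m).toMul : L), h1, one_mul]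

/-- Uniqueness of normal forms, if the monomials of different classes modulo `Λ₀` are linearly
independent. -/
lemma normalForm_eq_of_monomialEval_eq {f : K →+* L} {ζ : Λ →+ Additive Lˣ}
    (h : ∀ m : Λ₀, f ((ρ m).toMul : K) * ((ζ m).toMul : L) = 1)
    (hind : ∀ G : AddMonoidAlgebra K Λ, IsNormal Λ₀ G → monomialEval f ζ G = 0 → G = 0)
    {F G : AddMonoidAlgebra K Λ} (hFG : monomialEval f ζ F = monomialEval f ζ G) :
    normalForm Λ₀ ρ F = normalForm Λ₀ ρ G := by
  refine sub_eq_zero.mp (hind _ (isNormal_normalForm_sub Λ₀ ρ F G) ?_)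
  rw [map_sub, monomialEval_normalForm h, monomialEval_normalForm h, hFG, sub_self]

end NormalForm

/-! ### Rational functions -/

section RationalFunctions

open Opposite

variable {X Y : Scheme.{u}} [IsIntegral X] [IsIntegral Y]

lemma genericPoint_mem {U : X.Opens} {x : X} (h : x ∈ U) : genericPoint X ∈ U :=
  ((genericPoint_spec X).mem_open_set_iff U.isOpen).mpr ⟨x, trivial, h⟩

lemma ratFun_eq_germ {U : X.Opens} (h : genericPoint X ∈ U) (s : Γ(X, U)) :
    ratFun s = X.presheaf.germ U (genericPoint X) h s := dif_pos h

/-- Regular functions on a nonempty open subset as rational functions. -/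
def ratHom (U : X.Opens) (h : genericPoint X ∈ U) : Γ(X, U) →+* X.functionField :=
  (X.presheaf.germ U (genericPoint X) h).hom

lemma ratHom_apply {U : X.Opens} (h : genericPoint X ∈ U) (s : Γ(X, U)) :
    ratHom U h s = ratFun s := (ratFun_eq_germ h s).symm

lemma ratFun_injective {U : X.Opens} (h : genericPoint X ∈ U) {s s' : Γ(X, U)}
    (e : ratFun s = ratFun s') : s = s' := by
  rw [ratFun_eq_germ h, ratFun_eq_germ h] at e
  exact germ_injective_of_isIntegral X _ h e

lemma ratFun_res {U V : X.Opens} (h : genericPoint X ∈ V) (i : V ⟶ U) (s : Γ(X, U)) :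
    ratFun (X.presheaf.map i.op s) = ratFun s := by
  rw [ratFun_eq_germ h, ratFun_eq_germ (i.le h)]
  exact X.presheaf.germ_res_apply i _ h s

/-- Sections over the empty set are equal. -/
lemma section_eq_of_genericPoint_notMem {U : X.Opens} (h : genericPoint X ∉ U) (s s' : Γ(X, U)) :
    s = s' := by
  have : U = ⊥ := by
    refine eq_bot_iff.mpr fun x hx ↦ (h (genericPoint_mem hx)).elim
  subst this
  exact Subsingleton.elim _ _

/-- Sections are determined by their rational functions, also over the empty set, where `ratFun` is
a junk value. -/
lemma section_ext {U : X.Opens} {s s' : Γ(X, U)}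
    (e : genericPoint X ∈ U → ratFun s = ratFun s') : s = s' := by
  by_cases h : genericPoint X ∈ U
  · exact ratFun_injective h (e h)
  · exact section_eq_of_genericPoint_notMem h _ _

/-- The rational functions which are regular at `x`. -/
def regularAt (x : X) : Subring X.functionField :=
  (algebraMap (X.presheaf.stalk x) X.functionField).range

lemma ratFun_mem_regularAt {U : X.Opens} {x : X} (hx : x ∈ U) (s : Γ(X, U)) :
    ratFun s ∈ regularAt x := ⟨_, algebraMap_germ_eq_ratFun hx s⟩

lemma exists_ratFun_eq {x : X} {g : X.functionField} (hg : g ∈ regularAt x) :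
    ∃ (U : X.Opens) (_ : x ∈ U) (s : Γ(X, U)), ratFun s = g := by
  obtain ⟨a, rfl⟩ := hg
  obtain ⟨U, hU, s, rfl⟩ := X.presheaf.exists_germ_eq a
  exact ⟨U, hU, s, (algebraMap_germ_eq_ratFun hU s).symm⟩

/-- A rational function which is regular at every point of an open subset is a regular function. -/
lemma exists_section_of_regularAt {V : X.Opens} {g : X.functionField}
    (hg : ∀ x ∈ V, g ∈ regularAt x) : ∃ s : Γ(X, V), genericPoint X ∈ V → ratFun s = g := by
  by_cases hV : genericPoint X ∈ V
  swap
  · exact ⟨0, fun h ↦ (hV h).elim⟩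
  have h1 : ∀ x : V, ∃ (U : X.Opens) (_ : x.1 ∈ U) (_ : U ≤ V) (s : Γ(X, U)), ratFun s = g := by
    intro x
    obtain ⟨U, hU, s, hs⟩ := exists_ratFun_eq (hg x.1 x.2)
    have hx : x.1 ∈ U ⊓ V := ⟨hU, x.2⟩
    exact ⟨U ⊓ V, hx, inf_le_right, X.presheaf.map (homOfLE inf_le_left).op s,
      (ratFun_res (genericPoint_mem hx) _ _).trans hs⟩
  choose U hxU hUV s hs using h1
  obtain ⟨t, ht, -⟩ := X.sheaf.existsUnique_gluing' U V (fun x ↦ homOfLE (hUV x))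
    (fun x hx ↦ TopologicalSpace.Opens.mem_iSup.mpr ⟨⟨x, hx⟩, hxU _⟩) s (by
      intro x y
      refine section_ext fun h ↦ ?_
      exact (ratFun_res h _ (s x)).trans (((hs x).trans (hs y).symm).trans
        (ratFun_res h _ (s y)).symm))
  refine ⟨t, fun _ ↦ ?_⟩
  have h2 := ht ⟨_, hV⟩
  rw [← hs ⟨_, hV⟩, ← h2]
  exact (ratFun_res (hxU _) _ _).symm

variable (p : Y ⟶ X) (hp : p (genericPoint Y) = genericPoint X)

/-- The pull back of rational functions along a dominant morphism. -/
def ratPull : X.functionField →+* Y.functionField :=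
  (X.presheaf.stalkSpecializes (specializes_of_eq hp) ≫ p.stalkMap (genericPoint Y)).hom

lemma ratPull_ratFun {U : X.Opens} (h : genericPoint X ∈ U) (s : Γ(X, U)) :
    ratPull p hp (ratFun s) = ratFun (p.app U s) := by
  have hY : p (genericPoint Y) ∈ U := hp ▸ h
  rw [ratFun_eq_germ h, ratFun_eq_germ (U := p ⁻¹ᵁ U) hY]
  change (X.presheaf.germ U _ h ≫ X.presheaf.stalkSpecializes (specializes_of_eq hp) ≫
    p.stalkMap (genericPoint Y)).hom s = (p.app U ≫ Y.presheaf.germ _ _ hY).hom s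
  rw [X.presheaf.germ_stalkSpecializes_assoc, Scheme.Hom.germ_stalkMap]

lemma ratPull_mem_regularAt {y : Y} {g : X.functionField} (hg : g ∈ regularAt (p y)) :
    ratPull p hp g ∈ regularAt y := by
  obtain ⟨U, hU, s, rfl⟩ := exists_ratFun_eq hg
  rw [ratPull_ratFun p hp (genericPoint_mem hU)]
  exact ratFun_mem_regularAt (U := p ⁻¹ᵁ U) hU _

lemma SpecMap_ratPull :
    Spec.map (CommRingCat.ofHom (ratPull p hp)) ≫ X.fromSpecStalk (genericPoint X) =
      Y.fromSpecStalk (genericPoint Y) ≫ p := by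
  change Spec.map (X.presheaf.stalkSpecializes (specializes_of_eq hp) ≫
    p.stalkMap (genericPoint Y)) ≫ _ = _
  rw [Spec.map_comp, Category.assoc, Scheme.SpecMap_stalkSpecializes_fromSpecStalk,
    Scheme.SpecMap_stalkMap_fromSpecStalk]

end RationalFunctions

/-! ### Torsors over a lattice of Cartier divisors -/

namespace DivisorLattice

open Opposite

section Stalks

variable {X : Scheme.{u}} [IsIntegral X] {Λ : Type u} [AddCommGroup Λ] {W : DivisorLattice X Λ}

lemma mem_stalk_iff (hW : W.IsCartier) {x : X} {j : W.J} (hj : x ∈ W.U j) {m : Λ}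
    {f : X.functionField} :
    f ∈ W.stalk x m ↔ ((W.eqn j m).toMul : X.functionField) * f ∈ regularAt x := by
  refine ⟨fun h ↦ h j hj, fun h j' hj' ↦ ?_⟩
  obtain ⟨v, hv⟩ := hW.2 j' j x hj' hj m
  rw [hv, mul_assoc]
  exact (regularAt x).mul_mem ⟨_, rfl⟩ h

variable {Λ₀ : AddSubgroup Λ} {ρ : Λ₀ →+ Additive (X.functionField)ˣ}

/-- Being a shifting family is a local property, which can be checked on one local equation at
each point. -/
lemma isShiftingFamily_of_regularAt (hW : W.IsCartier)
    (h : ∀ x : X, ∃ j : W.J, x ∈ W.U j ∧ ∀ m : Λ₀,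
      ((W.eqn j m).toMul : X.functionField) * ((ρ m).toMul : X.functionField) ∈ regularAt x) :
    W.IsShiftingFamily ρ := by
  intro m₀ m U f hf x hx
  obtain ⟨j, hj, hreg⟩ := h x
  rw [mem_stalk_iff hW hj, map_add, toMul_add, Units.val_mul]
  have h1 := mul_mem (hreg m₀) ((mem_stalk_iff hW hj).mp (hf x hx))
  convert h1 using 1
  ring

lemma IsShiftingFamily.mul_mem_stalk (h : W.IsShiftingFamily ρ) (hW : W.IsCartier) (m₀ : Λ₀) {m : Λ}
    {x : X} {f : X.functionField} (hf : f ∈ W.stalk x m) :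
    ((ρ m₀).toMul : X.functionField) * f ∈ W.stalk x (m + m₀) := by
  obtain ⟨j, hj⟩ := hW.1 x
  obtain ⟨V, hV, s, hs⟩ := exists_ratFun_eq ((mem_stalk_iff hW hj).mp hf)
  refine h m₀ m (V ⊓ W.U j) f (fun y hy ↦ ?_) x ⟨hV, hj⟩
  rw [mem_stalk_iff hW hy.2, ← hs]
  exact ratFun_mem_regularAt hy.1 s

lemma single_mem_stalkRing {x : X} {m : Λ} {f : X.functionField} (hf : f ∈ W.stalk x m) :
    AddMonoidAlgebra.single m f ∈ W.stalkRing x := by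
  classical
  intro m'
  rw [AddMonoidAlgebra.coeff_single, Finsupp.single_apply]
  split_ifs with h
  · exact h ▸ hf
  · exact zero_mem _

lemma normalForm_mem_stalkRing (h : W.IsShiftingFamily ρ) (hW : W.IsCartier) {x : X}
    {F : AddMonoidAlgebra X.functionField Λ} (hF : F ∈ W.stalkRing x) :
    normalForm Λ₀ ρ F ∈ W.stalkRing x := by
  rw [← AddMonoidAlgebra.sum_coeff_single F, Finsupp.sum, map_sum]
  refine sum_mem fun m _ ↦ ?_
  rw [normalForm_single, mul_comm]
  refine single_mem_stalkRing ?_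
  have h1 := h.mul_mem_stalk hW ⟨_, cosetRep_sub_mem Λ₀ m⟩ (hF m)
  rwa [add_sub_cancel] at h1

/-- The constant section of `ℛ` with a given value. -/
def const (U : X.Opens) (F : AddMonoidAlgebra X.functionField Λ)
    (hF : ∀ x ∈ U, F ∈ W.stalkRing x) : W.ring U :=
  ⟨fun _ ↦ F, fun _ _ ↦ rfl, fun x ↦ hF x.1 x.2⟩

lemma ring_eq_zero_of_genericPoint_notMem {U : X.Opens} (hU : genericPoint X ∉ U) (r : W.ring U) :
    r = 0 :=
  Subtype.ext (funext fun x ↦ (hU (genericPoint_mem x.2)).elim)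

/-- A section of `ℛ` differs from its normal form by an element of the shift ideal. -/
lemma sub_normalForm_mem_shiftIdeal (h : W.IsShiftingFamily ρ) (hW : W.IsCartier) {U : X.Opens}
    {r r' : W.ring U} {F : AddMonoidAlgebra X.functionField Λ} (hr : ∀ x, r.1 x = F)
    (hr' : ∀ x, r'.1 x = normalForm Λ₀ ρ F) : r - r' ∈ W.shiftIdeal ρ U := by
  have hF : ∀ x ∈ U, F ∈ W.stalkRing x := fun x hx ↦ hr ⟨x, hx⟩ ▸ r.2.2 ⟨x, hx⟩
  let g : Λ → W.ring U := fun m ↦ const U (AddMonoidAlgebra.single m (F.coeff m))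
    fun x hx ↦ single_mem_stalkRing (hF x hx m)
  let g' : Λ → W.ring U := fun m ↦ const U (normalForm Λ₀ ρ (AddMonoidAlgebra.single m
    (F.coeff m))) fun x hx ↦ normalForm_mem_stalkRing h hW (single_mem_stalkRing (hF x hx m))
  have hmem : ∀ m, g m - g' m ∈ W.shiftIdeal ρ U := fun m ↦
    Ideal.subset_span ⟨g m, ⟨_, cosetRep_sub_mem Λ₀ m⟩, fun x ↦ by
      change AddMonoidAlgebra.single m (F.coeff m) - normalForm Λ₀ ρ (AddMonoidAlgebra.single m
        (F.coeff m)) = AddMonoidAlgebra.single m (F.coeff m) -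
          AddMonoidAlgebra.single m (F.coeff m) * _
      rw [normalForm_single, AddMonoidAlgebra.single_mul_single, add_sub_cancel]⟩
  have hsum : r - r' = ∑ m ∈ F.coeff.support, (g m - g' m) := by
    refine Subtype.ext (funext fun x ↦ ?_)
    let ev : W.ring U →+* AddMonoidAlgebra X.functionField Λ :=
      (Pi.evalRingHom _ x).comp (W.ring U).subtype
    change r.1 x - r'.1 x = ev _
    have h1 : ∑ m ∈ F.coeff.support, AddMonoidAlgebra.single m (F.coeff m) = F :=
      AddMonoidAlgebra.sum_coeff_single F
    rw [map_sum, hr, hr']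
    change _ = ∑ m ∈ F.coeff.support, (AddMonoidAlgebra.single m (F.coeff m) -
      normalForm Λ₀ ρ (AddMonoidAlgebra.single m (F.coeff m)))
    rw [Finset.sum_sub_distrib, ← map_sum, h1]
  rw [hsum]
  exact sum_mem fun m _ ↦ hmem m

end Stalks

section Map

variable {X Y : Scheme.{u}} [IsIntegral X] [IsIntegral Y] {Λ : Type u} [AddCommGroup Λ]
  {W : DivisorLattice X Λ} (p : Y ⟶ X) (hp : p (genericPoint Y) = genericPoint X)
  (ζ : Λ →+ Additive (Y.functionField)ˣ)

/-- The divisor `p^* m` is trivialized by the rational function `ζ m`, for all `m ∈ Λ`: near every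
point, `ζ m` is a regular multiple of the pull back of a local equation. Since this is required of
`-m` too, the multiplier is a unit. -/
def IsTrivializedBy (W : DivisorLattice X Λ) : Prop :=
  ∀ y : Y, ∃ j : W.J, p y ∈ W.U j ∧ ∀ m, ∃ z ∈ regularAt y,
    z * ratPull p hp ((W.eqn j m).toMul : X.functionField) = ((ζ m).toMul : Y.functionField)

variable {p hp ζ}

/-- If `ζ m` is a multiple of the local equation of `m`, then it clears the poles of the sections of
`𝒪_X(m)`. -/
lemma monomialEval_mem_regularAt (hζ : W.IsTrivializedBy p hp ζ) {y : Y}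
    {F : AddMonoidAlgebra X.functionField Λ} (hF : F ∈ W.stalkRing (p y)) :
    monomialEval (ratPull p hp) ζ F ∈ regularAt y := by
  obtain ⟨j, hj, hz⟩ := hζ y
  rw [← AddMonoidAlgebra.sum_coeff_single F, Finsupp.sum, map_sum]
  refine sum_mem fun m _ ↦ ?_
  obtain ⟨z, hz, h⟩ := hz m
  rw [monomialEval_single, ← h]
  have h1 := mul_mem hz (ratPull_mem_regularAt p hp (hF m j hj))
  rw [map_mul] at h1
  convert h1 using 1
  ring

variable (W p hp ζ) in
/-- The value of a section of `ℛ` at the rational functions `ζ m`. -/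
def evalRat (U : X.Opens) (hU : genericPoint X ∈ U) : W.ring U →+* Y.functionField :=
  (monomialEval (ratPull p hp) ζ).comp ((Pi.evalRingHom _ (⟨_, hU⟩ : U)).comp (W.ring U).subtype)

lemma evalRat_eq {U : X.Opens} (hU : genericPoint X ∈ U) {r : W.ring U} (x : U) :
    W.evalRat p hp ζ U hU r = monomialEval (ratPull p hp) ζ (r.1 x) :=
  congrArg (monomialEval (ratPull p hp) ζ) (r.2.1 ⟨_, hU⟩ x)

lemma exists_section_ratFun_eq (hζ : W.IsTrivializedBy p hp ζ) (U : X.Opens) (r : W.ring U) :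
    ∃ s : Γ(Y, p ⁻¹ᵁ U), ∀ hU : genericPoint X ∈ U, ratFun s = W.evalRat p hp ζ U hU r := by
  by_cases hU : genericPoint X ∈ U
  · obtain ⟨s, hs⟩ := exists_section_of_regularAt (V := p ⁻¹ᵁ U) (g := W.evalRat p hp ζ U hU r)
      fun y hy ↦ by
        rw [evalRat_eq hU ⟨p y, hy⟩]
        exact monomialEval_mem_regularAt hζ (r.2.2 ⟨p y, hy⟩)
    refine ⟨s, fun _ ↦ hs ?_⟩
    change p (genericPoint Y) ∈ U
    rwa [hp]
  · exact ⟨0, fun h ↦ (hU h).elim⟩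

lemma section_ext_of_dominant (hp : p (genericPoint Y) = genericPoint X) {U : X.Opens}
    {s s' : Γ(Y, p ⁻¹ᵁ U)} (h : genericPoint X ∈ U → ratFun s = ratFun s') : s = s' :=
  section_ext fun hY ↦ h (hp ▸ (show p (genericPoint Y) ∈ U from hY))

/-- The section `∑ f_m z^m` of `ℛ` is mapped to the regular function `∑ p^♯(f_m) ζ(m)`. -/
def evalSection (hζ : W.IsTrivializedBy p hp ζ) (U : X.Opens) (r : W.ring U) : Γ(Y, p ⁻¹ᵁ U) :=
  (exists_section_ratFun_eq hζ U r).choose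

lemma ratFun_evalSection (hζ : W.IsTrivializedBy p hp ζ) {U : X.Opens} (r : W.ring U)
    (hU : genericPoint X ∈ U) :
    ratFun (evalSection hζ U r) = W.evalRat p hp ζ U hU r :=
  (exists_section_ratFun_eq hζ U r).choose_spec hU

lemma genericPoint_mem_preimage (hp : p (genericPoint Y) = genericPoint X) {U : X.Opens}
    (hU : genericPoint X ∈ U) : genericPoint Y ∈ p ⁻¹ᵁ U :=
  show p (genericPoint Y) ∈ U from hp ▸ hU

/-- The homomorphism `∑ f_m z^m ↦ ∑ p^♯(f_m) ζ(m)`. -/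
def evalHom (hζ : W.IsTrivializedBy p hp ζ) (U : X.Opens) : W.ring U →+* Γ(Y, p ⁻¹ᵁ U) where
  toFun := evalSection hζ U
  map_one' := section_ext_of_dominant hp fun hU ↦ by
    rw [ratFun_evalSection hζ _ hU, map_one, ← ratHom_apply (genericPoint_mem_preimage hp hU),
      map_one]
  map_zero' := section_ext_of_dominant hp fun hU ↦ by
    rw [ratFun_evalSection hζ _ hU, map_zero, ← ratHom_apply (genericPoint_mem_preimage hp hU),
      map_zero]
  map_mul' r r' := section_ext_of_dominant hp fun hU ↦ by
    rw [ratFun_evalSection hζ _ hU, map_mul, ← ratHom_apply (genericPoint_mem_preimage hp hU),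
      map_mul, ratHom_apply, ratHom_apply, ratFun_evalSection hζ _ hU, ratFun_evalSection hζ _ hU]
  map_add' r r' := section_ext_of_dominant hp fun hU ↦ by
    rw [ratFun_evalSection hζ _ hU, map_add, ← ratHom_apply (genericPoint_mem_preimage hp hU),
      map_add, ratHom_apply, ratHom_apply, ratFun_evalSection hζ _ hU, ratFun_evalSection hζ _ hU]

/-- The homomorphism `ℛ ⟶ p_* 𝒪_Y`, `∑ f_m z^m ↦ ∑ p^♯(f_m) ζ(m)`. -/
def evalSheafHom (hζ : W.IsTrivializedBy p hp ζ) :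
    W.sheafR ⟶ (TopologicalSpace.Opens.map p.base).op ⋙ Y.presheaf where
  app U := CommRingCat.ofHom (evalHom hζ U.unop)
  naturality U V i := by
    refine CommRingCat.hom_ext (RingHom.ext fun r ↦ section_ext_of_dominant (U := V.unop) hp
      fun hV ↦ ?_)
    have e₁ := ratFun_evalSection hζ (W.res i.unop.le r) hV
    have e₂ := ratFun_evalSection hζ (U := U.unop) r (i.unop.le hV)
    exact e₁.trans (e₂.symm.trans (ratFun_res (genericPoint_mem_preimage hp hV)
      ((TopologicalSpace.Opens.map p.base).map i.unop) _).symm)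

lemma ratFun_evalSheafHom (hζ : W.IsTrivializedBy p hp ζ) {U : X.Opens} (r : W.ring U)
    (hU : genericPoint X ∈ U) :
    ratFun (((evalSheafHom hζ).app (op U)).hom r) = W.evalRat p hp ζ U hU r :=
  ratFun_evalSection hζ r hU

lemma evalSheafHom_ofRegular (hζ : W.IsTrivializedBy p hp ζ) (U : X.Opens) (s : Γ(X, U)) :
    (evalSheafHom hζ).app (op U) (W.ofRegular U s) = p.app U s := by
  refine section_ext_of_dominant hp fun hU ↦ ?_
  refine (ratFun_evalSheafHom hζ _ hU).trans ?_
  rw [← ratPull_ratFun p hp hU, evalRat_eq hU ⟨_, hU⟩, ofRegular_apply, monomialEval_single,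
    map_zero, toMul_zero, Units.val_one, mul_one, algebraMap_germ_eq_ratFun]

variable {Λ₀ : AddSubgroup Λ} {ρ : Λ₀ →+ Additive (X.functionField)ˣ}

lemma evalSheafHom_shiftIdeal (hζ : W.IsTrivializedBy p hp ζ)
    (hρζ : ∀ m : Λ₀, ratPull p hp ((ρ m).toMul : X.functionField) *
      ((ζ m).toMul : Y.functionField) = 1) (U : X.Opens) (r : W.ring U)
    (hr : r ∈ W.shiftIdeal ρ U) : ((evalSheafHom hζ).app (op U)).hom r = 0 := by
  suffices W.shiftIdeal ρ U ≤ RingHom.ker ((evalSheafHom hζ).app (op U)).hom from this hr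
  refine Ideal.span_le.mpr ?_
  rintro r ⟨f, m₀, hr⟩
  refine section_ext_of_dominant hp fun hU ↦ ?_
  rw [ratFun_evalSheafHom hζ _ hU, ← ratHom_apply (genericPoint_mem_preimage hp hU), map_zero,
    evalRat_eq hU ⟨_, hU⟩, hr, map_sub, map_mul, monomialEval_single, hρζ, mul_one, sub_self]

/-- Every regular function on `p⁻¹(U)` is, near every point of `U`, a combination
`∑ p^♯(f_m) ζ(m)`. -/
def IsGeneratedBy (W : DivisorLattice X Λ) (p : Y ⟶ X) (hp : p (genericPoint Y) = genericPoint X)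
    (ζ : Λ →+ Additive (Y.functionField)ˣ) : Prop :=
  ∀ (U : X.Opens) (x : X), x ∈ U → ∀ b : Γ(Y, p ⁻¹ᵁ U), ∃ F ∈ W.stalkRing x,
    monomialEval (ratPull p hp) ζ F = ratFun b

/-- If the monomials `ζ m` of different classes modulo `Λ₀` are linearly independent over `K(X)` and
generate `𝒪_Y` locally over `X`, then `ℛ / ℐ ≅ p_* 𝒪_Y`. Both injectivity and surjectivity follow
from the uniqueness of normal forms. -/
lemma evalSheafHom_bijective (hW : W.IsCartier) (hρ : W.IsShiftingFamily ρ)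
    (hζ : W.IsTrivializedBy p hp ζ)
    (hρζ : ∀ m : Λ₀, ratPull p hp ((ρ m).toMul : X.functionField) *
      ((ζ m).toMul : Y.functionField) = 1)
    (hind : ∀ G : AddMonoidAlgebra X.functionField Λ, IsNormal Λ₀ G →
      monomialEval (ratPull p hp) ζ G = 0 → G = 0)
    (hgen : W.IsGeneratedBy p hp ζ) (U : X.Opens) :
    Function.Bijective (Ideal.Quotient.lift (W.shiftIdeal ρ U) ((evalSheafHom hζ).app (op U)).hom
      (evalSheafHom_shiftIdeal hζ hρζ U)) := by
  constructor
  · refine (injective_iff_map_eq_zero _).mpr fun r ↦ ?_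
    obtain ⟨r, rfl⟩ := Ideal.Quotient.mk_surjective r
    intro h0
    replace h0 : ((evalSheafHom hζ).app (op U)).hom r = 0 := h0
    rw [Ideal.Quotient.eq_zero_iff_mem]
    by_cases hU : genericPoint X ∈ U
    swap
    · rw [ring_eq_zero_of_genericPoint_notMem hU r]
      exact zero_mem _
    have h1 : monomialEval (ratPull p hp) ζ (r.1 ⟨_, hU⟩) =
        monomialEval (ratPull p hp) ζ 0 := by
      rw [map_zero, ← evalRat_eq hU ⟨_, hU⟩, ← ratFun_evalSheafHom hζ r hU, h0,
        ← ratHom_apply (genericPoint_mem_preimage hp hU), map_zero]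
    have h2 := normalForm_eq_of_monomialEval_eq hρζ hind h1
    rw [map_zero] at h2
    rw [← sub_zero r]
    exact sub_normalForm_mem_shiftIdeal hρ hW (fun x ↦ r.2.1 x ⟨_, hU⟩) fun x ↦ h2.symm
  · intro b
    -- The normal forms of local preimages of `b` are unique, so they agree and define a section.
    by_cases hU : genericPoint X ∈ U
    swap
    · exact ⟨0, section_ext_of_dominant hp fun h ↦ (hU h).elim⟩
    choose F hF hFb using fun x : U ↦ hgen U x.1 x.2 b
    have h1 : ∀ x y, normalForm Λ₀ ρ (F x) = normalForm Λ₀ ρ (F y) := fun x y ↦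
      normalForm_eq_of_monomialEval_eq hρζ hind ((hFb x).trans (hFb y).symm)
    let r : W.ring U := ⟨fun x ↦ normalForm Λ₀ ρ (F x), h1, fun x ↦
      normalForm_mem_stalkRing hρ hW (hF x)⟩
    refine ⟨Ideal.Quotient.mk _ r, ?_⟩
    refine section_ext_of_dominant hp fun hU ↦ ?_
    refine (ratFun_evalSheafHom hζ r hU).trans ?_
    rw [evalRat_eq hU ⟨_, hU⟩]
    exact (monomialEval_normalForm hρζ _).trans (hFb _)

end Map

end DivisorLattice

/-! ### Linear independence of monomials modulo a sublattice -/

section Collect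

variable {𝕜 Λ : Type u} [Field 𝕜] [AddCommGroup Λ] (Λ₀ : AddSubgroup Λ)

/-- The ring homomorphism `𝕜[Λ₀][Λ] → 𝕜[Λ]` which multiplies the monomials of `𝕜[Λ₀]` and `Λ`. -/
def collect : AddMonoidAlgebra (AddMonoidAlgebra 𝕜 Λ₀) Λ →+* AddMonoidAlgebra 𝕜 Λ :=
  AddMonoidAlgebra.liftNCRingHom (AddMonoidAlgebra.mapDomainRingHom 𝕜 Λ₀.subtype)
    (AddMonoidAlgebra.of 𝕜 Λ) fun _ _ ↦ Commute.all _ _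

lemma collect_single (m : Λ) (a : AddMonoidAlgebra 𝕜 Λ₀) :
    collect Λ₀ (AddMonoidAlgebra.single m a) =
      AddMonoidAlgebra.mapDomainRingHom 𝕜 Λ₀.subtype a * AddMonoidAlgebra.single m 1 :=
  AddMonoidAlgebra.liftNC_single _ _ _ _

lemma coeff_collect_single_self (m : Λ) (a : AddMonoidAlgebra 𝕜 Λ₀) (l : Λ₀) :
    (collect Λ₀ (AddMonoidAlgebra.single m a)).coeff (l + m) = a.coeff l := by
  rw [collect_single, AddMonoidAlgebra.coeff_mul_single_apply, mul_one, add_neg_cancel_right]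
  exact Finsupp.mapDomain_apply Subtype.val_injective a.coeff l

lemma coeff_collect_single_of_notMem {m m' : Λ} (h : m - m' ∉ Λ₀) (a : AddMonoidAlgebra 𝕜 Λ₀)
    (l : Λ₀) : (collect Λ₀ (AddMonoidAlgebra.single m' a)).coeff (l + m) = 0 := by
  rw [collect_single, AddMonoidAlgebra.coeff_mul_single_apply, mul_one]
  refine Finsupp.mapDomain_of_notMem_range a.coeff _ ?_
  rintro ⟨l', hl'⟩
  refine h ?_
  have h1 : m - m' = l' - l := by
    rw [show (l' : Λ) = l + m + -m' from hl']
    abel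
  rw [h1]
  exact sub_mem l'.2 l.2

variable {Λ₀}

/-- Terms whose exponents lie in different classes modulo `Λ₀` do not cancel. -/
lemma eq_zero_of_collect_eq_zero {G : AddMonoidAlgebra (AddMonoidAlgebra 𝕜 Λ₀) Λ}
    (hG : ∀ m m', G.coeff m ≠ 0 → G.coeff m' ≠ 0 → m' - m ∈ Λ₀ → m = m')
    (h : collect Λ₀ G = 0) : G = 0 := by
  refine AddMonoidAlgebra.ext (Finsupp.ext fun m ↦ AddMonoidAlgebra.ext (Finsupp.ext fun l ↦ ?_))
  by_cases hm : G.coeff m = 0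
  · rw [hm]
    rfl
  have h1 : (collect Λ₀ G).coeff (l + m) = (G.coeff m).coeff l := by
    conv_lhs => rw [← AddMonoidAlgebra.sum_coeff_single G]
    rw [Finsupp.sum, map_sum, AddMonoidAlgebra.coeff_sum, Finsupp.finsetSum_apply,
      Finset.sum_eq_single m, coeff_collect_single_self]
    · intro m' hm' hne
      refine coeff_collect_single_of_notMem Λ₀ (fun hmem ↦ hne ?_) _ _
      exact hG m' m (Finsupp.mem_support_iff.mp hm') hm hmem
    · intro hm'
      rw [Finsupp.notMem_support_iff.mp hm', AddMonoidAlgebra.single_zero, map_zero]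
      rfl
  rw [← h1, h]
  rfl

end Collect

/-! ### Generation over an affine cover -/

section Charts

open Opposite

variable {X Y : Scheme.{u}} [IsIntegral X] [IsIntegral Y]

lemma ratFun_inv_mem_regularAt {U : X.Opens} {x : X} {s : Γ(X, U)} (hx : x ∈ X.basicOpen s) :
    (ratFun s)⁻¹ ∈ regularAt x := by
  have hxU : x ∈ U := X.basicOpen_le s hx
  obtain ⟨v, hv⟩ := (Scheme.mem_basicOpen X s x hxU).mp hx
  rw [← algebraMap_germ_eq_ratFun hxU, ← hv]
  refine ⟨((v⁻¹ : (X.presheaf.stalk x)ˣ) : X.presheaf.stalk x), ?_⟩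
  refine eq_inv_of_mul_eq_one_left ?_
  rw [← map_mul, Units.inv_mul, map_one]

section

variable {Λ : Type u} [AddCommGroup Λ] {W : DivisorLattice X Λ} {p : Y ⟶ X}
  {hp : p (genericPoint Y) = genericPoint X} {ζ : Λ →+ Additive (Y.functionField)ˣ}

lemma DivisorLattice.mem_stalk_zero {x : X} {g : X.functionField} (hg : g ∈ regularAt x) :
    g ∈ W.stalk x 0 := fun j _ ↦ by
  rw [map_zero, toMul_zero, Units.val_one, one_mul]
  exact hg

/-- It suffices to generate the functions on the preimages of the members of an affine cover. -/
lemma DivisorLattice.isGeneratedBy_of_affine [IsAffineHom p]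
    (h : ∀ x : X, ∃ V : X.Opens, x ∈ V ∧ IsAffineOpen V ∧ ∀ b : Γ(Y, p ⁻¹ᵁ V),
      ∃ F : AddMonoidAlgebra X.functionField Λ, (∀ x' ∈ V, F ∈ W.stalkRing x') ∧
        monomialEval (ratPull p hp) ζ F = ratFun b) :
    W.IsGeneratedBy p hp ζ := by
  intro U x hxU b
  -- A function on `p⁻¹(D(f))` is a quotient by a power of `f`, which is a unit near `x`.
  obtain ⟨V, hxV, hV, hgen⟩ := h x
  obtain ⟨f, hfU, hxf⟩ := hV.exists_basicOpen_le ⟨x, hxU⟩ hxV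
  let i : p ⁻¹ᵁ X.basicOpen f ⟶ p ⁻¹ᵁ V := homOfLE (p.preimage_mono (X.basicOpen_le f))
  have hloc := (hV.preimage p).isLocalization_of_eq_basicOpen (p.app V f) i
    (Scheme.preimage_basicOpen p f)
  let alg := (Y.presheaf.map i.op).hom.toAlgebra
  have hY : genericPoint Y ∈ p ⁻¹ᵁ X.basicOpen f :=
    DivisorLattice.genericPoint_mem_preimage hp (genericPoint_mem hxf)
  let i' : p ⁻¹ᵁ X.basicOpen f ⟶ p ⁻¹ᵁ U := homOfLE (p.preimage_mono hfU)
  obtain ⟨⟨b', ⟨_, n, rfl⟩⟩, hb⟩ := IsLocalization.surj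
    (Submonoid.powers (p.app V f)) (Y.presheaf.map i'.op b)
  obtain ⟨F, hF, hFb⟩ := hgen b'
  have hb1 : ratFun b * ratFun (p.app V f) ^ n = ratFun b' := by
    have h1 := congrArg (ratHom _ hY) hb
    rw [map_mul, ratHom_apply, ratHom_apply, ratHom_apply, ratFun_res hY] at h1
    change ratFun b * ratFun (Y.presheaf.map i.op (p.app V f ^ n)) =
      ratFun (Y.presheaf.map i.op b') at h1
    rwa [ratFun_res hY, ratFun_res hY, ← ratHom_apply (i.le hY), map_pow, ratHom_apply] at h1
  have hf : ratFun (p.app V f) ≠ 0 := by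
    have hm : genericPoint Y ∈ Y.basicOpen (p.app V f) := by
      rwa [← Scheme.preimage_basicOpen]
    have h1 := (Scheme.mem_basicOpen Y _ _ (i.le hY)).mp hm
    rw [ratFun_eq_germ (i.le hY)]
    exact h1.ne_zero
  refine ⟨AddMonoidAlgebra.single 0 ((ratFun f)⁻¹ ^ n) * F, mul_mem ?_ (hF x hxV), ?_⟩
  · exact single_mem_stalkRing (mem_stalk_zero (pow_mem (ratFun_inv_mem_regularAt hxf) n))
  · rw [map_mul, monomialEval_single, hFb, ← hb1, map_zero, toMul_zero, Units.val_one, mul_one,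
      map_pow, map_inv₀, ratPull_ratFun p hp (genericPoint_mem hxV)]
    rw [mul_comm (ratFun b), ← mul_assoc, ← mul_pow, inv_mul_cancel₀ hf, one_pow, one_mul]

end

/-! ### Charts and rational functions -/

variable {Z : Scheme.{u}} {A : CommRingCat.{u}} (q : X ⟶ Z) (f : Spec A ⟶ Z) [IsOpenImmersion f]

/-- An element of `A` as a regular function on the image of an open immersion `Spec A ⟶ Z`. -/
def funOn : A →+* Γ(Z, f ''ᵁ ⊤) := (f.appIso ⊤).inv.hom.comp (Scheme.ΓSpecIso A).inv.hom

lemma SpecMap_funOn (hV : IsAffineOpen (f ''ᵁ ⊤)) :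
    Spec.map (CommRingCat.ofHom (funOn f)) ≫ f = hV.fromSpec := by
  have h1 := hV.SpecMap_appLE_fromSpec f (isAffineOpen_top (Spec A)) (f.preimage_image_eq ⊤).ge
  rw [← f.appIso_hom', IsAffineOpen.fromSpec_top, Scheme.isoSpec_Spec_inv] at h1
  change Spec.map ((Scheme.ΓSpecIso A).inv ≫ (f.appIso ⊤).inv) ≫ f = _
  rw [Spec.map_comp, Category.assoc, ← h1, ← Category.assoc, ← Spec.map_comp, Iso.hom_inv_id,
    Spec.map_id, Category.id_comp]

lemma exists_funOn_eq (s : Γ(Z, f ''ᵁ ⊤)) : ∃ a, funOn f a = s :=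
  ⟨(Scheme.ΓSpecIso A).hom ((f.appIso ⊤).hom s), by
    change (f.appIso ⊤).inv ((Scheme.ΓSpecIso A).inv ((Scheme.ΓSpecIso A).hom _)) = s
    simp⟩

/-- The rational function on `X` defined by pulling back an element of `A`, seen as a function on an
open subscheme `Spec A` of `Z`, along `q : X ⟶ Z`. -/
def ratMap (h : q (genericPoint X) ∈ f ''ᵁ ⊤) : A →+* X.functionField :=
  (ratHom (q ⁻¹ᵁ (f ''ᵁ ⊤)) h).comp ((q.app _).hom.comp (funOn f))

lemma ratMap_apply (h : q (genericPoint X) ∈ f ''ᵁ ⊤) (a : A) :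
    ratMap q f h a = ratFun (q.app _ (funOn f a)) := ratHom_apply _ _

lemma SpecMap_ratMap (h : q (genericPoint X) ∈ f ''ᵁ ⊤) :
    Spec.map (CommRingCat.ofHom (ratMap q f h)) ≫ f = X.fromSpecStalk (genericPoint X) ≫ q := by
  have hV : IsAffineOpen (f ''ᵁ ⊤) := (isAffineOpen_top _).image_of_isOpenImmersion f
  obtain ⟨_, ⟨U, hU, rfl⟩, hxU, hUV⟩ := X.isBasis_affineOpens.exists_subset_of_mem_open
    h (q ⁻¹ᵁ (f ''ᵁ ⊤)).2
  replace hU : IsAffineOpen U := hU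
  replace hxU : genericPoint X ∈ U := hxU
  replace hUV : U ≤ q ⁻¹ᵁ (f ''ᵁ ⊤) := hUV
  have h1 : CommRingCat.ofHom (ratMap q f h) = CommRingCat.ofHom (funOn f) ≫
      q.appLE (f ''ᵁ ⊤) U hUV ≫ X.presheaf.germ U _ hxU := by
    rw [Scheme.Hom.appLE, Category.assoc, X.presheaf.germ_res]
    rfl
  rw [h1, Spec.map_comp, Category.assoc, SpecMap_funOn f hV, Spec.map_comp, Category.assoc,
    hV.SpecMap_appLE_fromSpec q hU, ← hU.fromSpecStalk_eq_fromSpecStalk hxU,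
    IsAffineOpen.fromSpecStalk, Category.assoc]

lemma ratMap_eq_of_comp_eq {h : q (genericPoint X) ∈ f ''ᵁ ⊤} {r : A →+* X.functionField}
    (hr : Spec.map (CommRingCat.ofHom r) ≫ f = X.fromSpecStalk (genericPoint X) ≫ q) :
    ratMap q f h = r := by
  rw [← SpecMap_ratMap q f h, cancel_mono] at hr
  exact congrArg CommRingCat.Hom.hom (Spec.map_injective hr).symm

section Immersion

variable {X : Scheme.{u}} [IsIntegral X] {A : CommRingCat.{u}} (f : Spec A ⟶ X) [IsOpenImmersion f]

lemma genericPoint_mem_image [Nontrivial A] : (𝟙 X) (genericPoint X) ∈ f ''ᵁ ⊤ :=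
  genericPoint_mem (x := f (Nonempty.some inferInstance)) ⟨_, trivial, rfl⟩

/-- An element of `A` as a rational function on a scheme in which `Spec A` is open. -/
def chartRat [Nontrivial A] : A →+* X.functionField := ratMap (𝟙 X) f (genericPoint_mem_image f)

lemma chartRat_apply [Nontrivial A] (a : A) : chartRat f a = ratFun (funOn f a) := by
  rw [chartRat, ratMap_apply]
  rfl

lemma SpecMap_chartRat [Nontrivial A] :
    Spec.map (CommRingCat.ofHom (chartRat f)) ≫ f = X.fromSpecStalk (genericPoint X) :=
  (SpecMap_ratMap _ _ _).trans (Category.comp_id _)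

lemma chartRat_mem_regularAt [Nontrivial A] (a : A) {x : X} (hx : x ∈ f ''ᵁ ⊤) :
    chartRat f a ∈ regularAt x := by
  rw [chartRat_apply]
  exact ratFun_mem_regularAt hx _

lemma chartRat_injective [IsDomain A] : Function.Injective (chartRat f) := by
  intro a b h
  rw [chartRat_apply, chartRat_apply] at h
  have h1 := ratFun_injective (genericPoint_mem_image f) h
  have h2 : Function.Injective ((Scheme.ΓSpecIso A).inv ≫ (f.appIso ⊤).inv) :=
    (ConcreteCategory.bijective_of_isIso ((Scheme.ΓSpecIso A).inv ≫ (f.appIso ⊤).inv)).1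
  exact h2 h1

lemma exists_chartRat_eq [Nontrivial A] {U : X.Opens} (hU : U = f ''ᵁ ⊤) (b : Γ(X, U)) :
    ∃ a, chartRat f a = ratFun b := by
  subst hU
  obtain ⟨a, rfl⟩ := exists_funOn_eq f b
  exact ⟨a, chartRat_apply f a⟩

/-- Every rational function is a quotient of elements of the coordinate ring of a chart. -/
lemma exists_mul_chartRat_eq [IsDomain A] (g : X.functionField) :
    ∃ b : A, b ≠ 0 ∧ ∃ a, g * chartRat f b = chartRat f a := by
  have : Nonempty (f ''ᵁ ⊤) := ⟨⟨_, genericPoint_mem_image f⟩⟩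
  have hfr := functionField_isFractionRing_of_isAffineOpen (X := X) (f ''ᵁ ⊤)
    ((isAffineOpen_top _).image_of_isOpenImmersion f)
  obtain ⟨⟨s, ⟨d, hd⟩⟩, h⟩ := IsLocalization.surj (nonZeroDivisors Γ(X, f ''ᵁ ⊤)) g
  obtain ⟨a, rfl⟩ := exists_funOn_eq f s
  obtain ⟨b, rfl⟩ := exists_funOn_eq f d
  refine ⟨b, ?_, a, ?_⟩
  · rintro rfl
    exact nonZeroDivisors.ne_zero hd (map_zero _)
  · rw [chartRat_apply, chartRat_apply, ratFun_eq_germ (genericPoint_mem_image f),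
      ratFun_eq_germ (genericPoint_mem_image f)]
    exact h

/-- Common denominators. -/
lemma exists_mul_map_chartRat_eq [IsDomain A] {Λ : Type u} [AddCommGroup Λ]
    (F : AddMonoidAlgebra X.functionField Λ) :
    ∃ b : A, b ≠ 0 ∧ ∃ G : AddMonoidAlgebra A Λ,
      AddMonoidAlgebra.single 0 (chartRat f b) * F =
        AddMonoidAlgebra.mapRingHom Λ (chartRat f) G := by
  induction F using AddMonoidAlgebra.induction_linear with
  | zero => exact ⟨1, one_ne_zero, 0, by rw [mul_zero, map_zero]⟩
  | add F F' hF hF' =>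
    obtain ⟨b, hb, G, hG⟩ := hF
    obtain ⟨b', hb', G', hG'⟩ := hF'
    refine ⟨b * b', mul_ne_zero hb hb', AddMonoidAlgebra.single 0 b' * G +
      AddMonoidAlgebra.single 0 b * G', ?_⟩
    have h1 : AddMonoidAlgebra.single (0 : Λ) (chartRat f (b * b')) =
        AddMonoidAlgebra.single 0 (chartRat f b) * AddMonoidAlgebra.single 0 (chartRat f b') := by
      rw [AddMonoidAlgebra.single_mul_single, add_zero, map_mul]
    rw [h1, map_add, map_mul, map_mul, ← hG, ← hG', AddMonoidAlgebra.mapRingHom_single,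
      AddMonoidAlgebra.mapRingHom_single]
    ring
  | single m g =>
    obtain ⟨b, hb, a, ha⟩ := exists_mul_chartRat_eq f g
    refine ⟨b, hb, AddMonoidAlgebra.single m a, ?_⟩
    rw [AddMonoidAlgebra.single_mul_single, AddMonoidAlgebra.mapRingHom_single, zero_add, mul_comm,
      ha]

/-- Monomials of different classes modulo the image of `Λ₀` in `Λ` are linearly independent over the
rational functions, for schemes with charts `Spec 𝕜[Λ₀]` and `Spec 𝕜[Λ]`. -/
lemma eq_zero_of_isNormal_of_monomialEval_eq_zero {X Y : Scheme.{u}} [IsIntegral X] [IsIntegral Y]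
    {𝕜 Λ : Type u} [Field 𝕜] [AddCommGroup Λ] {Λ₀ : AddSubgroup Λ}
    [IsDomain (AddMonoidAlgebra 𝕜 Λ₀)] [IsDomain (AddMonoidAlgebra 𝕜 Λ)]
    (f : Spec (.of (AddMonoidAlgebra 𝕜 Λ₀)) ⟶ X) [IsOpenImmersion f]
    (g : Spec (.of (AddMonoidAlgebra 𝕜 Λ)) ⟶ Y) [IsOpenImmersion g]
    {r : X.functionField →+* Y.functionField} {ζ : Λ →+ Additive (Y.functionField)ˣ}
    (hr : ∀ a, r (chartRat f a) = chartRat g (AddMonoidAlgebra.mapDomainRingHom 𝕜 Λ₀.subtype a))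
    (hζ : ∀ m, ((ζ m).toMul : Y.functionField) = chartRat g (AddMonoidAlgebra.single m 1))
    {F : AddMonoidAlgebra X.functionField Λ} (hF : IsNormal Λ₀ F)
    (h0 : monomialEval r ζ F = 0) : F = 0 := by
  obtain ⟨b, hb, G, hG⟩ := exists_mul_map_chartRat_eq f F
  have hb' : chartRat f b ≠ 0 := fun h ↦ hb (chartRat_injective f (h.trans (map_zero _).symm))
  have hcoeff : ∀ m, chartRat f b * F.coeff m = chartRat f (G.coeff m) := fun m ↦ by
    have h1 := congrArg (fun H ↦ H.coeff m) hG
    change (AddMonoidAlgebra.single 0 _ * F).coeff m = _ at h1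
    rwa [AddMonoidAlgebra.coeff_single_zero_mul, AddMonoidAlgebra.coeff_mapRingHom] at h1
  have heval : ∀ H : AddMonoidAlgebra (AddMonoidAlgebra 𝕜 Λ₀) Λ,
      chartRat g (collect Λ₀ H) =
        monomialEval r ζ (AddMonoidAlgebra.mapRingHom Λ (chartRat f) H) := by
    intro H
    induction H using AddMonoidAlgebra.induction_linear with
    | zero => rw [map_zero, map_zero, map_zero, map_zero]
    | add H H' h h' => rw [map_add, map_add, map_add, map_add, h, h']
    | single m a =>
      rw [collect_single, map_mul, AddMonoidAlgebra.mapRingHom_single, monomialEval_single, hr, hζ]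
  have hG0 : G = 0 := by
    refine eq_zero_of_collect_eq_zero (fun m m' hm hm' h ↦ hF m m' ?_ ?_ h)
      (chartRat_injective g ?_)
    · rintro h
      exact hm (chartRat_injective f (by rw [← hcoeff, h, mul_zero, map_zero]))
    · rintro h
      exact hm' (chartRat_injective f (by rw [← hcoeff, h, mul_zero, map_zero]))
    · rw [heval, ← hG, map_mul, h0, mul_zero, map_zero]
  refine AddMonoidAlgebra.ext (Finsupp.ext fun m ↦ ?_)
  have h1 := hcoeff m
  rw [hG0, AddMonoidAlgebra.coeff_zero, Finsupp.zero_apply, map_zero] at h1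
  exact (mul_eq_zero.mp h1).resolve_left hb'

end Immersion

end Charts

/-! ### The topology of the glued spaces -/

namespace StarDatum

variable {I : Type u} (D : StarDatum I)

lemma ι₀_apply (x : D.X₀) : D.ι₀ x = D.ιOp ⊤ ⟨x, trivial⟩ := by
  rw [ιOp_eq]
  rfl

/-- The glued scheme is covered by the centre and the charts. -/
lemma exists_eq (x : D.glued) : (∃ a, D.ι₀ a = x) ∨ ∃ i a, D.ι i a = x := by
  obtain ⟨a, y, h⟩ := Scheme.IsLocallyDirected.ι_jointly_surjective D.diagram x
  cases a with
  | op W =>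
    refine .inl ⟨W.ι y, ?_⟩
    change D.ιOp W y = x at h
    rw [ιOp_eq] at h
    exact h
  | chart i => exact .inr ⟨i, y, h⟩

/-- The centre and a chart are only identified along the gluing locus. -/
lemma exists_of_ι₀_eq_ι {i : I} {x : D.X₀} {y : D.X i} (h : D.ι₀ x = D.ι i y) :
    ∃ v : D.V i, v.1 = x ∧ D.j i v = y := by
  rw [ι₀_apply] at h
  obtain ⟨k, f, g, z, hf, hg⟩ := (Scheme.IsLocallyDirected.ι_eq_ι_iff D.diagram).mp h
  cases k with
  | op W =>
    have hW : W ≤ D.V i := D.op_le_chart g.le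
    refine ⟨D.X₀.homOfLE hW z, ?_, hg⟩
    have h1 : (D.X₀.homOfLE le_top z).1 = x := congrArg Subtype.val hf
    exact ((Scheme.homOfLE_apply ..).trans (Scheme.homOfLE_apply ..).symm).trans h1
  | chart i => exact (D.not_chart_le_op f.le).elim

/-- Different charts are only identified through the centre. -/
lemma exists_of_ι_eq_ι {i i' : I} (hi : i ≠ i') {x : D.X i} {y : D.X i'} (h : D.ι i x = D.ι i' y) :
    ∃ a, D.ι₀ a = D.ι i x := by
  obtain ⟨k, f, g, z, hf, hg⟩ := (Scheme.IsLocallyDirected.ι_eq_ι_iff D.diagram).mp h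
  cases k with
  | op W =>
    refine ⟨W.ι z, ?_⟩
    change (W.ι ≫ D.ι₀) z = D.ι i x
    rw [← ιOp_eq, ← hf]
    have h1 := colimit.w D.diagram f
    exact congrArg (fun q : W.toScheme ⟶ D.glued ↦ q z) h1.symm
  | chart j => exact (hi ((D.chart_le_chart f.le).symm.trans (D.chart_le_chart g.le))).elim

end StarDatum

namespace MutationDatum

variable {Q Q' I : Type u} [AddCommGroup Q] [AddCommGroup Q'] (𝕜 : Type u) [Field 𝕜]
  (D : MutationDatum Q I) {D' : MutationDatum Q' I}

lemma mem_torusOpen_or_mem_chartOpen (x : D.space 𝕜) :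
    x ∈ D.torusOpen 𝕜 ∨ ∃ i, x ∈ D.chartOpen 𝕜 i := by
  obtain ⟨a, h⟩ | ⟨i, a, h⟩ := (D.star 𝕜).exists_eq x
  · exact .inl ⟨a, trivial, h⟩
  · exact .inr ⟨i, a, trivial, h⟩

lemma mem_torusOpen_of_mem_chartOpen {i i' : I} (hi : i ≠ i') {x : D.space 𝕜}
    (h : x ∈ D.chartOpen 𝕜 i) (h' : x ∈ D.chartOpen 𝕜 i') : x ∈ D.torusOpen 𝕜 := by
  obtain ⟨a, -, rfl⟩ := h
  obtain ⟨b, -, hb⟩ := h'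
  obtain ⟨c, hc⟩ := (D.star 𝕜).exists_of_ι_eq_ι hi hb.symm
  exact ⟨c, trivial, hc⟩

/-- The torus and a chart are glued along the overlap. -/
lemma exists_of_torus_eq_chart {i : I} {x : Spec (.of (AddMonoidAlgebra 𝕜 Q))}
    {y : Spec (.of (AddMonoidAlgebra 𝕜 (D.chartMonoid i)))} (h : D.torus 𝕜 x = D.chart 𝕜 i y) :
    ∃ z : Spec (.of (D.OverlapRing 𝕜 i)),
      Spec.map (CommRingCat.ofHom (algebraMap (AddMonoidAlgebra 𝕜 Q) (D.OverlapRing 𝕜 i))) z = x ∧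
        Spec.map (CommRingCat.ofHom (D.mutationMap 𝕜 i).toRingHom) z = y := by
  obtain ⟨v, rfl, rfl⟩ := (D.star 𝕜).exists_of_ι₀_eq_ι h
  let f := Spec.map (CommRingCat.ofHom (algebraMap (AddMonoidAlgebra 𝕜 Q) (D.OverlapRing 𝕜 i)))
  have e : f.isoOpensRange.inv ≫ f = f.opensRange.ι := f.isoOpensRange_inv_comp
  exact ⟨f.isoOpensRange.inv v, congrArg (fun q : f.opensRange.toScheme ⟶ _ ↦ q v) e, rfl⟩

/-- The function `1 + z^ψ` (or `1`, for frozen `i`) in the coordinates of the chart. -/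
def chartWall (i : I) : AddMonoidAlgebra 𝕜 (D.chartMonoid i) :=
  open Classical in
  if h : i ∈ D.F then 1 else 1 + AddMonoidAlgebra.single ⟨D.ψ i, fun hi ↦ (h hi).elim⟩ 1

lemma chartIncl_chartWall (i : I) : D.chartIncl 𝕜 i (D.chartWall 𝕜 i) = D.wall 𝕜 i := by
  by_cases h : i ∈ D.F
  · rw [chartWall, dif_pos h, wall, if_pos h, map_one]
  · rw [chartWall, dif_neg h, wall, if_neg h, map_add, map_one, chartIncl_single]

lemma mutationMap_chartWall (i : I) :
    D.mutationMap 𝕜 i (D.chartWall 𝕜 i) = algebraMap _ _ (D.wall 𝕜 i) := by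
  change (D.mutationMap 𝕜 i).toRingHom _ = _
  rw [mutationMap_eq]
  change D.twist 𝕜 i (-1) (algebraMap _ _ (D.chartIncl 𝕜 i _)) = _
  rw [chartIncl_chartWall, twist_algebraMap, twist_wall]

/-- The monomial `z^v` has a zero along the boundary divisor of the chart `i`. -/
def IsBoundaryMonomial (i : I) (v : D.chartMonoid i) : Prop :=
  (i ∈ D.F → 0 < D.u i v.1) ∧ (i ∉ D.F → v = 0)

variable {D} in
lemma IsBoundaryMonomial.add_nsmul_mem {i : I} {v : D.chartMonoid i} (hv : D.IsBoundaryMonomial i v)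
    (q : Q) : ∃ n₀ : ℕ, ∀ n ≥ n₀, q + n • v.1 ∈ D.chartMonoid i := by
  by_cases hi : i ∈ D.F
  · refine ⟨(D.u i q).natAbs, fun n hn _ ↦ ?_⟩
    have h0 := hv.1 hi
    rw [map_add, map_nsmul, nsmul_eq_mul]
    have h1 : -((D.u i q).natAbs : ℤ) ≤ D.u i q := by omega
    have h2 : ((D.u i q).natAbs : ℤ) ≤ n := by exact_mod_cast hn
    nlinarith
  · exact ⟨0, fun n _ h ↦ (hi h).elim⟩

/-- The equation of the complement of the torus in a chart. -/
lemma mem_torusOpen_iff {i : I} {v : D.chartMonoid i} (hv : D.IsBoundaryMonomial i v)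
    (y : Spec (.of (AddMonoidAlgebra 𝕜 (D.chartMonoid i)))) :
    D.chart 𝕜 i y ∈ D.torusOpen 𝕜 ↔
      AddMonoidAlgebra.single v 1 * D.chartWall 𝕜 i ∉ y.asIdeal := by
  constructor
  · rintro ⟨x, -, hx⟩ hmem
    obtain ⟨z, -, rfl⟩ := D.exists_of_torus_eq_chart 𝕜 hx
    have h1 : D.mutationMap 𝕜 i (AddMonoidAlgebra.single v 1 * D.chartWall 𝕜 i) ∈ z.asIdeal := hmem
    have h2 : IsUnit (D.mutationMap 𝕜 i (AddMonoidAlgebra.single v 1 * D.chartWall 𝕜 i)) := by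
      rw [map_mul, mutationMap_chartWall, mutationMap_single]
      refine (IsUnit.mul (.map _ ?_) (Units.isUnit _)).mul
        (IsLocalization.Away.algebraMap_isUnit _)
      refine IsUnit.of_mul_eq_one (AddMonoidAlgebra.single (-v.1) 1) ?_
      rw [AddMonoidAlgebra.single_mul_single, add_neg_cancel, mul_one]
      rfl
    exact z.2.ne_top (Ideal.eq_top_of_isUnit_mem _ h1 h2)
  · intro hy
    have hloc := D.isLocalization_chartIncl 𝕜 i v hv.add_nsmul_mem
    obtain ⟨z, hz⟩ : ∃ z : PrimeSpectrum (AddMonoidAlgebra 𝕜 Q),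
        PrimeSpectrum.comap (D.chartIncl 𝕜 i) z = y := by
      let := (D.chartIncl 𝕜 i).toAlgebra
      have h1 := PrimeSpectrum.localization_away_comap_range (AddMonoidAlgebra 𝕜 Q)
        (AddMonoidAlgebra.single v 1 : AddMonoidAlgebra 𝕜 (D.chartMonoid i))
      have h2 : y ∈ Set.range (PrimeSpectrum.comap (algebraMap
          (AddMonoidAlgebra 𝕜 (D.chartMonoid i)) (AddMonoidAlgebra 𝕜 Q))) := by
        rw [h1]
        exact fun h ↦ hy (Ideal.mul_mem_right _ _ h)
      exact h2
    obtain ⟨w, hw⟩ : ∃ w : PrimeSpectrum (D.OverlapRing 𝕜 i),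
        PrimeSpectrum.comap (algebraMap _ _) w = z := by
      have h1 := PrimeSpectrum.localization_away_comap_range (D.OverlapRing 𝕜 i) (D.wall 𝕜 i)
      have h2 : z ∈ Set.range (PrimeSpectrum.comap (algebraMap (AddMonoidAlgebra 𝕜 Q)
          (D.OverlapRing 𝕜 i))) := by
        rw [h1]
        intro h
        refine hy (Ideal.mul_mem_left _ _ ?_)
        rw [← hz]
        change D.chartIncl 𝕜 i _ ∈ z.asIdeal
        rw [chartIncl_chartWall]
        exact h
      exact h2
    have h1 : PrimeSpectrum.comap (D.twist 𝕜 i (-1))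
        (PrimeSpectrum.comap (D.twist 𝕜 i 1) w) = w := by
      rw [← PrimeSpectrum.comap_comp_apply, twist_comp_twist _ _ _ (by norm_num)]
      rfl
    have h2 : Spec.map (CommRingCat.ofHom (D.mutationMap 𝕜 i).toRingHom)
        (PrimeSpectrum.comap (D.twist 𝕜 i 1) w) = y := by
      rw [mutationMap_eq]
      rw [← hz, ← hw]
      conv_rhs => rw [← h1]
      rfl
    let w' : Spec (.of (D.OverlapRing 𝕜 i)) := PrimeSpectrum.comap (D.twist 𝕜 i 1) w
    refine ⟨Spec.map (CommRingCat.ofHom (algebraMap _ (D.OverlapRing 𝕜 i))) w', trivial, ?_⟩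
    rw [← h2]
    exact congrArg (fun q : Spec (.of (D.OverlapRing 𝕜 i)) ⟶ _ ↦ q w') (D.overlap_torus 𝕜 i)

lemma mem_chartOpen_iff {i : I} (x : Spec (.of (AddMonoidAlgebra 𝕜 Q))) :
    D.torus 𝕜 x ∈ D.chartOpen 𝕜 i ↔ D.wall 𝕜 i ∉ x.asIdeal := by
  have h1 := PrimeSpectrum.localization_away_comap_range (D.OverlapRing 𝕜 i) (D.wall 𝕜 i)
  constructor
  · rintro ⟨y, -, hy⟩
    obtain ⟨z, rfl, -⟩ := D.exists_of_torus_eq_chart 𝕜 hy.symm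
    exact h1.le ⟨z, rfl⟩
  · intro hx
    obtain ⟨z, rfl⟩ := h1.ge hx
    exact ⟨_, trivial, congrArg (fun q : Spec (.of (D.OverlapRing 𝕜 i)) ⟶ _ ↦ q z)
      (D.overlap_torus 𝕜 i).symm⟩

variable {D}

namespace Hom

variable (h : Hom D D')

lemma map_chartWall (i : I) :
    AddMonoidAlgebra.mapDomainRingHom 𝕜 (h.onChart i) (D.chartWall 𝕜 i) = D'.chartWall 𝕜 i := by
  by_cases hi : i ∈ D.F
  · rw [chartWall, chartWall, dif_pos hi, dif_pos (by rwa [h.F_eq]), map_one]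
  · rw [chartWall, chartWall, dif_neg hi, dif_neg (by rwa [h.F_eq]), map_add, map_one,
      AddMonoidAlgebra.mapDomainRingHom_apply, AddMonoidAlgebra.mapDomain_single]
    congr 3
    exact Subtype.ext (h.ψ_apply i)

lemma isBoundaryMonomial_onChart {i : I} {v : D.chartMonoid i} (hv : D.IsBoundaryMonomial i v) :
    D'.IsBoundaryMonomial i (h.onChart i v) := by
  refine ⟨fun hi ↦ ?_, fun hi ↦ ?_⟩
  · change 0 < D'.u i (h.toHom v.1)
    rw [h.u_apply]
    exact hv.1 (by rwa [← h.F_eq])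
  · rw [hv.2 (by rwa [← h.F_eq]), map_zero]

lemma preimage_torusOpen (hv : ∀ i, ∃ v, D.IsBoundaryMonomial i v) :
    h.spaceMap 𝕜 ⁻¹ᵁ D.torusOpen 𝕜 = D'.torusOpen 𝕜 := by
  refine le_antisymm (fun x hx ↦ ?_) ?_
  · obtain hx' | ⟨i, a, -, rfl⟩ := D'.mem_torusOpen_or_mem_chartOpen 𝕜 x
    · exact hx'
    obtain ⟨v, hv⟩ := hv i
    refine (D'.mem_torusOpen_iff 𝕜 (h.isBoundaryMonomial_onChart hv) a).mpr ?_
    change (D'.chart 𝕜 i ≫ h.spaceMap 𝕜) a ∈ D.torusOpen 𝕜 at hx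
    rw [chart_spaceMap] at hx
    have h1 := (D.mem_torusOpen_iff 𝕜 hv _).mp hx
    change AddMonoidAlgebra.mapDomainRingHom 𝕜 (h.onChart i) _ ∉ a.asIdeal at h1
    rwa [map_mul, map_chartWall, AddMonoidAlgebra.mapDomainRingHom_apply,
      AddMonoidAlgebra.mapDomain_single] at h1
  · rintro _ ⟨a, -, rfl⟩
    change (D'.torus 𝕜 ≫ h.spaceMap 𝕜) a ∈ D.torusOpen 𝕜
    rw [torus_spaceMap]
    exact ⟨_, trivial, rfl⟩

lemma preimage_chartOpen (hv : ∀ i, ∃ v, D.IsBoundaryMonomial i v) (i : I) :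
    h.spaceMap 𝕜 ⁻¹ᵁ D.chartOpen 𝕜 i = D'.chartOpen 𝕜 i := by
  have hle : ∀ j, D'.chartOpen 𝕜 j ≤ h.spaceMap 𝕜 ⁻¹ᵁ D.chartOpen 𝕜 j := by
    rintro j _ ⟨a, -, rfl⟩
    change (D'.chart 𝕜 j ≫ h.spaceMap 𝕜) a ∈ D.chartOpen 𝕜 j
    rw [chart_spaceMap]
    exact ⟨_, trivial, rfl⟩
  refine le_antisymm (fun x hx ↦ ?_) (hle i)
  by_cases hx' : x ∈ D'.torusOpen 𝕜
  · obtain ⟨a, -, rfl⟩ := hx'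
    refine (D'.mem_chartOpen_iff 𝕜 a).mpr ?_
    change (D'.torus 𝕜 ≫ h.spaceMap 𝕜) a ∈ D.chartOpen 𝕜 i at hx
    rw [torus_spaceMap] at hx
    have h1 := (D.mem_chartOpen_iff 𝕜 _).mp hx
    change AddMonoidAlgebra.mapDomainRingHom 𝕜 h.toHom _ ∉ a.asIdeal at h1
    rwa [map_wall] at h1
  · obtain ⟨j, hj⟩ := (D'.mem_torusOpen_or_mem_chartOpen 𝕜 x).resolve_left hx'
    by_cases hij : i = j
    · exact hij ▸ hj
    · rw [← h.preimage_torusOpen 𝕜 hv] at hx'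
      exact (hx' (D.mem_torusOpen_of_mem_chartOpen 𝕜 hij hx (hle j hj))).elim

end Hom

end MutationDatum

/-! ### Fibres over points of tori -/

section Twisted

variable {𝕜 K M P : Type u} [Field 𝕜] [AddCommGroup K] [AddCommMonoid M] [AddCommMonoid P]

/-- The ring homomorphism `𝕜[M] → 𝕜[P]`, `z^q ↦ τ(q) z^(π q)`. -/
def twistedMap (π : M →+ P) (τ : AddChar M 𝕜) : AddMonoidAlgebra 𝕜 M →+* AddMonoidAlgebra 𝕜 P :=
  (AddMonoidAlgebra.lift 𝕜 (AddMonoidAlgebra 𝕜 P) M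
    { toFun := fun q ↦ AddMonoidAlgebra.single (π q.toAdd) (τ q.toAdd)
      map_one' := by rw [toAdd_one, map_zero, AddChar.map_zero_eq_one]; rfl
      map_mul' := fun a b ↦ by
        rw [toAdd_mul, map_add, AddChar.map_add_eq_mul,
          AddMonoidAlgebra.single_mul_single] }).toRingHom

lemma twistedMap_single (π : M →+ P) (τ : AddChar M 𝕜) (q : M) (c : 𝕜) :
    twistedMap π τ (AddMonoidAlgebra.single q c) = AddMonoidAlgebra.single (π q) (c * τ q) := by
  change AddMonoidAlgebra.lift 𝕜 (AddMonoidAlgebra 𝕜 P) M _ (AddMonoidAlgebra.single q c) = _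
  rw [AddMonoidAlgebra.lift_single]
  exact AddMonoidAlgebra.smul_single _ _ _

lemma twistedMap_comp_eq {k : K →+ M} {φ : AddChar K 𝕜} {π : M →+ P} {τ : AddChar M 𝕜}
    (hτ : ∀ x, τ (k x) = φ x) (hk : ∀ x, π (k x) = 0) :
    (twistedMap π τ).comp (AddMonoidAlgebra.mapDomainRingHom 𝕜 k) =
      (algebraMap 𝕜 (AddMonoidAlgebra 𝕜 P)).comp
        (AddMonoidAlgebra.lift 𝕜 𝕜 K φ.toMonoidHom).toRingHom := by
  refine AddMonoidAlgebra.ringHom_ext (fun r ↦ ?_) (fun q ↦ ?_)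
  · rw [RingHom.comp_apply, AddMonoidAlgebra.mapDomainRingHom_apply,
      AddMonoidAlgebra.mapDomain_single, map_zero, twistedMap_single, map_zero,
      AddChar.map_zero_eq_one, mul_one]
    change _ = algebraMap 𝕜 _ (AddMonoidAlgebra.lift 𝕜 𝕜 K _ _)
    rw [AddMonoidAlgebra.lift_single]
    simp
  · rw [RingHom.comp_apply, AddMonoidAlgebra.mapDomainRingHom_apply,
      AddMonoidAlgebra.mapDomain_single, twistedMap_single, hk, hτ, one_mul]
    change _ = algebraMap 𝕜 _ (AddMonoidAlgebra.lift 𝕜 𝕜 K _ _)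
    rw [AddMonoidAlgebra.lift_single, one_smul]
    rfl

lemma twistedMap_surjective {π : M →+ P} {τ : AddChar M 𝕜} (hτ0 : ∀ q, τ q ≠ 0)
    (hπ : Function.Surjective π) : Function.Surjective (twistedMap π τ) := by
  intro a
  induction a using AddMonoidAlgebra.induction_linear with
  | zero => exact ⟨0, map_zero _⟩
  | add a b ha hb =>
    obtain ⟨a, rfl⟩ := ha
    obtain ⟨b, rfl⟩ := hb
    exact ⟨a + b, map_add _ _ _⟩
  | single p c =>
    obtain ⟨q, rfl⟩ := hπ p
    exact ⟨AddMonoidAlgebra.single q (c / τ q), by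
      rw [twistedMap_single, div_mul_cancel₀ _ (hτ0 q)]⟩

lemma exists_comp_twistedMap_eq {k : K →+ M} {φ : AddChar K 𝕜} {π : M →+ P} {τ : AddChar M 𝕜}
    (hτ : ∀ x, τ (k x) = φ x) (hτ0 : ∀ q, τ q ≠ 0)
    (hπ : Function.Surjective π) (hker : ∀ q q', π q = π q' → ∃ x, q' = q + k x)
    {R : Type u} [CommRing R] {a : AddMonoidAlgebra 𝕜 M →+* R} {b : 𝕜 →+* R}
    (hab : a.comp (AddMonoidAlgebra.mapDomainRingHom 𝕜 k) =
      b.comp (AddMonoidAlgebra.lift 𝕜 𝕜 K φ.toMonoidHom).toRingHom) :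
    ∃ d : AddMonoidAlgebra 𝕜 P →+* R, d.comp (twistedMap π τ) = a ∧
      d.comp (algebraMap 𝕜 (AddMonoidAlgebra 𝕜 P)) = b := by
  have h0 : ∀ r, a (AddMonoidAlgebra.single 0 r) = b r := fun r ↦ by
    have h1 := RingHom.congr_fun hab (AddMonoidAlgebra.single 0 r)
    rw [RingHom.comp_apply, AddMonoidAlgebra.mapDomainRingHom_apply,
      AddMonoidAlgebra.mapDomain_single, map_zero] at h1
    rw [h1]
    change b (AddMonoidAlgebra.lift 𝕜 𝕜 K _ _) = _
    rw [AddMonoidAlgebra.lift_single]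
    simp
  have h1 : ∀ x, a (AddMonoidAlgebra.single (k x) 1) = b (φ x) := fun x ↦ by
    have h1 := RingHom.congr_fun hab (AddMonoidAlgebra.single x 1)
    rw [RingHom.comp_apply, AddMonoidAlgebra.mapDomainRingHom_apply,
      AddMonoidAlgebra.mapDomain_single] at h1
    rw [h1]
    change b (AddMonoidAlgebra.lift 𝕜 𝕜 K _ _) = _
    rw [AddMonoidAlgebra.lift_single, one_smul]
    rfl
  let c : M → R := fun q ↦ a (AddMonoidAlgebra.single q 1) * b (τ q)⁻¹
  have hc0 : c 0 = 1 := by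
    change a (AddMonoidAlgebra.single 0 1) * b (τ 0)⁻¹ = 1
    rw [h0, AddChar.map_zero_eq_one, inv_one, map_one, one_mul]
  have hcadd : ∀ q q', c (q + q') = c q * c q' := fun q q' ↦ by
    have h2 : AddMonoidAlgebra.single (q + q') (1 : 𝕜) =
        AddMonoidAlgebra.single q 1 * AddMonoidAlgebra.single q' 1 := by
      rw [AddMonoidAlgebra.single_mul_single, one_mul]
    change a _ * b _ = a _ * b _ * (a _ * b _)
    rw [h2, map_mul, AddChar.map_add_eq_mul, mul_inv, map_mul]
    ring
  have hck : ∀ x, c (k x) = 1 := fun x ↦ by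
    change a _ * b _ = 1
    rw [h1, hτ, ← map_mul, mul_inv_cancel₀ (hτ x ▸ hτ0 _), map_one]
  have hc : ∀ q q', π q = π q' → c q = c q' := fun q q' h ↦ by
    obtain ⟨x, rfl⟩ := hker q q' h
    rw [hcadd, hck, mul_one]
  have hs := Function.rightInverse_surjInv hπ
  let d : AddMonoidAlgebra 𝕜 P →+* R := AddMonoidAlgebra.liftNCRingHom b
    { toFun := fun p : Multiplicative P ↦ c (Function.surjInv hπ p.toAdd)
      map_one' := by
        rw [← hc0]
        exact hc _ _ ((hs _).trans (map_zero π).symm)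
      map_mul' := fun p p' ↦ by
        rw [← hcadd]
        exact hc _ _ (by rw [hs, map_add, hs, hs]; rfl) } fun _ _ ↦ Commute.all _ _
  have hd : ∀ p r, d (AddMonoidAlgebra.single p r) = b r * c (Function.surjInv hπ p) :=
    fun p r ↦ AddMonoidAlgebra.liftNC_single _ _ _ _
  refine ⟨d, AddMonoidAlgebra.ringHom_ext (fun r ↦ ?_) (fun q ↦ ?_), RingHom.ext fun r ↦ ?_⟩
  · rw [RingHom.comp_apply, twistedMap_single, hd, AddChar.map_zero_eq_one, mul_one, hc _ 0 (hs _),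
      hc0, mul_one, h0]
  · rw [RingHom.comp_apply, twistedMap_single, hd, hc _ q (hs _), one_mul]
    change b _ * (a _ * b _) = _
    rw [mul_comm, mul_assoc, ← map_mul, inv_mul_cancel₀ (hτ0 q), map_one, mul_one]
  · change d (AddMonoidAlgebra.single 0 r) = _
    rw [hd, hc _ 0 ((hs _).trans (map_zero π).symm), hc0, mul_one]

/-- If `P` is the quotient of `M` by `K`, then the fibre of `Spec 𝕜[M] ⟶ Spec 𝕜[K]` over a
`𝕜`-point is isomorphic to `Spec 𝕜[P]`. -/
lemma isPushout_twistedMap {k : K →+ M} {φ : AddChar K 𝕜} {π : M →+ P} {τ : AddChar M 𝕜}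
    (hτ : ∀ x, τ (k x) = φ x) (hτ0 : ∀ q, τ q ≠ 0) (hk : ∀ x, π (k x) = 0)
    (hπ : Function.Surjective π) (hker : ∀ q q', π q = π q' → ∃ x, q' = q + k x) :
    IsPushout (CommRingCat.ofHom (AddMonoidAlgebra.mapDomainRingHom 𝕜 k))
      (CommRingCat.ofHom (AddMonoidAlgebra.lift 𝕜 𝕜 K φ.toMonoidHom).toRingHom)
      (CommRingCat.ofHom (twistedMap π τ))
      (CommRingCat.ofHom (algebraMap 𝕜 (AddMonoidAlgebra 𝕜 P))) := by
  have w := twistedMap_comp_eq hτ hk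
  have hex := fun s : PushoutCocone (CommRingCat.ofHom (AddMonoidAlgebra.mapDomainRingHom 𝕜 k))
      (CommRingCat.ofHom (AddMonoidAlgebra.lift 𝕜 𝕜 K φ.toMonoidHom).toRingHom) ↦
    exists_comp_twistedMap_eq hτ hτ0 hπ hker
      (congrArg CommRingCat.Hom.hom s.condition : s.inl.hom.comp _ = s.inr.hom.comp _)
  refine ⟨⟨by rw [← CommRingCat.ofHom_comp, w, CommRingCat.ofHom_comp]⟩,
    ⟨PushoutCocone.IsColimit.mk _ (fun s ↦ CommRingCat.ofHom (hex s).choose) (fun s ↦ ?_)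
      (fun s ↦ ?_) fun s m hm _ ↦ ?_⟩⟩
  · exact CommRingCat.hom_ext (hex s).choose_spec.1
  · exact CommRingCat.hom_ext (hex s).choose_spec.2
  · refine CommRingCat.hom_ext (RingHom.ext fun a ↦ ?_)
    obtain ⟨a, rfl⟩ := twistedMap_surjective hτ0 hπ a
    exact (RingHom.congr_fun (congrArg CommRingCat.Hom.hom hm) a).trans
      (RingHom.congr_fun (hex s).choose_spec.1 a).symm

end Twisted

namespace MutationDatum

variable {Q P I : Type u} [AddCommGroup Q] [AddCommGroup P]

/-- The morphism `incl : Z ⟶ D.space` is the inclusion of the fibre of a fibration of `D.space` over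
a torus, where the invariant monomials are the kernel of a surjection `hom` onto another lattice.
The charts of the fibre are then isomorphic to those of `D'`, by means of an extension `τ` of the
point of the torus to a character of the whole lattice of monomials. -/
structure FibreDatum (𝕜 : Type u) [Field 𝕜] (D : MutationDatum Q I) (D' : MutationDatum P I)
    {Z : Scheme.{u}} (incl : Z ⟶ D.space 𝕜) where
  K : Type u
  [addCommGroup : AddCommGroup K]
  k : K →+ Q
  u_k : ∀ i x, D.u i (k x) = 0
  φ : AddChar K 𝕜
  str : Z ⟶ Spec (.of 𝕜)
  isPullback : IsPullback str incl (Seed.point φ) (D.fibration 𝕜 k u_k)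
  hom : Hom D D'
  surjective : Function.Surjective hom.toHom
  ker_iff : ∀ q, hom.toHom q = 0 ↔ ∃ x, k x = q
  τ : AddChar Q 𝕜
  τ_k : ∀ x, τ (k x) = φ x
  exists_isBoundaryMonomial : ∀ i, ∃ v, D.IsBoundaryMonomial i v
  twistedMap_wall_ne_zero : ∀ i, twistedMap hom.toHom τ (D.wall 𝕜 i) ≠ 0

namespace FibreDatum

attribute [instance] addCommGroup

variable {𝕜 : Type u} [Field 𝕜] {D : MutationDatum Q I} {D' : MutationDatum P I}
  {Z : Scheme.{u}} {incl : Z ⟶ D.space 𝕜} (T : FibreDatum 𝕜 D D' incl)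

/-- The map `z^q ↦ τ(q) z^(π q)` on functions on the torus. -/
def onTorus : AddMonoidAlgebra 𝕜 Q →+* AddMonoidAlgebra 𝕜 P := twistedMap T.hom.toHom T.τ

/-- The map `z^q ↦ τ(q) z^(π q)` on functions on a chart. -/
def onChart (i : I) :
    AddMonoidAlgebra 𝕜 (D.chartMonoid i) →+* AddMonoidAlgebra 𝕜 (D'.chartMonoid i) :=
  twistedMap (T.hom.onChart i) (T.τ.compAddMonoidHom (D.chartMonoid i).subtype)

lemma isPushout_onTorus :
    IsPushout (CommRingCat.ofHom (AddMonoidAlgebra.mapDomainRingHom 𝕜 T.k))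
      (CommRingCat.ofHom (AddMonoidAlgebra.lift 𝕜 𝕜 T.K T.φ.toMonoidHom).toRingHom)
      (CommRingCat.ofHom T.onTorus) (CommRingCat.ofHom (algebraMap 𝕜 (AddMonoidAlgebra 𝕜 P))) :=
  isPushout_twistedMap T.τ_k (fun q ↦ (T.τ.val_isUnit q).ne_zero)
    (fun x ↦ (T.ker_iff _).mpr ⟨x, rfl⟩) T.surjective fun q q' h ↦ by
      obtain ⟨x, hx⟩ := (T.ker_iff (q' - q)).mp (by rw [map_sub, h, sub_self])
      exact ⟨x, by rw [hx, add_sub_cancel]⟩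

lemma onChart_surjective (i : I) : Function.Surjective (T.hom.onChart i) := by
  rintro ⟨p, hp⟩
  obtain ⟨q, rfl⟩ := T.surjective p
  refine ⟨⟨q, fun hi ↦ ?_⟩, rfl⟩
  rw [← T.hom.u_apply]
  exact hp (by rwa [T.hom.F_eq])

lemma isPushout_onChart (i : I) :
    IsPushout (CommRingCat.ofHom (AddMonoidAlgebra.mapDomainRingHom 𝕜
        (D.invariantOnChart T.k T.u_k i)))
      (CommRingCat.ofHom (AddMonoidAlgebra.lift 𝕜 𝕜 T.K T.φ.toMonoidHom).toRingHom)
      (CommRingCat.ofHom (T.onChart i))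
      (CommRingCat.ofHom (algebraMap 𝕜 (AddMonoidAlgebra 𝕜 (D'.chartMonoid i)))) :=
  isPushout_twistedMap T.τ_k (fun q ↦ (T.τ.val_isUnit q.1).ne_zero)
    (fun x ↦ Subtype.ext ((T.ker_iff _).mpr ⟨x, rfl⟩)) (T.onChart_surjective i) fun q q' h ↦ by
      obtain ⟨x, hx⟩ := (T.ker_iff (q'.1 - q.1)).mp (by
        rw [map_sub, sub_eq_zero]
        exact (congrArg Subtype.val h).symm)
      refine ⟨x, Subtype.ext ?_⟩
      change q'.1 = q.1 + T.k x
      rw [hx, add_sub_cancel]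

lemma isPullback_onTorus : IsPullback
    (Spec.map (CommRingCat.ofHom (algebraMap 𝕜 (AddMonoidAlgebra 𝕜 P))))
    (Spec.map (CommRingCat.ofHom T.onTorus)) (Seed.point T.φ)
    (D.torus 𝕜 ≫ D.fibration 𝕜 T.k T.u_k) := by
  rw [torus_fibration]
  exact (isPullback_SpecMap_of_isPushout _ _ _ _ T.isPushout_onTorus).flip

lemma isPullback_onChart (i : I) : IsPullback
    (Spec.map (CommRingCat.ofHom (algebraMap 𝕜 (AddMonoidAlgebra 𝕜 (D'.chartMonoid i)))))
    (Spec.map (CommRingCat.ofHom (T.onChart i))) (Seed.point T.φ)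
    (D.chart 𝕜 i ≫ D.fibration 𝕜 T.k T.u_k) := by
  rw [chart_fibration]
  exact (isPullback_SpecMap_of_isPushout _ _ _ _ (T.isPushout_onChart i)).flip

/-- The torus in the fibre. -/
def torus : Spec (.of (AddMonoidAlgebra 𝕜 P)) ⟶ Z :=
  T.isPullback.lift (Spec.map (CommRingCat.ofHom (algebraMap 𝕜 (AddMonoidAlgebra 𝕜 P))))
    (Spec.map (CommRingCat.ofHom T.onTorus) ≫ D.torus 𝕜)
    (by rw [T.isPullback_onTorus.w, Category.assoc])

/-- The chart of index `i` in the fibre. -/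
def chart (i : I) : Spec (.of (AddMonoidAlgebra 𝕜 (D'.chartMonoid i))) ⟶ Z :=
  T.isPullback.lift
    (Spec.map (CommRingCat.ofHom (algebraMap 𝕜 (AddMonoidAlgebra 𝕜 (D'.chartMonoid i)))))
    (Spec.map (CommRingCat.ofHom (T.onChart i)) ≫ D.chart 𝕜 i)
    (by rw [(T.isPullback_onChart i).w, Category.assoc])

lemma isPullback_torus :
    IsPullback T.torus (Spec.map (CommRingCat.ofHom T.onTorus)) incl (D.torus 𝕜) :=
  T.isPullback_onTorus.of_right' T.isPullback

lemma isPullback_chart (i : I) :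
    IsPullback (T.chart i) (Spec.map (CommRingCat.ofHom (T.onChart i))) incl (D.chart 𝕜 i) :=
  (T.isPullback_onChart i).of_right' T.isPullback

instance : IsOpenImmersion T.torus :=
  MorphismProperty.of_isPullback T.isPullback_torus.flip inferInstance

instance (i : I) : IsOpenImmersion (T.chart i) :=
  MorphismProperty.of_isPullback (T.isPullback_chart i).flip inferInstance

lemma torus_incl : T.torus ≫ incl = Spec.map (CommRingCat.ofHom T.onTorus) ≫ D.torus 𝕜 :=
  T.isPullback_torus.w

lemma chart_incl (i : I) :
    T.chart i ≫ incl = Spec.map (CommRingCat.ofHom (T.onChart i)) ≫ D.chart 𝕜 i :=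
  (T.isPullback_chart i).w

lemma torus_str : T.torus ≫ T.str =
    Spec.map (CommRingCat.ofHom (algebraMap 𝕜 (AddMonoidAlgebra 𝕜 P))) :=
  T.isPullback.lift_fst _ _ _

lemma image_torus : T.torus ''ᵁ ⊤ = incl ⁻¹ᵁ D.torusOpen 𝕜 :=
  IsOpenImmersion.image_preimage_eq_preimage_image_of_isPullback T.isPullback_torus.flip ⊤

lemma image_chart (i : I) : T.chart i ''ᵁ ⊤ = incl ⁻¹ᵁ D.chartOpen 𝕜 i :=
  IsOpenImmersion.image_preimage_eq_preimage_image_of_isPullback (T.isPullback_chart i).flip ⊤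

lemma mem_torus_or_mem_chart (z : Z) : z ∈ T.torus ''ᵁ ⊤ ∨ ∃ i, z ∈ T.chart i ''ᵁ ⊤ := by
  obtain h | ⟨i, h⟩ := D.mem_torusOpen_or_mem_chartOpen 𝕜 (incl z)
  · exact .inl (T.image_torus.ge h)
  · exact .inr ⟨i, (T.image_chart i).ge h⟩

lemma mem_torus_of_mem_chart {i i' : I} (hi : i ≠ i') {z : Z} (h : z ∈ T.chart i ''ᵁ ⊤)
    (h' : z ∈ T.chart i' ''ᵁ ⊤) : z ∈ T.torus ''ᵁ ⊤ :=
  T.image_torus.ge (D.mem_torusOpen_of_mem_chartOpen 𝕜 hi ((T.image_chart i).le h)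
    ((T.image_chart i').le h'))

end FibreDatum

end MutationDatum

namespace MutationDatum

variable {Q P I : Type u} [AddCommGroup Q] [AddCommGroup P]

namespace FibreDatum

variable {𝕜 : Type u} [Field 𝕜] {D : MutationDatum Q I} {D' : MutationDatum P I}
  {Z : Scheme.{u}} {incl : Z ⟶ D.space 𝕜} (T : FibreDatum 𝕜 D D' incl)

/-! ### Integrality of the fibres -/

section Integral

variable [IsDomain (AddMonoidAlgebra 𝕜 P)]

instance (i : I) : IsDomain (AddMonoidAlgebra 𝕜 (D'.chartMonoid i)) :=
  (D'.chartIncl_injective 𝕜 i).isDomain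

/-- The torus meets every chart, since `1 + z^ψ` does not vanish identically on it. -/
lemma exists_mem_torus_mem_chart (i : I) : ∃ z, z ∈ T.torus ''ᵁ ⊤ ∧ z ∈ T.chart i ''ᵁ ⊤ := by
  let x : Spec (.of (AddMonoidAlgebra 𝕜 P)) := (⊥ : PrimeSpectrum _)
  refine ⟨T.torus x, ⟨x, trivial, rfl⟩, (T.image_chart i).ge ?_⟩
  change (T.torus ≫ incl) x ∈ D.chartOpen 𝕜 i
  rw [torus_incl]
  exact (D.mem_chartOpen_iff 𝕜 _).mpr (T.twistedMap_wall_ne_zero i)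

lemma closure_torus : closure ((T.torus ''ᵁ ⊤ : Z.Opens) : Set Z) = Set.univ := by
  refine Set.eq_univ_of_forall fun z ↦ ?_
  obtain hz | ⟨i, w, -, rfl⟩ := T.mem_torus_or_mem_chart z
  · exact subset_closure hz
  refine mem_closure_iff.mpr fun U hU hw ↦ ?_
  obtain ⟨_, hz, w', -, rfl⟩ := T.exists_mem_torus_mem_chart i
  have h1 := PreirreducibleSpace.isPreirreducible_univ (X := Spec (.of (AddMonoidAlgebra 𝕜
    (D'.chartMonoid i)))) _ _ (hU.preimage (T.chart i).continuous)
    ((T.torus ''ᵁ ⊤).2.preimage (T.chart i).continuous) ⟨w, trivial, hw⟩ ⟨w', trivial, hz⟩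
  obtain ⟨y, -, hy⟩ := h1
  exact ⟨_, hy⟩

/-- The fibre is irreducible as the closure of its torus, and reduced since its charts are. -/
lemma isIntegral (T : FibreDatum 𝕜 D D' incl) : IsIntegral Z := by
  have : IrreducibleSpace Z := by
    have h1 : IsIrreducible ((T.torus ''ᵁ ⊤ : Z.Opens) : Set Z) := by
      have h2 := (IrreducibleSpace.isIrreducible_univ
        (Spec (.of (AddMonoidAlgebra 𝕜 P)))).image T.torus T.torus.continuous.continuousOn
      exact h2
    have h2 := h1.closure
    rw [closure_torus] at h2
    exact (irreducibleSpace_def _).mpr h2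
  have : IsReduced Z := by
    have (x : Z) : _root_.IsReduced (Z.presheaf.stalk x) := by
      obtain ⟨w, -, rfl⟩ | ⟨i, w, -, rfl⟩ := T.mem_torus_or_mem_chart x
      · exact isReduced_of_injective (T.torus.stalkMap w).hom
          (ConcreteCategory.bijective_of_isIso (T.torus.stalkMap w)).1
      · exact isReduced_of_injective ((T.chart i).stalkMap w).hom
          (ConcreteCategory.bijective_of_isIso ((T.chart i).stalkMap w)).1
    exact isReduced_of_isReduced_stalk Z
  exact isIntegral_of_irreducibleSpace_of_isReduced Z

end Integral

/-! ### Rational functions on the fibres -/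

section Rational

variable [IsIntegral Z]

lemma ratMap_torus (h : incl (genericPoint Z) ∈ D.torus 𝕜 ''ᵁ ⊤) :
    ratMap incl (D.torus 𝕜) h = (chartRat T.torus).comp T.onTorus := by
  refine ratMap_eq_of_comp_eq _ _ ?_
  rw [CommRingCat.ofHom_comp, Spec.map_comp, Category.assoc, ← torus_incl, ← Category.assoc]
  exact congrArg (· ≫ incl) (SpecMap_chartRat T.torus)

lemma ratMap_chart (i : I) (h : incl (genericPoint Z) ∈ D.chart 𝕜 i ''ᵁ ⊤) :
    ratMap incl (D.chart 𝕜 i) h = (chartRat (T.chart i)).comp (T.onChart i) := by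
  refine ratMap_eq_of_comp_eq _ _ ?_
  rw [CommRingCat.ofHom_comp, Spec.map_comp, Category.assoc, ← chart_incl, ← Category.assoc]
  exact congrArg (· ≫ incl) (SpecMap_chartRat (T.chart i))

lemma genericPoint_mem_torusOpen (T : FibreDatum 𝕜 D D' incl) :
    incl (genericPoint Z) ∈ D.torus 𝕜 ''ᵁ ⊤ :=
  T.image_torus.le (genericPoint_mem_image T.torus)

lemma genericPoint_mem_chartOpen (T : FibreDatum 𝕜 D D' incl) (i : I) :
    incl (genericPoint Z) ∈ D.chart 𝕜 i ''ᵁ ⊤ :=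
  (T.image_chart i).le (genericPoint_mem_image (T.chart i))

lemma ratFun_torusFun (a : AddMonoidAlgebra 𝕜 Q) :
    ratFun (incl.app _ (D.torusFun 𝕜 a)) = chartRat T.torus (T.onTorus a) :=
  (ratMap_apply incl (D.torus 𝕜) T.genericPoint_mem_torusOpen a).symm.trans
    (RingHom.congr_fun (T.ratMap_torus _) a)

lemma ratFun_chartFun (i : I) (a : AddMonoidAlgebra 𝕜 (D.chartMonoid i)) :
    ratFun (incl.app _ (D.chartFun 𝕜 i a)) = chartRat (T.chart i) (T.onChart i a) :=
  (ratMap_apply incl (D.chart 𝕜 i) (T.genericPoint_mem_chartOpen i) a).symm.trans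
    (RingHom.congr_fun (T.ratMap_chart i _) a)

/-- The function `1 + τ(ψ) z^(π ψ)`, or `1` for frozen `i`, as a rational function. -/
def wallRat (i : I) : Z.functionField := chartRat T.torus (T.onTorus (D.wall 𝕜 i))

variable [IsDomain (AddMonoidAlgebra 𝕜 P)]

lemma wallRat_ne_zero (i : I) : T.wallRat i ≠ 0 := fun h ↦
  T.twistedMap_wall_ne_zero i (chartRat_injective T.torus (h.trans (map_zero _).symm))

lemma mutationMap_single_eq (i : I) (q : D.chartMonoid i) (c : 𝕜) :
    D.mutationMap 𝕜 i (AddMonoidAlgebra.single q c) =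
      algebraMap (AddMonoidAlgebra 𝕜 Q) _ (AddMonoidAlgebra.single q.1 c) *
        ((D.wallUnit 𝕜 i ^ (-D.u i q.1) : (D.OverlapRing 𝕜 i)ˣ) : D.OverlapRing 𝕜 i) := by
  have h1 : AddMonoidAlgebra.single q c = c • AddMonoidAlgebra.single q (1 : 𝕜) := by
    rw [AddMonoidAlgebra.smul_single, smul_eq_mul, mul_one]
  have h2 : AddMonoidAlgebra.single q.1 c = c • AddMonoidAlgebra.single q.1 (1 : 𝕜) := by
    rw [AddMonoidAlgebra.smul_single, smul_eq_mul, mul_one]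
  rw [h1, h2, map_smul, mutationMap_single, Algebra.smul_def c (AddMonoidAlgebra.single q.1 _),
    map_mul, ← IsScalarTower.algebraMap_apply, Algebra.smul_def, mul_assoc]

/-- The functions on the overlap of the torus with a chart as rational functions on the fibre,
compatibly with both coordinate systems. -/
lemma exists_overlapRat (i : I) : ∃ r : D.OverlapRing 𝕜 i →+* Z.functionField,
    (∀ a, r (algebraMap _ _ a) = chartRat T.torus (T.onTorus a)) ∧
      ∀ a, r (D.mutationMap 𝕜 i a) = chartRat (T.chart i) (T.onChart i a) := by
  let r : D.OverlapRing 𝕜 i →+* Z.functionField := IsLocalization.Away.lift (D.wall 𝕜 i)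
    (g := (chartRat T.torus).comp T.onTorus) (T.wallRat_ne_zero i).isUnit
  have hr : ∀ a, r (algebraMap _ _ a) = chartRat T.torus (T.onTorus a) := fun a ↦
    IsLocalization.Away.lift_eq _ _ a
  refine ⟨r, hr, fun a ↦ ?_⟩
  have h1 : ratMap incl (D.chart 𝕜 i) (T.genericPoint_mem_chartOpen i) =
      r.comp (D.mutationMap 𝕜 i).toRingHom := by
    refine ratMap_eq_of_comp_eq _ _ ?_
    rw [CommRingCat.ofHom_comp, Spec.map_comp, Category.assoc, ← overlap_torus, ← Category.assoc,
      ← Spec.map_comp, ← CommRingCat.ofHom_comp, ← SpecMap_ratMap incl (D.torus 𝕜)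
        T.genericPoint_mem_torusOpen, T.ratMap_torus]
    congr 3
    exact RingHom.ext hr
  rw [T.ratMap_chart] at h1
  exact (RingHom.congr_fun h1 a).symm

/-- The monomials on a chart in terms of the monomials on the torus. -/
lemma chartRat_chart_single (i : I) (p : D'.chartMonoid i) (c : 𝕜) :
    chartRat (T.chart i) (AddMonoidAlgebra.single p c) =
      chartRat T.torus (AddMonoidAlgebra.single p.1 c) * T.wallRat i ^ (-D'.u i p.1) := by
  obtain ⟨r, hr, hr'⟩ := T.exists_overlapRat i
  obtain ⟨q, rfl⟩ := T.onChart_surjective i p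
  have hq : T.τ q.1 ≠ 0 := (T.τ.val_isUnit q.1).ne_zero
  have h1 := hr' (AddMonoidAlgebra.single q (c / T.τ q.1))
  have h2 : c / T.τ q.1 * (T.τ.compAddMonoidHom (D.chartMonoid i).subtype) q = c :=
    div_mul_cancel₀ _ hq
  rw [onChart, twistedMap_single, h2, mutationMap_single_eq, map_mul, hr, onTorus,
    twistedMap_single, div_mul_cancel₀ _ hq] at h1
  rw [← h1]
  congr 1
  have h3 : Units.map r.toMonoidHom (D.wallUnit 𝕜 i) = Units.mk0 _ (T.wallRat_ne_zero i) :=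
    Units.ext (hr _)
  have h4 : D'.u i (T.hom.onChart i q).1 = D.u i q.1 := T.hom.u_apply i q.1
  rw [h4]
  change ((Units.map r.toMonoidHom (D.wallUnit 𝕜 i ^ _) : Z.functionFieldˣ) : Z.functionField) = _
  rw [map_zpow, h3, Units.val_zpow_eq_zpow_val, Units.val_mk0]

lemma chartRat_chart_chartWall (i : I) :
    chartRat (T.chart i) (T.onChart i (D.chartWall 𝕜 i)) = T.wallRat i := by
  obtain ⟨r, hr, hr'⟩ := T.exists_overlapRat i
  rw [← hr', mutationMap_chartWall, hr]
  rfl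

end Rational

end FibreDatum

end MutationDatum

/-! ### Morphisms between fibres -/

lemma ratPull_chartRat {X Y : Scheme.{u}} [IsIntegral X] [IsIntegral Y] {A B : CommRingCat.{u}}
    [Nontrivial A] [Nontrivial B] {p : Y ⟶ X} (hp : p (genericPoint Y) = genericPoint X)
    {f : Spec A ⟶ X} [IsOpenImmersion f] {g : Spec B ⟶ Y} [IsOpenImmersion g] {r : A →+* B}
    (h : g ≫ p = Spec.map (CommRingCat.ofHom r) ≫ f) (a : A) :
    ratPull p hp (chartRat f a) = chartRat g (r a) := by
  have h1 : Spec.map (CommRingCat.ofHom ((ratPull p hp).comp (chartRat f))) ≫ f =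
      Spec.map (CommRingCat.ofHom ((chartRat g).comp r)) ≫ f := by
    rw [CommRingCat.ofHom_comp, CommRingCat.ofHom_comp, Spec.map_comp, Spec.map_comp,
      Category.assoc, Category.assoc, SpecMap_chartRat, ← h, SpecMap_ratPull, ← Category.assoc,
      SpecMap_chartRat]
  rw [cancel_mono] at h1
  exact RingHom.congr_fun (congrArg CommRingCat.Hom.hom (Spec.map_injective h1)) a

lemma genericPoint_eq_of_dominant_charts {X Y : Scheme.{u}} [IsIntegral X] [IsIntegral Y]
    {A B : CommRingCat.{u}} [IsDomain A] [IsDomain B] {p : Y ⟶ X}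
    {f : Spec A ⟶ X} [IsOpenImmersion f] {g : Spec B ⟶ Y} [IsOpenImmersion g] {r : A →+* B}
    (hr : Function.Injective r) (h : g ≫ p = Spec.map (CommRingCat.ofHom r) ≫ f) :
    p (genericPoint Y) = genericPoint X := by
  rw [← genericPoint_eq_of_isOpenImmersion g, ← genericPoint_eq_of_isOpenImmersion f]
  change (g ≫ p) _ = _
  rw [h]
  change f (Spec.map _ _) = _
  congr 1
  rw [genericPoint_eq_bot_of_affine, genericPoint_eq_bot_of_affine]
  refine PrimeSpectrum.ext ?_
  exact (RingHom.injective_iff_ker_eq_bot r).mp hr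

namespace MutationDatum

namespace FibreDatum

variable {𝕜 Q P Q₂ P₂ I : Type u} [Field 𝕜] [AddCommGroup Q] [AddCommGroup P]
  [AddCommGroup Q₂] [AddCommGroup P₂] {D : MutationDatum Q I} {D' : MutationDatum P I}
  {E : MutationDatum Q₂ I} {E' : MutationDatum P₂ I} {X Y : Scheme.{u}}
  {inclX : X ⟶ D.space 𝕜} {inclY : Y ⟶ E.space 𝕜}

/-- The morphism `p` of fibres is induced by the homomorphism `H` of mutation data, and is given by
the homomorphism `j` on the lattices of monomials on the fibres. -/
structure IsMap (T : FibreDatum 𝕜 D D' inclX) (T₂ : FibreDatum 𝕜 E E' inclY) (H : Hom D E)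
    (j : Hom D' E') (p : Y ⟶ X) : Prop where
  comp_incl : p ≫ inclX = inclY ≫ H.spaceMap 𝕜
  comp_str : p ≫ T.str = T₂.str
  hom_comp : ∀ q, T₂.hom.toHom (H.toHom q) = j.toHom (T.hom.toHom q)
  τ_comp : ∀ q, T₂.τ (H.toHom q) = T.τ q

variable {T : FibreDatum 𝕜 D D' inclX} {T₂ : FibreDatum 𝕜 E E' inclY} {H : Hom D E}
  {j : Hom D' E'} {p : Y ⟶ X}

lemma algebraMap_comp {M N : Type u} [AddCommMonoid M] [AddCommMonoid N] (f : M →+ N) :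
    (AddMonoidAlgebra.mapDomainRingHom 𝕜 f).comp (algebraMap 𝕜 (AddMonoidAlgebra 𝕜 M)) =
      algebraMap 𝕜 (AddMonoidAlgebra 𝕜 N) := by
  refine RingHom.ext fun r ↦ ?_
  change AddMonoidAlgebra.mapDomainRingHom 𝕜 f (AddMonoidAlgebra.single 0 r) =
    AddMonoidAlgebra.single 0 r
  rw [AddMonoidAlgebra.mapDomainRingHom_apply, AddMonoidAlgebra.mapDomain_single, map_zero]

namespace IsMap

lemma onTorus_comp (h : IsMap T T₂ H j p) :
    T₂.onTorus.comp (AddMonoidAlgebra.mapDomainRingHom 𝕜 H.toHom) =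
      (AddMonoidAlgebra.mapDomainRingHom 𝕜 j.toHom).comp T.onTorus := by
  refine RingHom.ext fun a ↦ ?_
  induction a using AddMonoidAlgebra.induction_linear with
  | zero => rw [map_zero, map_zero]
  | add a b ha hb => rw [map_add, map_add, ha, hb]
  | single q c =>
    simp only [RingHom.comp_apply, AddMonoidAlgebra.mapDomainRingHom_apply, onTorus,
      AddMonoidAlgebra.mapDomain_single, twistedMap_single, h.hom_comp, h.τ_comp]

lemma torus_comp (h : IsMap T T₂ H j p) : T₂.torus ≫ p =
    Spec.map (CommRingCat.ofHom (AddMonoidAlgebra.mapDomainRingHom 𝕜 j.toHom)) ≫ T.torus := by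
  refine T.isPullback.hom_ext ?_ ?_
  · rw [Category.assoc, h.comp_str, torus_str, Category.assoc, torus_str, ← Spec.map_comp,
      ← CommRingCat.ofHom_comp, algebraMap_comp]
  · rw [Category.assoc, h.comp_incl, ← Category.assoc, torus_incl, Category.assoc,
      Hom.torus_spaceMap, Category.assoc, torus_incl, ← Category.assoc, ← Category.assoc,
      ← Spec.map_comp, ← Spec.map_comp, ← CommRingCat.ofHom_comp, ← CommRingCat.ofHom_comp,
      h.onTorus_comp]

lemma preimage_torus (h : IsMap T T₂ H j p) :
    p ⁻¹ᵁ T.torus ''ᵁ ⊤ = T₂.torus ''ᵁ ⊤ := by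
  rw [image_torus, image_torus, ← Scheme.Hom.comp_preimage, h.comp_incl, Scheme.Hom.comp_preimage,
    H.preimage_torusOpen 𝕜 T.exists_isBoundaryMonomial]

lemma preimage_chart (h : IsMap T T₂ H j p) (i : I) :
    p ⁻¹ᵁ T.chart i ''ᵁ ⊤ = T₂.chart i ''ᵁ ⊤ := by
  rw [image_chart, image_chart, ← Scheme.Hom.comp_preimage, h.comp_incl, Scheme.Hom.comp_preimage,
    H.preimage_chartOpen 𝕜 T.exists_isBoundaryMonomial]

/-- The preimages of the torus and of the charts are the torus and the charts, which are affine. -/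
lemma isAffineHom (h : IsMap T T₂ H j p) : IsAffineHom p := by
  refine isAffineHom_of_forall_exists_isAffineOpen _ fun x ↦ ?_
  obtain hx | ⟨i, hx⟩ := T.mem_torus_or_mem_chart x
  · exact ⟨_, hx, (isAffineOpen_top _).image_of_isOpenImmersion _,
      h.preimage_torus ▸ (isAffineOpen_top _).image_of_isOpenImmersion _⟩
  · exact ⟨_, hx, (isAffineOpen_top _).image_of_isOpenImmersion _,
      h.preimage_chart i ▸ (isAffineOpen_top _).image_of_isOpenImmersion _⟩

variable [IsIntegral X] [IsIntegral Y]

lemma genericPoint_eq (h : IsMap T T₂ H j p) [IsDomain (AddMonoidAlgebra 𝕜 P)]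
    [IsDomain (AddMonoidAlgebra 𝕜 P₂)]
    (hj : Function.Injective j.toHom) : p (genericPoint Y) = genericPoint X :=
  genericPoint_eq_of_dominant_charts (f := T.torus) (g := T₂.torus)
    (r := AddMonoidAlgebra.mapDomainRingHom 𝕜 j.toHom)
    (AddMonoidAlgebra.mapDomain_injective hj) h.torus_comp

lemma ratPull_chartRat_torus (h : IsMap T T₂ H j p) (hp : p (genericPoint Y) = genericPoint X)
    (a : AddMonoidAlgebra 𝕜 P) : ratPull p hp (chartRat T.torus a) =
      chartRat T₂.torus (AddMonoidAlgebra.mapDomainRingHom 𝕜 j.toHom a) :=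
  ratPull_chartRat (f := T.torus) (g := T₂.torus) hp h.torus_comp a

lemma ratPull_wallRat (h : IsMap T T₂ H j p) (hp : p (genericPoint Y) = genericPoint X) (i : I) :
    ratPull p hp (T.wallRat i) = T₂.wallRat i := by
  rw [wallRat, h.ratPull_chartRat_torus, wallRat, ← H.map_wall 𝕜 i]
  exact congrArg _ (RingHom.congr_fun h.onTorus_comp _).symm

end IsMap

end FibreDatum

end MutationDatum

/-! ### Monomials as rational functions -/

section UnitsAt

variable {X : Scheme.{u}} [IsIntegral X]

/-- The rational functions which are regular and do not vanish at `x`. -/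
def unitsAt (x : X) : Subgroup (X.functionField)ˣ :=
  (Units.map (algebraMap (X.presheaf.stalk x) X.functionField).toMonoidHom).range

lemma mem_unitsAt_iff {x : X} {g : (X.functionField)ˣ} :
    g ∈ unitsAt x ↔ (g : X.functionField) ∈ regularAt x ∧
      ((g⁻¹ : (X.functionField)ˣ) : X.functionField) ∈ regularAt x := by
  constructor
  · rintro ⟨v, rfl⟩
    exact ⟨⟨v, rfl⟩, ⟨((v⁻¹ : (X.presheaf.stalk x)ˣ) : X.presheaf.stalk x), rfl⟩⟩
  · rintro ⟨⟨a, ha⟩, ⟨b, hb⟩⟩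
    have hab : a * b = 1 := by
      refine FaithfulSMul.algebraMap_injective (X.presheaf.stalk x) X.functionField ?_
      rw [map_mul, map_one, ha, hb, Units.mul_inv]
    exact ⟨⟨a, b, hab, by rw [mul_comm, hab]⟩, Units.ext ha⟩

lemma mem_unitsAt_of_pow_mem {x : X} {g : (X.functionField)ˣ}
    (hg : (g : X.functionField) ∈ regularAt x) {n : ℕ} (hn : n ≠ 0) (h : g ^ n ∈ unitsAt x) :
    g ∈ unitsAt x := by
  obtain ⟨n, rfl⟩ := Nat.exists_eq_succ_of_ne_zero hn
  refine mem_unitsAt_iff.mpr ⟨hg, ?_⟩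
  have h1 := (regularAt x).mul_mem (mem_unitsAt_iff.mp h).2 ((regularAt x).pow_mem hg n)
  rwa [← Units.val_pow_eq_pow_val, ← Units.val_mul, Nat.succ_eq_add_one, pow_succ, mul_inv_rev,
    inv_mul_cancel_right] at h1

end UnitsAt

namespace MutationDatum

namespace FibreDatum

variable {𝕜 Q P I : Type u} [Field 𝕜] [AddCommGroup Q] [AddCommGroup P]
  {D : MutationDatum Q I} {D' : MutationDatum P I}
  {Z : Scheme.{u}} {incl : Z ⟶ D.space 𝕜} (T : FibreDatum 𝕜 D D' incl)
  [IsIntegral Z]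

/-- The constants as rational functions. -/
def const : 𝕜 →+* Z.functionField := (chartRat T.torus).comp AddMonoidAlgebra.singleZeroRingHom

/-- The monomials as invertible rational functions. -/
def monomial : P →+ Additive (Z.functionField)ˣ :=
  AddMonoidHom.mk' (fun p ↦ Additive.ofMul
    { val := chartRat T.torus (AddMonoidAlgebra.single p 1)
      inv := chartRat T.torus (AddMonoidAlgebra.single (-p) 1)
      val_inv := by
        rw [← map_mul, AddMonoidAlgebra.single_mul_single, add_neg_cancel, mul_one,
          ← AddMonoidAlgebra.one_def, map_one]
      inv_val := by
        rw [← map_mul, AddMonoidAlgebra.single_mul_single, neg_add_cancel, mul_one,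
          ← AddMonoidAlgebra.one_def, map_one] }) fun p p' ↦ by
    refine Additive.toMul.injective (Units.ext ?_)
    change chartRat _ _ = chartRat _ _ * chartRat _ _
    rw [← map_mul, AddMonoidAlgebra.single_mul_single, mul_one]

lemma coe_monomial (p : P) : ((T.monomial p).toMul : Z.functionField) =
    chartRat T.torus (AddMonoidAlgebra.single p 1) := rfl

lemma chartRat_torus_single (p : P) (c : 𝕜) :
    chartRat T.torus (AddMonoidAlgebra.single p c) =
      T.const c * ((T.monomial p).toMul : Z.functionField) := by
  rw [coe_monomial]
  change _ = chartRat T.torus (AddMonoidAlgebra.single 0 c) * _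
  rw [← map_mul, AddMonoidAlgebra.single_mul_single, zero_add, mul_one]

lemma monomial_mem_unitsAt {z : Z} (hz : z ∈ T.torus ''ᵁ ⊤) (p : P) :
    (T.monomial p).toMul ∈ unitsAt z :=
  mem_unitsAt_iff.mpr ⟨chartRat_mem_regularAt T.torus _ hz, chartRat_mem_regularAt T.torus _ hz⟩

lemma wallRat_mem_regularAt_of_mem_torus {z : Z} (hz : z ∈ T.torus ''ᵁ ⊤) (i : I) :
    T.wallRat i ∈ regularAt z :=
  chartRat_mem_regularAt T.torus _ hz

variable [IsDomain (AddMonoidAlgebra 𝕜 P)]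

/-- The function `1 + τ(ψ) z^(π ψ)`, or `1` for frozen `i`, as an invertible rational function. -/
def wallRatUnit (i : I) : (Z.functionField)ˣ := Units.mk0 _ (T.wallRat_ne_zero i)

lemma wallRatUnit_of_mem {i : I} (hi : i ∈ D.F) : T.wallRatUnit i = 1 := by
  refine Units.ext ?_
  change chartRat T.torus (T.onTorus (D.wall 𝕜 i)) = 1
  rw [wall, if_pos hi, map_one, map_one]

/-- The monomial `z^p` in the coordinates of the chart `i`. -/
def chartMonomial (i : I) (p : P) : (Z.functionField)ˣ :=
  (T.monomial p).toMul * T.wallRatUnit i ^ (-D'.u i p)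

lemma chartRat_chart_eq (i : I) (p : D'.chartMonoid i) (c : 𝕜) :
    chartRat (T.chart i) (AddMonoidAlgebra.single p c) =
      T.const c * (T.chartMonomial i p.1 : Z.functionField) := by
  rw [chartRat_chart_single, chartRat_torus_single, chartMonomial, Units.val_mul,
    Units.val_zpow_eq_zpow_val, mul_assoc]
  rfl

lemma const_mem_regularAt (c : 𝕜) (z : Z) : T.const c ∈ regularAt z := by
  obtain hz | ⟨i, hz⟩ := T.mem_torus_or_mem_chart z
  · exact chartRat_mem_regularAt T.torus _ hz
  · have h1 := chartRat_mem_regularAt (T.chart i) (AddMonoidAlgebra.single 0 c) hz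
    rwa [chartRat_chart_eq, chartMonomial, ZeroMemClass.coe_zero, map_zero T.monomial,
      map_zero (D'.u i), neg_zero, zpow_zero, toMul_zero, mul_one, Units.val_one, mul_one] at h1

lemma map_const_mem_unitsAt (c : 𝕜ˣ) (z : Z) : Units.map T.const.toMonoidHom c ∈ unitsAt z := by
  refine mem_unitsAt_iff.mpr ⟨T.const_mem_regularAt _ _, ?_⟩
  rw [← map_inv]
  exact T.const_mem_regularAt _ _

lemma chartMonomial_mem_regularAt {i : I} {z : Z} (hz : z ∈ T.chart i ''ᵁ ⊤) {p : P}
    (hp : p ∈ D'.chartMonoid i) : (T.chartMonomial i p : Z.functionField) ∈ regularAt z := by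
  have h1 := chartRat_mem_regularAt (T.chart i) (AddMonoidAlgebra.single ⟨p, hp⟩ 1) hz
  rwa [chartRat_chart_eq, map_one, one_mul] at h1

lemma chartMonomial_neg (i : I) (p : P) : T.chartMonomial i (-p) = (T.chartMonomial i p)⁻¹ := by
  rw [chartMonomial, chartMonomial, map_neg T.monomial, map_neg (D'.u i), toMul_neg, mul_inv,
    ← zpow_neg]

lemma chartMonomial_mem_unitsAt {i : I} {z : Z} (hz : z ∈ T.chart i ''ᵁ ⊤) {p : P}
    (hp : i ∈ D'.F → D'.u i p = 0) : T.chartMonomial i p ∈ unitsAt z := by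
  refine mem_unitsAt_iff.mpr ⟨T.chartMonomial_mem_regularAt hz fun hi ↦ (hp hi).ge, ?_⟩
  rw [← chartMonomial_neg]
  exact T.chartMonomial_mem_regularAt hz fun hi ↦ by rw [map_neg, hp hi, neg_zero]

lemma chartMonomial_of_mem {i : I} (hi : i ∈ D.F) (p : P) :
    T.chartMonomial i p = (T.monomial p).toMul := by
  rw [chartMonomial, T.wallRatUnit_of_mem hi, one_zpow, mul_one]

/-- The function `1 + τ(ψ) z^(π ψ)` does not vanish on the intersection of the torus with the
chart, since both coordinate systems consist of units there. -/
lemma wallRatUnit_mem_unitsAt {i : I} (hi : i ∉ D.F) (hu : ∃ p, D'.u i p ≠ 0) {z : Z}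
    (hz : z ∈ T.torus ''ᵁ ⊤) (hz' : z ∈ T.chart i ''ᵁ ⊤) : T.wallRatUnit i ∈ unitsAt z := by
  obtain ⟨p, hp⟩ := hu
  have hi' : i ∉ D'.F := by rwa [T.hom.F_eq]
  have h1 := (unitsAt z).mul_mem (inv_mem (T.monomial_mem_unitsAt hz p))
    (T.chartMonomial_mem_unitsAt hz' (p := p) fun h ↦ (hi' h).elim)
  rw [chartMonomial, inv_mul_cancel_left] at h1
  refine mem_unitsAt_of_pow_mem (T.wallRat_mem_regularAt_of_mem_torus hz i)
    (Int.natAbs_ne_zero.mpr hp) ?_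
  obtain h2 | h2 := Int.natAbs_eq (D'.u i p)
  · rw [h2, zpow_neg, zpow_natCast] at h1
    exact inv_mem_iff.mp h1
  · rwa [h2, neg_neg, zpow_natCast] at h1

end FibreDatum

end MutationDatum

namespace MutationDatum

namespace FibreDatum

namespace IsMap

variable {𝕜 Q P Q₂ P₂ I : Type u} [Field 𝕜] [AddCommGroup Q] [AddCommGroup P]
  [AddCommGroup Q₂] [AddCommGroup P₂] {D : MutationDatum Q I} {D' : MutationDatum P I}
  {E : MutationDatum Q₂ I} {E' : MutationDatum P₂ I} {X Y : Scheme.{u}}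
  {inclX : X ⟶ D.space 𝕜} {inclY : Y ⟶ E.space 𝕜} [IsIntegral X] [IsIntegral Y]
  {T : FibreDatum 𝕜 D D' inclX} {T₂ : FibreDatum 𝕜 E E' inclY} {H : Hom D E}
  {j : Hom D' E'} {p : Y ⟶ X}

lemma ratPull_const (h : IsMap T T₂ H j p) (hp : p (genericPoint Y) = genericPoint X) (c : 𝕜) :
    ratPull p hp (T.const c) = T₂.const c := by
  refine (h.ratPull_chartRat_torus hp (AddMonoidAlgebra.single 0 c)).trans ?_
  rw [AddMonoidAlgebra.mapDomainRingHom_apply, AddMonoidAlgebra.mapDomain_single, map_zero]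
  rfl

lemma map_ratPull_monomial (h : IsMap T T₂ H j p) (hp : p (genericPoint Y) = genericPoint X)
    (q : P) : Units.map (ratPull p hp).toMonoidHom (T.monomial q).toMul =
      (T₂.monomial (j.toHom q)).toMul := by
  refine Units.ext ((h.ratPull_chartRat_torus hp (AddMonoidAlgebra.single q 1)).trans ?_)
  rw [AddMonoidAlgebra.mapDomainRingHom_apply, AddMonoidAlgebra.mapDomain_single]
  rfl

lemma map_ratPull_wallRatUnit (h : IsMap T T₂ H j p) [IsDomain (AddMonoidAlgebra 𝕜 P)]
    [IsDomain (AddMonoidAlgebra 𝕜 P₂)] (hp : p (genericPoint Y) = genericPoint X) (i : I) :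
    Units.map (ratPull p hp).toMonoidHom (T.wallRatUnit i) = T₂.wallRatUnit i :=
  Units.ext (h.ratPull_wallRat hp i)

end IsMap

end FibreDatum

end MutationDatum

/-! ### The fibres attached to a seed -/

/-- A primitive element of the dual lattice takes the value `1`. -/
lemma exists_eq_one_of_primitive {N : Type u} [AddCommGroup N] {f : Module.Dual ℤ N}
    (h : ∀ (c : ℤ) (m : Module.Dual ℤ N), f = c • m → IsUnit c) : ∃ n, f n = 1 := by
  let g : ℤ := Submodule.IsPrincipal.generator (LinearMap.range f)
  have hdvd : ∀ n, g ∣ f n := fun n ↦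
    (Submodule.IsPrincipal.mem_iff_generator_dvd _).mp ⟨n, rfl⟩
  obtain ⟨n, hn⟩ : g ∈ LinearMap.range f := Submodule.IsPrincipal.generator_mem _
  have hg : IsUnit g := by
    refine h g (AddMonoidHom.mk' (fun n ↦ f n / g) fun a b ↦ ?_).toIntLinearMap
      (LinearMap.ext fun n ↦ ?_)
    · rw [map_add, Int.add_ediv_of_dvd_left (hdvd a)]
    · exact (Int.mul_ediv_cancel' (hdvd n)).symm
  obtain hg | hg := Int.isUnit_iff.mp hg
  · exact ⟨n, hn.trans hg⟩
  · exact ⟨-n, by rw [map_neg, hn, hg, neg_neg]⟩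

namespace Seed

variable {𝕜 N I : Type u} [Field 𝕜] [AddCommGroup N] (S : Seed N I)

/-- The data for the charts of `𝒜^⋆_t`: the lattice of monomials is `M_I`. -/
def latticeDatum : MutationDatum (Module.Dual ℤ S.NI) I where
  u i := (Module.Dual.eval ℤ S.NI (S.eI i)).toAddMonoidHom
  ψ i := S.pbar₁ (S.e i)
  F := S.F
  u_ψ i hi := S.bracket_self i hi

/-- The data for the charts of `𝒳^⋆_φ`: the lattice of monomials is `p̄₁(N)`. -/
def sublatticeDatum : MutationDatum S.Λ₀ I where
  u i := (S.latticeDatum.u i).comp S.Λ₀.subtype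
  ψ i := S.pbar₁Λ₀ (S.e i)
  F := S.F
  u_ψ i hi := S.bracket_self i hi

/-- The inclusion of `p̄₁(N)` into `M_I`. -/
def sublatticeIncl : S.sublatticeDatum.Hom S.latticeDatum where
  toHom := S.Λ₀.subtype
  F_eq := rfl
  u_apply _ _ := rfl
  ψ_apply _ := rfl

/-- The projection `p̄₁ : N → p̄₁(N)`. -/
def leafHom : S.xDatum.Hom S.sublatticeDatum where
  toHom := AddMonoidHom.mk' S.pbar₁Λ₀ fun _ _ ↦ Subtype.ext (map_add _ _ _)
  F_eq := rfl
  u_apply _ _ := rfl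
  ψ_apply _ := rfl

/-- The projection `M_I ⊕ N → M_I`. -/
def fibreHom : S.prin.aDatum.Hom S.latticeDatum where
  toHom := (LinearMap.dualMap (LinearMap.inl ℤ S.NI (Module.Dual ℤ N))).toAddMonoidHom
  F_eq := rfl
  u_apply _ _ := rfl
  ψ_apply i := by
    refine LinearMap.ext fun x ↦ ?_
    change S.bracket (S.e i) x.1 + (0 : Module.Dual ℤ N) (S.e i) - (0 : Module.Dual ℤ N) x.1 =
      S.bracket (S.e i) x.1
    simp

instance : IsDomain (AddMonoidAlgebra 𝕜 (Module.Dual ℤ S.NI)) := by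
  have : TwoUniqueSums (Module.Dual ℤ S.NI) :=
    TwoUniqueSums.of_injective_addHom
      (⟨fun m x ↦ m x, fun _ _ ↦ rfl⟩ : (Module.Dual ℤ S.NI) →ₙ+ (S.NI → ℤ))
      DFunLike.coe_injective inferInstance
  infer_instance

instance : IsDomain (AddMonoidAlgebra 𝕜 S.Λ₀) :=
  Function.Injective.isDomain (AddMonoidAlgebra.mapDomainRingHom 𝕜 S.Λ₀.subtype)
    (AddMonoidAlgebra.mapDomain_injective Subtype.val_injective)

variable {S}

lemma exists_bracket_eq_one (hS : S.IsAdmissible) {i : I} (hi : i ∈ S.F) :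
    ∃ n, S.bracket n (S.e i) = 1 :=
  exists_eq_one_of_primitive (hS.p₂_primitive i hi)

lemma exists_isBoundaryMonomial (hS : S.IsAdmissible) (i : I) :
    ∃ v, S.xDatum.IsBoundaryMonomial i v := by
  by_cases hi : i ∈ S.F
  · obtain ⟨n, hn⟩ := exists_bracket_eq_one hS hi
    have h1 : S.xDatum.u i n = 1 := hn
    exact ⟨⟨n, fun _ ↦ by rw [h1]; exact zero_le_one⟩, fun _ ↦ by rw [h1]; exact zero_lt_one,
      fun h ↦ (h hi).elim⟩
  · exact ⟨0, fun h ↦ (hi h).elim, fun _ ↦ rfl⟩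

lemma one_add_single_ne_zero {P : Type u} [AddCommGroup P] {p : P} {c : 𝕜}
    (h : p = 0 → c ≠ -1) : (1 + AddMonoidAlgebra.single p c : AddMonoidAlgebra 𝕜 P) ≠ 0 := by
  classical
  intro h0
  have h1 := congrArg (fun a ↦ a.coeff 0) h0
  simp only [AddMonoidAlgebra.coeff_add, Finsupp.add_apply, AddMonoidAlgebra.one_def,
    AddMonoidAlgebra.coeff_single, Finsupp.single_apply, AddMonoidAlgebra.coeff_zero,
    Finsupp.zero_apply, if_true] at h1
  by_cases hp : p = 0
  · rw [if_pos hp] at h1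
    exact h hp (eq_neg_of_add_eq_zero_right h1)
  · rw [if_neg hp, add_zero] at h1
    exact one_ne_zero h1

variable {φ : AddChar S.K₁ 𝕜} {t : AddChar N 𝕜}

variable (S φ t) in
/-- The assumptions on the seed `S` and on the points `φ` and `t` with `i(t) = φ` under which the
fibre `𝒜^⋆_t` is the universal torsor of `𝒳^⋆_φ`. -/
structure IsRegularPoint : Prop where
  admissible : S.IsAdmissible
  mem_K₁ : ∀ n : N, S.pbar₁ n = 0 → n ∈ S.K₁
  ne_neg_one : ∀ (i : I) (hi : S.e i ∈ S.K₁), i ∉ S.F → φ ⟨S.e i, hi⟩ ≠ -1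
  imagePoint_eq : S.imagePoint t = φ

/-- The condition on `φ` says that no wall contains the fibre. -/
lemma IsRegularPoint.one_add_ne_zero (h : S.IsRegularPoint φ t) {i : I} (hi : i ∉ S.F)
    {P : Type u} [AddCommGroup P] {p : P}
    (hp : p = 0 → S.pbar₁ (S.e i) = 0) :
    (1 + AddMonoidAlgebra.single p (t (S.e i)) : AddMonoidAlgebra 𝕜 P) ≠ 0 :=
  one_add_single_ne_zero fun h0 ↦ by
    have h1 := h.ne_neg_one i (h.mem_K₁ _ (hp h0)) hi
    have h2 := DFunLike.congr_fun h.imagePoint_eq ⟨S.e i, h.mem_K₁ _ (hp h0)⟩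
    rwa [← h2] at h1

/-- The charts of `𝒳^⋆_φ`. The monomial `z^n` restricts to `z^n(t) z^{p̄₁(n)}`: the point `t`
provides the extension of the character `φ` of `K₁` to `N`. -/
def IsRegularPoint.leafFibre (h : S.IsRegularPoint φ t) :
    MutationDatum.FibreDatum 𝕜 S.xDatum S.sublatticeDatum (S.xLeafIncl φ) where
  K := S.K₁
  k := S.K₁.subtype.toAddMonoidHom
  u_k i k := by
    change S.p₁ k.1 (S.e i) = 0
    rw [LinearMap.mem_ker.mp k.2]
    rfl
  φ := φ
  str := pullback.snd _ _
  isPullback := (IsPullback.of_hasPullback (S.lam 𝕜) (point φ)).flip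
  hom := S.leafHom
  surjective := by
    rintro ⟨_, n, rfl⟩
    exact ⟨n, rfl⟩
  ker_iff n := by
    refine ⟨fun h0 ↦ ⟨⟨n, h.mem_K₁ n (congrArg Subtype.val h0)⟩, rfl⟩, ?_⟩
    rintro ⟨x, rfl⟩
    refine Subtype.ext (LinearMap.ext fun y ↦ ?_)
    change S.p₁ x.1 y.1 = 0
    rw [LinearMap.mem_ker.mp x.2]
    rfl
  τ := t
  τ_k x := by rw [← h.imagePoint_eq]; rfl
  exists_isBoundaryMonomial := exists_isBoundaryMonomial h.admissible
  twistedMap_wall_ne_zero i := by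
    by_cases hi : i ∈ S.xDatum.F
    · rw [MutationDatum.wall, if_pos hi, map_one]
      exact one_ne_zero
    · rw [MutationDatum.wall, if_neg hi, map_add, map_one, twistedMap_single, one_mul]
      exact h.one_add_ne_zero hi (congrArg Subtype.val)

lemma fibreHom_prinChar (m : Module.Dual ℤ S.NI) (n : N) :
    S.fibreHom.toHom (S.prinChar m n) = m := by
  refine LinearMap.ext fun x ↦ ?_
  change S.prinChar m n (x, 0) = m x
  rw [prinChar_apply]
  exact add_zero _

variable [Module.Free ℤ N] [Module.Finite ℤ N]

/-- The projection `M_I ⊕ N → N`. -/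
def prinSnd (S : Seed N I) : Module.Dual ℤ (S.NI × Module.Dual ℤ N) →+ N :=
  ((Module.evalEquiv ℤ N).symm.toLinearMap ∘ₗ
    LinearMap.dualMap (LinearMap.inr ℤ S.NI (Module.Dual ℤ N))).toAddMonoidHom

lemma prinSnd_prinChar (m : Module.Dual ℤ S.NI) (n : N) : S.prinSnd (S.prinChar m n) = n := by
  refine (LinearEquiv.symm_apply_eq _).mpr (LinearMap.ext fun f ↦ ?_)
  change S.prinChar m n (0, f) = f n
  rw [prinChar_apply, map_zero, zero_add]

lemma prinChar_prinSnd (μ : Module.Dual ℤ (S.NI × Module.Dual ℤ N)) :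
    S.prinChar (S.fibreHom.toHom μ) (S.prinSnd μ) = μ := by
  refine LinearMap.ext fun x ↦ ?_
  have h1 : x.2 (S.prinSnd μ) = μ (0, x.2) :=
    LinearMap.congr_fun ((Module.evalEquiv ℤ N).apply_symm_apply
      (LinearMap.dualMap (LinearMap.inr ℤ S.NI (Module.Dual ℤ N)) μ)) x.2
  have h2 : S.fibreHom.toHom μ x.1 = μ (x.1, 0) := rfl
  rw [prinChar_apply, h1, h2, ← map_add]
  congr 1
  exact Prod.ext (add_zero _) (zero_add _)

/-- The charts of `𝒜^⋆_t`. The monomial `z^{(m, n)}` restricts to `z^n(t) z^m`. -/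
def IsRegularPoint.torsorFibre (h : S.IsRegularPoint φ t) :
    MutationDatum.FibreDatum 𝕜 S.prin.aDatum S.latticeDatum (S.aFibreIncl t) where
  K := N
  k := S.piHom
  u_k i n := by
    change S.prinChar 0 n (S.eI i, 0) = 0
    simp [prinChar_apply]
  φ := t
  str := pullback.snd _ _
  isPullback := (IsPullback.of_hasPullback (S.pi 𝕜) (point t)).flip
  hom := S.fibreHom
  surjective m := ⟨S.prinChar m 0, fibreHom_prinChar m 0⟩
  ker_iff μ := by
    constructor
    · intro h0
      refine ⟨S.prinSnd μ, ?_⟩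
      rw [← prinChar_prinSnd μ, h0, prinSnd_prinChar]
      rfl
    · rintro ⟨n, rfl⟩
      exact fibreHom_prinChar 0 n
  τ := t.compAddMonoidHom S.prinSnd
  τ_k n := congrArg t (prinSnd_prinChar 0 n)
  exists_isBoundaryMonomial i := by
    obtain ⟨v, hv⟩ := exists_isBoundaryMonomial h.admissible i
    exact ⟨_, S.ptildeHom.isBoundaryMonomial_onChart hv⟩
  twistedMap_wall_ne_zero i := by
    by_cases hi : i ∈ S.prin.aDatum.F
    · rw [MutationDatum.wall, if_pos hi, map_one]
      exact one_ne_zero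
    · rw [MutationDatum.wall, if_neg hi, map_add, map_one, twistedMap_single, one_mul,
        S.fibreHom.ψ_apply]
      have h1 : (t.compAddMonoidHom S.prinSnd) (S.prin.aDatum.ψ i) = t (S.e i) := by
        rw [← S.ptildeHom.ψ_apply]
        exact congrArg t (prinSnd_prinChar _ _)
      rw [h1]
      exact h.one_add_ne_zero hi id

lemma IsRegularPoint.isMap_pFibre (h : S.IsRegularPoint φ t) :
    MutationDatum.FibreDatum.IsMap h.leafFibre h.torsorFibre S.ptildeHom
      S.sublatticeIncl (S.pFibre h.imagePoint_eq) where
  comp_incl := S.pFibre_incl h.imagePoint_eq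
  comp_str := pullback.lift_snd _ _ _
  hom_comp n := fibreHom_prinChar _ n
  τ_comp n := congrArg t (prinSnd_prinChar _ n)

end Seed

namespace Seed

/-! ### The divisors on the leaves -/

variable {𝕜 N I : Type u} [Field 𝕜] [AddCommGroup N] {S : Seed N I} {φ : AddChar S.K₁ 𝕜}
  {t : AddChar N 𝕜} (h : S.IsRegularPoint φ t)

namespace IsRegularPoint

lemma leafTorus_eq : S.leafTorus φ = h.leafFibre.torus ''ᵁ ⊤ := h.leafFibre.image_torus.symm

lemma leafChart_eq (i : I) : S.leafChart φ i = h.leafFibre.chart i ''ᵁ ⊤ :=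
  (h.leafFibre.image_chart i).symm

lemma exists_mem_eqnOpen (h : S.IsRegularPoint φ t) (x : S.xLeaf φ) :
    ∃ j, x ∈ S.eqnOpen φ j := by
  obtain hx | ⟨i, hx⟩ := h.leafFibre.mem_torus_or_mem_chart x
  · exact ⟨.torus, h.leafTorus_eq.ge hx⟩
  · by_cases hi : i ∈ S.F
    · obtain ⟨n, hn⟩ := exists_bracket_eq_one h.admissible hi
      exact ⟨.frozen i hi n hn, (h.leafChart_eq i).ge hx⟩
    · exact ⟨.unfrozen i hi, (h.leafChart_eq i).ge hx⟩

variable [IsIntegral (S.xLeaf φ)]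

lemma eqn_torus (m : Module.Dual ℤ S.NI) :
    ((S.divisors φ).eqn .torus m).toMul = 1 := rfl

lemma eqn_unfrozen (i : I) (hi : i ∉ S.F) (m : Module.Dual ℤ S.NI) :
    ((S.divisors φ).eqn (.unfrozen i hi) m).toMul = h.leafFibre.wallRatUnit i ^ m (S.eI i) := by
  have h1 : ratFun (S.leafChartFun φ i (1 + AddMonoidAlgebra.single (S.chartE i hi) 1)) =
      h.leafFibre.wallRat i := by
    have h2 : S.xDatum.chartWall 𝕜 i = 1 + AddMonoidAlgebra.single (S.chartE i hi) 1 :=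
      dif_neg hi
    rw [← MutationDatum.FibreDatum.chartRat_chart_chartWall,
      ← MutationDatum.FibreDatum.ratFun_chartFun, h2]
    rfl
  change ratUnit (ratFun (S.leafChartFun φ i (1 + AddMonoidAlgebra.single (S.chartE i hi) 1))) ^
    m (S.eI i) = _
  rw [h1, ratUnit, dif_neg (h.leafFibre.wallRat_ne_zero i)]
  rfl

/-- The monomial `z^n` on `𝒳^⋆_φ`, as an invertible rational function. -/
def leafMonomial (n : N) : ((S.xLeaf φ).functionField)ˣ :=
  Units.map h.leafFibre.const.toMonoidHom (Units.mk0 (t n) (t.val_isUnit n).ne_zero) *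
    (h.leafFibre.monomial (S.pbar₁Λ₀ n)).toMul

lemma coe_leafMonomial (n : N) : (h.leafMonomial n : (S.xLeaf φ).functionField) =
    h.leafFibre.const (t n) *
      ((h.leafFibre.monomial (S.pbar₁Λ₀ n)).toMul : (S.xLeaf φ).functionField) := rfl

lemma eqn_frozen (i : I) (hi : i ∈ S.F) (n : N) (hn : S.bracket n (S.e i) = 1)
    (m : Module.Dual ℤ S.NI) :
    ((S.divisors φ).eqn (.frozen i hi n hn) m).toMul = h.leafMonomial n ^ m (S.eI i) := by
  have h1 : ratFun (S.leafChartFun φ i (AddMonoidAlgebra.single (S.chartN i n hn) 1)) =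
      h.leafMonomial n := by
    rw [leafChartFun]
    refine (h.leafFibre.ratFun_chartFun i _).trans ?_
    rw [MutationDatum.FibreDatum.onChart, twistedMap_single, one_mul,
      MutationDatum.FibreDatum.chartRat_chart_eq, h.leafFibre.chartMonomial_of_mem hi]
    rfl
  change ratUnit (ratFun (S.leafChartFun φ i (AddMonoidAlgebra.single (S.chartN i n hn) 1))) ^
    m (S.eI i) = _
  rw [h1, ratUnit, dif_neg (Units.ne_zero _)]
  congr 1
  exact Units.ext rfl

/-- The local equations are units on the torus. -/
lemma eqn_mem_unitsAt (h : S.IsRegularPoint φ t) {x : S.xLeaf φ} (hx : x ∈ S.leafTorus φ)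
    (j : S.EqnIdx) (hj : x ∈ S.eqnOpen φ j) (m : Module.Dual ℤ S.NI) :
    ((S.divisors φ).eqn j m).toMul ∈ unitsAt x := by
  have hx' : x ∈ h.leafFibre.torus ''ᵁ ⊤ := h.leafTorus_eq.le hx
  cases j with
  | torus => exact one_mem _
  | unfrozen i hi =>
    rw [h.eqn_unfrozen]
    refine zpow_mem (h.leafFibre.wallRatUnit_mem_unitsAt hi ?_ hx' ((h.leafChart_eq i).le hj)) _
    obtain ⟨n, hn⟩ := DFunLike.ne_iff.mp (h.admissible.p₂_ne_zero i)
    exact ⟨S.pbar₁Λ₀ n, hn⟩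
  | frozen i hi n hn =>
    rw [h.eqn_frozen]
    exact zpow_mem (mul_mem (h.leafFibre.map_const_mem_unitsAt _ _)
      (h.leafFibre.monomial_mem_unitsAt hx' _)) _

lemma eqn_div_eqn_mem_unitsAt (h : S.IsRegularPoint φ t) {x : S.xLeaf φ} (j j' : S.EqnIdx)
    (hj : x ∈ S.eqnOpen φ j) (hj' : x ∈ S.eqnOpen φ j') (m : Module.Dual ℤ S.NI) :
    ((S.divisors φ).eqn j m).toMul / ((S.divisors φ).eqn j' m).toMul ∈ unitsAt x := by
  by_cases hx : x ∈ S.leafTorus φ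
  · exact div_mem (h.eqn_mem_unitsAt hx j hj m) (h.eqn_mem_unitsAt hx j' hj' m)
  have hne : ∀ i i', x ∈ S.leafChart φ i → x ∈ S.leafChart φ i' → i = i' := fun i i' hi hi' ↦ by
    by_contra hii
    exact hx (h.leafTorus_eq.ge (h.leafFibre.mem_torus_of_mem_chart hii ((h.leafChart_eq i).le hi)
      ((h.leafChart_eq i').le hi')))
  cases j with
  | torus => exact (hx hj).elim
  | unfrozen i hi =>
    cases j' with
    | torus => exact (hx hj').elim
    | unfrozen i' hi' =>
      obtain rfl := hne i i' hj hj'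
      rw [div_self']
      exact one_mem _
    | frozen i' hi' n' hn' => exact (hi (hne i i' hj hj' ▸ hi')).elim
  | frozen i hi n hn =>
    cases j' with
    | torus => exact (hx hj').elim
    | unfrozen i' hi' => exact (hi' (hne i i' hj hj' ▸ hi)).elim
    | frozen i' hi' n' hn' =>
      obtain rfl := hne i i' hj hj'
      rw [h.eqn_frozen, h.eqn_frozen, ← div_zpow]
      refine zpow_mem ?_ _
      rw [leafMonomial, leafMonomial, mul_div_mul_comm]
      refine mul_mem (div_mem (h.leafFibre.map_const_mem_unitsAt _ _)
        (h.leafFibre.map_const_mem_unitsAt _ _)) ?_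
      rw [← toMul_sub, ← map_sub, ← h.leafFibre.chartMonomial_of_mem hi]
      refine h.leafFibre.chartMonomial_mem_unitsAt ((h.leafChart_eq i).le hj) fun _ ↦ ?_
      rw [map_sub]
      change S.bracket n (S.e i) - S.bracket n' (S.e i) = 0
      rw [hn, hn', sub_self]

/-- The local equations define Cartier divisors. -/
lemma isCartier (h : S.IsRegularPoint φ t) : (S.divisors φ).IsCartier := by
  refine ⟨h.exists_mem_eqnOpen, fun j j' x hj hj' m ↦ ?_⟩
  obtain ⟨v, hv⟩ := h.eqn_div_eqn_mem_unitsAt j j' hj hj' m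
  refine ⟨v, ?_⟩
  have h1 := congrArg Units.val (eq_div_iff_mul_eq'.mp hv)
  exact h1.symm

/-- The shifting family `p̄₁(n) ↦ z^n(t) z^(-n)`. -/
def shift : S.Λ₀ →+ Additive ((S.xLeaf φ).functionField)ˣ := -h.leafFibre.monomial

lemma coe_shift_pbar₁ (n : N) : ((h.shift (S.pbar₁Λ₀ n)).toMul : (S.xLeaf φ).functionField) =
    ratFun (S.leafTorusFun φ (AddMonoidAlgebra.single (-n) (t n))) := by
  rw [leafTorusFun]
  refine Eq.trans ?_ (h.leafFibre.ratFun_torusFun _).symm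
  have h1 : t n * t (-n) = 1 := by
    rw [← AddChar.map_add_eq_mul, add_neg_cancel, AddChar.map_zero_eq_one]
  rw [MutationDatum.FibreDatum.onTorus, twistedMap_single]
  have h2 : t n * h.leafFibre.τ (-n) = 1 := h1
  rw [h2]
  change ((-h.leafFibre.monomial (S.pbar₁Λ₀ n)).toMul : (S.xLeaf φ).functionField) = _
  rw [← map_neg, MutationDatum.FibreDatum.coe_monomial]
  congr 2
  exact (map_neg S.leafHom.toHom n).symm

/-- On every chart, the local equation of the divisor of `m ∈ Λ₀` agrees with the monomial `z^m` up
to a unit. -/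
lemma isShiftingFamily_shift : (S.divisors φ).IsShiftingFamily h.shift := by
  refine DivisorLattice.isShiftingFamily_of_regularAt h.isCartier fun x ↦ ?_
  obtain ⟨j, hj⟩ := h.exists_mem_eqnOpen x
  refine ⟨j, hj, fun m ↦ ?_⟩
  have h0 : (h.shift m).toMul = (h.leafFibre.monomial (-m)).toMul := by
    rw [map_neg]
    rfl
  rw [h0, ← Units.val_mul]
  cases j with
  | torus =>
    rw [eqn_torus, one_mul]
    exact (mem_unitsAt_iff.mp (h.leafFibre.monomial_mem_unitsAt (h.leafTorus_eq.le hj) _)).1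
  | unfrozen i hi =>
    have h1 := (mem_unitsAt_iff.mp (h.leafFibre.chartMonomial_mem_unitsAt
      ((h.leafChart_eq i).le hj) (p := -m) fun hi' ↦ (hi hi').elim)).1
    rw [h.eqn_unfrozen, mul_comm]
    rwa [MutationDatum.FibreDatum.chartMonomial, map_neg (S.sublatticeDatum.u i), neg_neg] at h1
  | frozen i hi n hn =>
    have h1 := (mem_unitsAt_iff.mp (h.leafFibre.chartMonomial_mem_unitsAt
      ((h.leafChart_eq i).le hj) (p := m.1 (S.eI i) • S.pbar₁Λ₀ n - m) fun _ ↦ by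
        rw [map_sub, map_zsmul]
        change m.1 (S.eI i) • S.bracket n (S.e i) - m.1 (S.eI i) = 0
        rw [hn, smul_eq_mul, mul_one, sub_self])).1
    rw [h.eqn_frozen, leafMonomial, mul_zpow, mul_assoc, Units.val_mul]
    refine mul_mem (mem_unitsAt_iff.mp (zpow_mem (h.leafFibre.map_const_mem_unitsAt _ _) _)).1 ?_
    rwa [h.leafFibre.chartMonomial_of_mem hi, sub_eq_add_neg, map_add, map_zsmul, toMul_add,
      toMul_zsmul] at h1

end IsRegularPoint

end Seed

namespace Seed

/-! ### The fibres of the cluster variety with principal coefficients -/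

variable {𝕜 N I : Type u} [Field 𝕜] [AddCommGroup N] [Module.Free ℤ N] [Module.Finite ℤ N]
  {S : Seed N I} {φ : AddChar S.K₁ 𝕜} {t : AddChar N 𝕜} (h : S.IsRegularPoint φ t)

namespace IsRegularPoint

lemma ratFun_fibreMonomial [IsIntegral (S.aFibre t)] (m : Module.Dual ℤ S.NI) :
    ratFun (S.fibreMonomial t m) =
    ((h.torsorFibre.monomial m).toMul : (S.aFibre t).functionField) := by
  refine (h.torsorFibre.ratFun_torusFun _).trans ?_
  have h1 : h.torsorFibre.τ (S.prinChar m 0) = 1 :=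
    (congrArg t (prinSnd_prinChar m 0)).trans t.map_zero_eq_one
  have h2 : h.torsorFibre.hom.toHom (S.prinChar m 0) = m := fibreHom_prinChar m 0
  rw [MutationDatum.FibreDatum.onTorus, twistedMap_single, h1, h2, mul_one]
  rfl

variable [IsIntegral (S.xLeaf φ)] [IsIntegral (S.aFibre t)]

lemma pFibre_genericPoint : S.pFibre h.imagePoint_eq (genericPoint (S.aFibre t)) =
    genericPoint (S.xLeaf φ) :=
  h.isMap_pFibre.genericPoint_eq Subtype.val_injective

/-- The pull back of rational functions from `𝒳^⋆_φ` to `𝒜^⋆_t`. -/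
abbrev pull : (S.xLeaf φ).functionField →+* (S.aFibre t).functionField :=
  ratPull (S.pFibre h.imagePoint_eq) h.pFibre_genericPoint

lemma pull_shift_mul_monomial (m : S.Λ₀) :
    h.pull ((h.shift m).toMul : (S.xLeaf φ).functionField) *
      ((h.torsorFibre.monomial m).toMul : (S.aFibre t).functionField) = 1 := by
  have h1 : Units.map h.pull.toMonoidHom (h.shift m).toMul =
      (h.torsorFibre.monomial m).toMul⁻¹ := by
    change Units.map h.pull.toMonoidHom (h.leafFibre.monomial m).toMul⁻¹ = _
    rw [map_inv, h.isMap_pFibre.map_ratPull_monomial h.pFibre_genericPoint]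
    rfl
  have h2 := congrArg Units.val (eq_inv_iff_mul_eq_one.mp h1)
  exact h2

lemma map_pull_leafMonomial (n : N) : Units.map h.pull.toMonoidHom (h.leafMonomial n) =
    Units.map h.torsorFibre.const.toMonoidHom (Units.mk0 (t n) (t.val_isUnit n).ne_zero) *
      (h.torsorFibre.monomial (S.pbar₁ n)).toMul := by
  rw [leafMonomial, map_mul]
  congr 1
  · exact Units.ext (h.isMap_pFibre.ratPull_const h.pFibre_genericPoint _)
  · exact h.isMap_pFibre.map_ratPull_monomial h.pFibre_genericPoint _

/-- The divisor of `m ∈ M_I` becomes trivial on `𝒜^⋆_t`, where its local equation is, up to a unit,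
the monomial `z^m`. -/
lemma isTrivializedBy : (S.divisors φ).IsTrivializedBy (S.pFibre h.imagePoint_eq)
    h.pFibre_genericPoint h.torsorFibre.monomial := by
  intro y
  suffices ∃ j : S.EqnIdx, S.pFibre h.imagePoint_eq y ∈ S.eqnOpen φ j ∧ ∀ m, ∃ z ∈ unitsAt y,
      z * Units.map h.pull.toMonoidHom ((S.divisors φ).eqn j m).toMul =
        (h.torsorFibre.monomial m).toMul by
    obtain ⟨j, hj, hz⟩ := this
    refine ⟨j, hj, fun m ↦ ?_⟩
    obtain ⟨z, hz, h1⟩ := hz m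
    have h2 := congrArg Units.val h1
    exact ⟨z, (mem_unitsAt_iff.mp hz).1, h2⟩
  obtain hy | ⟨i, hy⟩ := h.torsorFibre.mem_torus_or_mem_chart y
  · refine ⟨.torus, h.leafTorus_eq.ge (h.isMap_pFibre.preimage_torus.ge hy), fun m ↦
      ⟨_, h.torsorFibre.monomial_mem_unitsAt hy m, ?_⟩⟩
    rw [eqn_torus, map_one, mul_one]
  have hy' := (h.leafChart_eq i).ge ((h.isMap_pFibre.preimage_chart i).ge hy)
  by_cases hi : i ∈ S.F
  · obtain ⟨n, hn⟩ := exists_bracket_eq_one h.admissible hi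
    refine ⟨.frozen i hi n hn, hy', fun m ↦ ?_⟩
    -- The local equation is a multiple of `z^{p̄₁(n)}`, where `[n, e_i] = 1`, so its power of
    -- exponent `⟨m, e_i⟩` differs from `z^m` by a monomial which is a unit along the boundary.
    have h1 : S.latticeDatum.u i (m - m (S.eI i) • S.pbar₁ n) = 0 := by
      rw [map_sub, map_zsmul]
      change m (S.eI i) - m (S.eI i) • S.bracket n (S.e i) = 0
      rw [hn, smul_eq_mul, mul_one, sub_self]
    refine ⟨_, mul_mem (zpow_mem (h.torsorFibre.map_const_mem_unitsAt
      (Units.mk0 (t n) (t.val_isUnit n).ne_zero) y) (-m (S.eI i)))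
      (h.torsorFibre.chartMonomial_mem_unitsAt hy fun _ ↦ h1), ?_⟩
    rw [h.eqn_frozen, map_zpow, h.map_pull_leafMonomial,
      h.torsorFibre.chartMonomial_of_mem (i := i) hi, mul_zpow, map_sub, map_zsmul, toMul_sub,
      toMul_zsmul, zpow_neg]
    rw [mul_mul_mul_comm, inv_mul_cancel, one_mul, div_mul_cancel]
  · -- On a mutated chart, `z^m (1 + z^{e_i})^{-⟨m, e_i⟩}` is a coordinate.
    refine ⟨.unfrozen i hi, hy', fun m ↦ ⟨_, h.torsorFibre.chartMonomial_mem_unitsAt hy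
      (p := m) fun hi' ↦ (hi hi').elim, ?_⟩⟩
    rw [h.eqn_unfrozen, map_zpow, h.isMap_pFibre.map_ratPull_wallRatUnit h.pFibre_genericPoint,
      MutationDatum.FibreDatum.chartMonomial]
    change _ * _ ^ (-m (S.eI i)) * _ = _
    rw [zpow_neg, inv_mul_cancel_right]

lemma exists_monomialEval_eq_torus (a : AddMonoidAlgebra 𝕜 (Module.Dual ℤ S.NI)) :
    ∃ F : AddMonoidAlgebra (S.xLeaf φ).functionField (Module.Dual ℤ S.NI),
      (∀ x ∈ S.leafTorus φ, F ∈ (S.divisors φ).stalkRing x) ∧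
        monomialEval h.pull h.torsorFibre.monomial F = chartRat h.torsorFibre.torus a := by
  induction a using AddMonoidAlgebra.induction_linear with
  | zero => exact ⟨0, fun _ _ ↦ zero_mem _, by rw [map_zero, map_zero]⟩
  | add a b ha hb =>
    obtain ⟨F, hF, ha⟩ := ha
    obtain ⟨G, hG, hb⟩ := hb
    exact ⟨F + G, fun x hx ↦ add_mem (hF x hx) (hG x hx), by rw [map_add, map_add, ha, hb]⟩
  | single m c =>
    refine ⟨AddMonoidAlgebra.single m (h.leafFibre.const c), fun x hx ↦
      DivisorLattice.single_mem_stalkRing ?_, ?_⟩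
    · rw [DivisorLattice.mem_stalk_iff h.isCartier (j := .torus) hx, eqn_torus, Units.val_one,
        one_mul]
      exact h.leafFibre.const_mem_regularAt c x
    · rw [monomialEval_single, h.isMap_pFibre.ratPull_const h.pFibre_genericPoint,
        ← MutationDatum.FibreDatum.chartRat_torus_single]

/-- The coordinate `z^m (1 + z^{e_i})^{-⟨m, e_i⟩}` of a chart is the image of a section of
`𝒪_X(m) z^m`. On a frozen chart, this uses that `⟨m, e_i⟩ ≥ 0`. -/
lemma exists_monomialEval_eq_chart (i : I)
    (a : AddMonoidAlgebra 𝕜 (S.latticeDatum.chartMonoid i)) :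
    ∃ F : AddMonoidAlgebra (S.xLeaf φ).functionField (Module.Dual ℤ S.NI),
      (∀ x ∈ S.leafChart φ i, F ∈ (S.divisors φ).stalkRing x) ∧
        monomialEval h.pull h.torsorFibre.monomial F = chartRat (h.torsorFibre.chart i) a := by
  induction a using AddMonoidAlgebra.induction_linear with
  | zero => exact ⟨0, fun _ _ ↦ zero_mem _, by rw [map_zero, map_zero]⟩
  | add a b ha hb =>
    obtain ⟨F, hF, ha⟩ := ha
    obtain ⟨G, hG, hb⟩ := hb
    exact ⟨F + G, fun x hx ↦ add_mem (hF x hx) (hG x hx), by rw [map_add, map_add, ha, hb]⟩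
  | single m c =>
    refine ⟨AddMonoidAlgebra.single m.1 (h.leafFibre.const c *
      ((h.leafFibre.wallRatUnit i ^ (-m.1 (S.eI i)) : (S.xLeaf φ).functionFieldˣ) :
        (S.xLeaf φ).functionField)), fun x hx ↦ DivisorLattice.single_mem_stalkRing ?_, ?_⟩
    · by_cases hi : i ∈ S.F
      · obtain ⟨n, hn⟩ := exists_bracket_eq_one h.admissible hi
        rw [DivisorLattice.mem_stalk_iff h.isCartier (j := .frozen i hi n hn) hx, h.eqn_frozen,
          h.leafFibre.wallRatUnit_of_mem (i := i) hi, one_zpow, Units.val_one, mul_one]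
        refine mul_mem ?_ (h.leafFibre.const_mem_regularAt c x)
        obtain ⟨k, hk⟩ := Int.eq_ofNat_of_zero_le (show 0 ≤ m.1 (S.eI i) from m.2 hi)
        rw [hk, zpow_natCast, Units.val_pow_eq_pow_val, h.coe_leafMonomial]
        refine pow_mem (mul_mem (h.leafFibre.const_mem_regularAt _ x) ?_) k
        rw [← h.leafFibre.chartMonomial_of_mem (i := i) hi]
        refine h.leafFibre.chartMonomial_mem_regularAt ((h.leafChart_eq i).le hx) fun _ ↦ ?_
        change 0 ≤ S.bracket n (S.e i)
        rw [hn]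
        exact zero_le_one
      · rw [DivisorLattice.mem_stalk_iff h.isCartier (j := .unfrozen i hi) hx, h.eqn_unfrozen,
          mul_left_comm, ← Units.val_mul, zpow_neg, mul_inv_cancel, Units.val_one, mul_one]
        exact h.leafFibre.const_mem_regularAt c x
    · have h1 := congrArg Units.val (map_zpow (Units.map h.pull.toMonoidHom)
        (h.leafFibre.wallRatUnit i) (-m.1 (S.eI i)))
      rw [h.isMap_pFibre.map_ratPull_wallRatUnit h.pFibre_genericPoint] at h1
      rw [monomialEval_single, map_mul, h.isMap_pFibre.ratPull_const h.pFibre_genericPoint,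
        MutationDatum.FibreDatum.chartRat_chart_eq, MutationDatum.FibreDatum.chartMonomial,
        mul_assoc, Units.val_mul]
      congr 1
      rw [mul_comm]
      congr 1

lemma isGeneratedBy : (S.divisors φ).IsGeneratedBy (S.pFibre h.imagePoint_eq)
    h.pFibre_genericPoint h.torsorFibre.monomial := by
  have := h.isMap_pFibre.isAffineHom
  refine DivisorLattice.isGeneratedBy_of_affine fun x ↦ ?_
  obtain hx | ⟨i, hx⟩ := h.leafFibre.mem_torus_or_mem_chart x
  · refine ⟨_, hx, (isAffineOpen_top _).image_of_isOpenImmersion _, fun b ↦ ?_⟩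
    obtain ⟨a, ha⟩ := exists_chartRat_eq h.torsorFibre.torus h.isMap_pFibre.preimage_torus b
    obtain ⟨F, hF, h1⟩ := h.exists_monomialEval_eq_torus a
    exact ⟨F, fun x' hx' ↦ hF x' (h.leafTorus_eq.ge hx'), h1.trans ha⟩
  · refine ⟨_, hx, (isAffineOpen_top _).image_of_isOpenImmersion _, fun b ↦ ?_⟩
    obtain ⟨a, ha⟩ := exists_chartRat_eq (h.torsorFibre.chart i)
      (h.isMap_pFibre.preimage_chart i) b
    obtain ⟨F, hF, h1⟩ := h.exists_monomialEval_eq_chart i a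
    exact ⟨F, fun x' hx' ↦ hF x' ((h.leafChart_eq i).ge hx'), h1.trans ha⟩

lemma eq_zero_of_isNormal {F : AddMonoidAlgebra (S.xLeaf φ).functionField (Module.Dual ℤ S.NI)}
    (hF : IsNormal S.Λ₀ F) (h0 : monomialEval h.pull h.torsorFibre.monomial F = 0) : F = 0 :=
  eq_zero_of_isNormal_of_monomialEval_eq_zero h.leafFibre.torus h.torsorFibre.torus
    (fun a ↦ h.isMap_pFibre.ratPull_chartRat_torus h.pFibre_genericPoint a) (fun _ ↦ rfl) hF h0

lemma isPtildeSharp : S.IsPtildeSharp h.imagePoint_eq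
    (DivisorLattice.evalSheafHom h.isTrivializedBy) := by
  refine ⟨DivisorLattice.evalSheafHom_ofRegular h.isTrivializedBy, fun U _ s m r hr ↦
    section_ext fun hY ↦ ?_⟩
  have hU : genericPoint (S.xLeaf φ) ∈ U := h.pFibre_genericPoint ▸ hY.1
  rw [← ratHom_apply hY (_ * _), map_mul, ratHom_apply, ratHom_apply]
  refine (ratFun_res hY _ _).trans ?_
  refine Eq.trans ?_ (congrArg₂ (· * ·) (ratFun_res hY _ _) (ratFun_res hY _ _)).symm
  refine (DivisorLattice.ratFun_evalSheafHom h.isTrivializedBy r hU).trans ?_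
  rw [DivisorLattice.evalRat_eq hU ⟨_, hU⟩, hr, monomialEval_single, h.ratFun_fibreMonomial,
    ratPull_ratFun _ _ hU]

end IsRegularPoint

end Seed

end Cluster

end

open CategoryTheory AlgebraicGeometry Opposite in
theorem theorem3p5 {𝕜 N I : Type u} [Field 𝕜] [AddCommGroup N] [Module.Free ℤ N]
    [Module.Finite ℤ N] (S : Cluster.Seed N I) (hS : S.IsAdmissible)
    (hK : ∀ n : N, S.pbar₁ n = 0 → n ∈ S.K₁)
    (φ : AddChar S.K₁ 𝕜)
    (hφ : ∀ (i : I) (hi : S.e i ∈ S.K₁), i ∉ S.F → φ ⟨S.e i, hi⟩ ≠ -1)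
    (t : AddChar N 𝕜) (ht : S.imagePoint t = φ) :
    ∃ _ : AlgebraicGeometry.IsIntegral (S.xLeaf φ),
      (S.divisors φ).IsCartier ∧
      ∃ ρ : S.Λ₀ →+ Additive ((S.xLeaf φ).functionField)ˣ,
        (∀ n : N, ((ρ (S.pbar₁Λ₀ n)).toMul : (S.xLeaf φ).functionField) =
          Cluster.ratFun (S.leafTorusFun φ (AddMonoidAlgebra.single (-n) (t n)))) ∧
        (S.divisors φ).IsShiftingFamily ρ ∧
        ∃ (hρ : (S.divisors φ).IsQuasiCoherent ρ)
          (θ : (S.divisors φ).sheafR ⟶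
            (TopologicalSpace.Opens.map (S.pFibre ht).base).op ⋙ (S.aFibre t).presheaf)
          (hθ : ∀ U : (S.xLeaf φ).Opens, ∀ r ∈ (S.divisors φ).shiftIdeal ρ U,
            (θ.app (op U)).hom r = 0)
          (Φ : S.aFibre t ≅ (S.divisors φ).universalTorsor ρ hρ),
          S.IsPtildeSharp ht θ ∧
          Φ.hom ≫ Cluster.DivisorLattice.universalTorsor.toBase hρ = S.pFibre ht ∧
          ∀ U : (S.xLeaf φ).affineOpens,
            (S.pFibre ht ⁻¹ᵁ U.1).ι ≫ Φ.hom =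
              (S.pFibre ht ⁻¹ᵁ U.1).toSpecΓ ≫
                Spec.map (CommRingCat.ofHom (Ideal.Quotient.lift
                  ((S.divisors φ).shiftIdeal ρ U.1) (θ.app (op U.1)).hom (hθ U.1))) ≫
                Cluster.DivisorLattice.universalTorsor.overAffine hρ U := by
  have h : S.IsRegularPoint φ t := ⟨hS, hK, hφ, ht⟩
  have hX : AlgebraicGeometry.IsIntegral (S.xLeaf φ) := h.leafFibre.isIntegral
  have hY : AlgebraicGeometry.IsIntegral (S.aFibre t) := h.torsorFibre.isIntegral
  have hp : AlgebraicGeometry.IsAffineHom (S.pFibre ht) := h.isMap_pFibre.isAffineHom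
  have hθ := Cluster.DivisorLattice.evalSheafHom_shiftIdeal h.isTrivializedBy
    h.pull_shift_mul_monomial
  obtain ⟨hρ, Φ, hΦ, hΦ'⟩ := Cluster.DivisorLattice.exists_iso_universalTorsor (S.divisors φ)
    h.shift (S.pFibre ht) (Cluster.DivisorLattice.evalSheafHom h.isTrivializedBy) hθ
    (Cluster.DivisorLattice.evalSheafHom_ofRegular h.isTrivializedBy)
    (Cluster.DivisorLattice.evalSheafHom_bijective h.isCartier h.isShiftingFamily_shift
      h.isTrivializedBy h.pull_shift_mul_monomial (fun _ ↦ h.eq_zero_of_isNormal) h.isGeneratedBy)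
  exact ⟨hX, h.isCartier, h.shift, h.coe_shift_pbar₁, h.isShiftingFamily_shift, hρ, _, hθ, Φ,
    h.isPtildeSharp, hΦ, hΦ'⟩
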